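/- Let $M$ be a smooth manifold (finite-dimensional, Hausdorff, second countable), and let $A\to M$ be a Lie algebroid, i.e. a smooth vector bundle of finite rank together with an odd vector field $\mathrm d_A$ on the supermanifold $\Pi A$ (whose functions are the smooth sections of $\Lambda A^*$) that satisfies $\mathrm d_A^2=0$ and has weight one, $l_t^*\circ \mathrm d_A=t\,\mathrm d_A\circ l_t^*$ for all $t\in\mathbb R$, where $l_t$ is multiplication by $t$ in the fibres. For a section $u=u^ie_i$ of $A$ let $\iota_u=u^i\,\partial/\partial\xi^i\in\mathrm{Vect}(\Pi A)$. The bracket and the anchor of $A$ are given by $\iota_{[u,v]_A}=[[\mathrm d_A,\iota_u],\iota_v]$ and $\rho_u(f)=[\mathrm d_A,\iota_u](f)$; these conditions determine them uniquely. Let $F$ be a graded bundle over $M$, i.e. a smooth manifold with a smooth action $h:\mathbb R\times F\to F$ of the multiplicative monoid $(\mathbb R,\cdot)$ such that $M=h_0(F)$, with projection $\tau=h_0:F\to M$. Let $p_{\Pi A}:\tau^*\Pi A\to\Pi A$ and $p_F:\tau^*\Pi A\to F$ be the projections of the pullback, and write $h_t,l_t,\iota_u$ also for the induced maps and vector fields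 on $\tau^*\Pi A=\Pi A\times_MF$. A *weighted $A$-connection* on $F$ is an odd vector field $\nabla$ on $\tau^*\Pi A$ of bi-weight $(0,1)$, i.e. $h_t^*\circ\nabla=\nabla\circ h_t^*$ and $l_t^*\circ\nabla=t\,\nabla\circ l_t^*$ for all $t\in\mathbb R$, that projects to $\mathrm d_A$, i.e. $\nabla\circ p_{\Pi A}^*=p_{\Pi A}^*\circ \mathrm d_A$. It is *flat* if $\nabla^2=\tfrac12[\nabla,\nabla]=0$. An *infinitesimal quasi-action* of $A$ on $F$ is an $\mathbb R$-linear map $a:\mathrm{Sec}(A)\to\mathrm{Vect}(F)$ such that, for all $u\in\mathrm{Sec}(A)$ and $f\in C^\infty(M)$: $a(u)$ has weight zero, i.e. $h_t^*\circ a(u)=a(u)\circ h_t^*$ for all $t\in\mathbb R$; $a(u)$ projects to $\rho_u$, i.e. $a(u)(\tau^*f)=\tau^*(\rho_u(f))$; and $a(fu)=(\tau^*f)\,a(u)$. It is an *infinitesimal action* if moreover $a([u,v]_A)=[a(u),a(v)]$ for all $u,v\in\mathrm{Sec}(A)$. **Theorem.** For every weighted $A$-connection $\nabla$ on $F$ and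 every $u\in\mathrm{Sec}(A)$ the vector field $[\nabla,\iota_u]$ is projectable to $F$, so that the generalised horizontal lift $H_\nabla(u):=(p_F)_*[\nabla,\iota_u]\in\mathrm{Vect}(F)$ is defined; $H_\nabla$ is an infinitesimal quasi-action of $A$ on $F$; and for all $u,v\in\mathrm{Sec}(A)$ the vector field $[[\nabla^2,\iota_u],\iota_v]$ is projectable to $F$ with $$(p_F)_*[[\nabla^2,\iota_u],\iota_v]=H_\nabla([u,v]_A)-[H_\nabla(u),H_\nabla(v)].$$ The map $\nabla\mapsto H_\nabla$ restricts to a bijection from the set of flat weighted $A$-connections on $F$ onto the set of infinitesimal actions of $A$ on $F$. -/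

import Mathlib

open scoped Manifold ContDiff Bundle Topology

noncomputable section

namespace WeightedConn

/-! ### The supermanifold `ΠE` of a vector bundle `E` -/

section Super

variable (EB : Type*) [NormedAddCommGroup EB] [NormedSpace ℝ EB]
  {B : Type*} [TopologicalSpace B] [ChartedSpace EB B]
  (FE : Type*) [NormedAddCommGroup FE] [NormedSpace ℝ FE]
  (E : B → Type*) [∀ b, AddCommMonoid (E b)] [∀ b, Module ℝ (E b)]
  [TopologicalSpace (Bundle.TotalSpace FE E)] [∀ b, TopologicalSpace (E b)]
  [FiberBundle FE E]

/-- A smooth section of the dual bundle `E*`, i.e. a smooth function on the total space of `E` that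
is linear on the fibres. -/
structure Covector where
  toFun : ∀ b, Module.Dual ℝ (E b)
  smooth : ContMDiff (𝓘(ℝ, EB).prod 𝓘(ℝ, FE)) 𝓘(ℝ, ℝ) ∞
    (fun v : Bundle.TotalSpace FE E => toFun v.1 v.2)

/-- The smooth functions on `B` (degree `0`) and the smooth sections of `E*` (degree `1`), as
families of elements of the exterior algebras `Λ(E_b*)`. -/
def generators : Set (∀ b, ExteriorAlgebra ℝ (Module.Dual ℝ (E b))) :=
  {η | ∃ f : C^∞⟮𝓘(ℝ, EB), B; ℝ⟯, η = fun b => algebraMap ℝ _ (f b)} ∪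
  {η | ∃ θ : Covector EB FE E, η = fun b => ExteriorAlgebra.ι ℝ (θ.toFun b)}

/-- The superalgebra `C^∞(ΠE)` of functions on `ΠE`, i.e. of smooth sections of `ΛE*`: families
`η b ∈ Λ(E_b*)` that are, near each point, polynomials in smooth functions on `B` and smooth
sections of `E*`. The product is the pointwise exterior product. -/
def SuperFun : Subalgebra ℝ (∀ b, ExteriorAlgebra ℝ (Module.Dual ℝ (E b))) where
  carrier := {η | ∀ b₀, ∃ g ∈ Algebra.adjoin ℝ (generators EB FE E), ∀ᶠ b in 𝓝 b₀, η b = g b}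
  mul_mem' := by
    intro x y hx hy b₀
    obtain ⟨g, hg, hgx⟩ := hx b₀
    obtain ⟨k, hk, hky⟩ := hy b₀
    refine ⟨g * k, mul_mem hg hk, ?_⟩
    filter_upwards [hgx, hky] with b h1 h2
    simp [h1, h2]
  add_mem' := by
    intro x y hx hy b₀
    obtain ⟨g, hg, hgx⟩ := hx b₀
    obtain ⟨k, hk, hky⟩ := hy b₀
    refine ⟨g + k, add_mem hg hk, ?_⟩
    filter_upwards [hgx, hky] with b h1 h2
    simp [h1, h2]
  algebraMap_mem' r b₀ := ⟨_, Subalgebra.algebraMap_mem _ r, Filter.Eventually.of_forall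
    fun _ => rfl⟩

variable {EB FE E}

theorem adjoin_le_superFun : Algebra.adjoin ℝ (generators EB FE E) ≤ SuperFun EB FE E :=
  fun η hη _ => ⟨η, hη, Filter.Eventually.of_forall fun _ => rfl⟩

variable (EB FE E)

/-- The pullback `π* : C^∞(B) → C^∞(ΠE)` along the projection `π : ΠE → B`. -/
def ofBase : C^∞⟮𝓘(ℝ, EB), B; ℝ⟯ →ₐ[ℝ] SuperFun EB FE E where
  toFun f := ⟨fun b => algebraMap ℝ _ (f b),
    adjoin_le_superFun (Algebra.subset_adjoin (Or.inl ⟨f, rfl⟩))⟩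
  map_one' := by ext b; simp
  map_mul' f g := by ext b; simp
  map_zero' := by ext b; simp
  map_add' f g := by ext b; simp
  commutes' r := by ext b; rfl

/-- The smooth section `θ` of `E*` as a function on `ΠE`. -/
def ofCovector (θ : Covector EB FE E) : SuperFun EB FE E :=
  ⟨fun b => ExteriorAlgebra.ι ℝ (θ.toFun b),
    adjoin_le_superFun (Algebra.subset_adjoin (Or.inr ⟨θ, rfl⟩))⟩

theorem contMDiff_body (η : SuperFun EB FE E) :
    ContMDiff 𝓘(ℝ, EB) 𝓘(ℝ, ℝ) ∞ (fun b => ExteriorAlgebra.algebraMapInv (η.1 b)) := by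
  have key : ∀ g ∈ Algebra.adjoin ℝ (generators EB FE E),
      ContMDiff 𝓘(ℝ, EB) 𝓘(ℝ, ℝ) ∞ (fun b => ExteriorAlgebra.algebraMapInv (g b)) := by
    intro g hg
    induction hg using Algebra.adjoin_induction with
    | mem x hx =>
      rcases hx with ⟨f, rfl⟩ | ⟨θ, rfl⟩
      · simpa [ExteriorAlgebra.algebraMapInv] using f.contMDiff
      · simpa [ExteriorAlgebra.algebraMapInv] using contMDiff_const
    | algebraMap r => simpa [ExteriorAlgebra.algebraMapInv] using contMDiff_const
    | add x y _ _ hx hy => simpa [Pi.add_def] using hx.add hy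
    | mul x y _ _ hx hy => simpa [Pi.mul_def] using hx.mul hy
  intro b₀
  obtain ⟨g, hg, h⟩ := η.2 b₀
  refine (key g hg b₀).congr_of_eventuallyEq ?_
  filter_upwards [h] with b hb
  rw [hb]

/-- The restriction `C^∞(ΠE) → C^∞(B)` of a function on `ΠE` to the reduced manifold `B`. -/
def body : SuperFun EB FE E →ₐ[ℝ] C^∞⟮𝓘(ℝ, EB), B; ℝ⟯ where
  toFun η := ⟨fun b => ExteriorAlgebra.algebraMapInv (η.1 b), contMDiff_body EB FE E η⟩
  map_one' := by ext b; exact map_one ExteriorAlgebra.algebraMapInv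
  map_mul' f g := by ext b; exact map_mul ExteriorAlgebra.algebraMapInv (f.1 b) (g.1 b)
  map_zero' := by ext b; exact map_zero (ExteriorAlgebra.algebraMapInv (M := Module.Dual ℝ (E b)) (R := ℝ))
  map_add' f g := by ext b; exact map_add ExteriorAlgebra.algebraMapInv (f.1 b) (g.1 b)
  commutes' r := by ext b; exact (ExteriorAlgebra.algebraMap_leftInverse _ r)

variable {EB FE E} in
theorem body_ofBase (f : C^∞⟮𝓘(ℝ, EB), B; ℝ⟯) : body EB FE E (ofBase EB FE E f) = f := by
  ext b
  exact ExteriorAlgebra.algebraMap_leftInverse _ (f b)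

/-- The functions of Grassmann parity `i`. -/
def parityPart (i : ZMod 2) : Submodule ℝ (SuperFun EB FE E) where
  carrier := {η | ∀ b, η.1 b ∈ CliffordAlgebra.evenOdd (0 : QuadraticForm ℝ (Module.Dual ℝ (E b))) i}
  add_mem' hx hy b := add_mem (hx b) (hy b)
  zero_mem' _ := zero_mem _
  smul_mem' r _ hx b := Submodule.smul_mem _ r (hx b)

theorem ofBase_mem_parityPart (f : C^∞⟮𝓘(ℝ, EB), B; ℝ⟯) :
    ofBase EB FE E f ∈ parityPart EB FE E 0 := fun _ =>
  CliffordAlgebra.one_le_evenOdd_zero _ (Submodule.algebraMap_mem _)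

/-- The sign `(-1)^i`. -/
def sgn (i : ZMod 2) : ℝ := (-1) ^ i.val

theorem sgn_zero : sgn 0 = 1 := pow_zero _

theorem sgn_one : sgn 1 = -1 := pow_one _

theorem sgn_add (i j : ZMod 2) : sgn (i + j) = sgn i * sgn j := by
  have h : (1 : ZMod 2) + 1 = 0 := rfl
  have hij : (i = 0 ∨ i = 1) ∧ (j = 0 ∨ j = 1) := by revert i j; decide
  rcases hij with ⟨rfl | rfl, rfl | rfl⟩ <;> simp [sgn_zero, sgn_one, h]

theorem sgn_eq (i : ZMod 2) : sgn i = 1 ∨ sgn i = -1 := by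
  have hi : i = 0 ∨ i = 1 := by revert i; decide
  rcases hi with rfl | rfl <;> simp [sgn_zero, sgn_one]

/-- A vector field on `ΠE` of Grassmann parity `ε`: an `ℝ`-linear map of parity `ε` of the
superalgebra of functions that satisfies the graded Leibniz rule. -/
@[ext]
structure SuperVect (ε : ZMod 2) where
  toLin : SuperFun EB FE E →ₗ[ℝ] SuperFun EB FE E
  parity : ∀ (i : ZMod 2), ∀ a ∈ parityPart EB FE E i, toLin a ∈ parityPart EB FE E (i + ε)
  leibniz : ∀ (i : ZMod 2), ∀ a ∈ parityPart EB FE E i, ∀ b,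
    toLin (a * b) = toLin a * b + sgn (ε * i) • (a * toLin b)

variable {EB FE E}

/-- The graded commutator `[X, Y] = X Y - (-1)^{εδ} Y X`. -/
def superBracket {ε δ : ZMod 2} (X : SuperVect EB FE E ε) (Y : SuperVect EB FE E δ) :
    SuperVect EB FE E (ε + δ) where
  toLin := X.toLin ∘ₗ Y.toLin - sgn (ε * δ) • (Y.toLin ∘ₗ X.toLin)
  parity i a ha := by
    have h1 := X.parity _ _ (Y.parity _ _ ha)
    have h2 := Y.parity _ _ (X.parity _ _ ha)
    rw [show i + δ + ε = i + (ε + δ) by ring] at h1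
    rw [show i + ε + δ = i + (ε + δ) by ring] at h2
    exact sub_mem h1 (Submodule.smul_mem _ _ h2)
  leibniz i a ha b := by
    have e1 := X.leibniz _ _ (Y.parity _ _ ha) b
    have e2 := X.leibniz _ _ ha (Y.toLin b)
    have e3 := Y.leibniz _ _ (X.parity _ _ ha) b
    have e4 := Y.leibniz _ _ ha (X.toLin b)
    simp only [LinearMap.sub_apply, LinearMap.comp_apply, LinearMap.smul_apply,
      Y.leibniz _ _ ha b, X.leibniz _ _ ha b, map_add, map_smul, e1, e2, e3, e4]
    simp only [mul_add, sgn_add, add_mul, mul_comm δ ε, sub_mul, mul_sub, smul_mul_assoc,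
      mul_smul_comm, smul_add, smul_sub]
    rcases sgn_eq (ε * δ) with h | h <;> rw [h] <;> module

/-- `X² = ½[X, X]` for an odd vector field `X`. -/
def superSq (X : SuperVect EB FE E 1) : SuperVect EB FE E (1 + 1) where
  toLin := (1 / 2 : ℝ) • (superBracket X X).toLin
  parity i a ha := Submodule.smul_mem _ _ ((superBracket X X).parity i a ha)
  leibniz i a ha b := by
    simp only [LinearMap.smul_apply, (superBracket X X).leibniz i a ha b, smul_add,
      smul_mul_assoc, mul_smul_comm, smul_smul, mul_comm]

theorem superSq_apply (X : SuperVect EB FE E 1) (η : SuperFun EB FE E) :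
    (superSq X).toLin η = X.toLin (X.toLin η) := by
  have h : sgn (1 * 1) = -1 := by rw [mul_one, sgn_one]
  simp only [superSq, superBracket, LinearMap.smul_apply, LinearMap.sub_apply, LinearMap.comp_apply, h]
  module

/-- The pushforward `π_* X` to `B` of a vector field `X` on `ΠE`: the vector field
`f ↦ (X (π* f))|_B`. If `X` is projectable, that is if `X (π* f)` always lies in `π* C^∞(B)`, it is
the vector field on `B` that is `π`-related to `X`. -/
def pushforward {ε : ZMod 2} (X : SuperVect EB FE E ε) :
    Derivation ℝ C^∞⟮𝓘(ℝ, EB), B; ℝ⟯ C^∞⟮𝓘(ℝ, EB), B; ℝ⟯ :=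
  Derivation.mk' ((body EB FE E).toLinearMap ∘ₗ X.toLin ∘ₗ (ofBase EB FE E).toLinearMap) (by
    intro f g
    have := X.leibniz 0 _ (ofBase_mem_parityPart EB FE E f) (ofBase EB FE E g)
    simp only [LinearMap.comp_apply, AlgHom.toLinearMap_apply, map_mul, this, map_add,
      body_ofBase, mul_zero, sgn_zero, one_smul, smul_eq_mul]
    ring)

/-! ### Contractions -/

theorem contractLeft_mul {V : Type*} [AddCommGroup V] [Module ℝ V] (d : Module.Dual ℝ V)
    (a b : ExteriorAlgebra ℝ V) :
    CliffordAlgebra.contractLeft d (a * b) =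
      CliffordAlgebra.contractLeft d a * b +
        CliffordAlgebra.involute a * CliffordAlgebra.contractLeft d b := by
  induction a using CliffordAlgebra.left_induction with
  | algebraMap r => simp [CliffordAlgebra.contractLeft_algebraMap_mul]
  | add x y hx hy => simp only [add_mul, map_add, hx, hy]; abel
  | ι_mul x v hx =>
    rw [mul_assoc, CliffordAlgebra.contractLeft_ι_mul, hx, CliffordAlgebra.contractLeft_ι_mul]
    simp only [map_mul, CliffordAlgebra.involute_ι, mul_add, sub_mul, smul_mul_assoc, neg_mul,
      mul_assoc]
    abel

theorem involute_eq {V : Type*} [AddCommGroup V] [Module ℝ V] (i : ZMod 2)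
    (a : ExteriorAlgebra ℝ V) (ha : a ∈ CliffordAlgebra.evenOdd (0 : QuadraticForm ℝ V) i) :
    CliffordAlgebra.involute a = sgn i • a := by
  have hi : ∀ i : ZMod 2, i = 0 ∨ i = 1 := by decide
  rcases hi i with rfl | rfl
  · simpa [sgn_zero] using CliffordAlgebra.involute_eq_of_mem_even ha
  · simpa [sgn_one] using CliffordAlgebra.involute_eq_of_mem_odd ha

theorem contractLeft_mem {V : Type*} [AddCommGroup V] [Module ℝ V] (d : Module.Dual ℝ V)
    (i : ZMod 2) (a : ExteriorAlgebra ℝ V)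
    (ha : a ∈ CliffordAlgebra.evenOdd (0 : QuadraticForm ℝ V) i) :
    CliffordAlgebra.contractLeft d a ∈
      CliffordAlgebra.evenOdd (0 : QuadraticForm ℝ V) (i + 1) := by
  have step : ∀ (j : ZMod 2) (m₁ m₂ : V) (x : ExteriorAlgebra ℝ V),
      x ∈ CliffordAlgebra.evenOdd (0 : QuadraticForm ℝ V) j →
      CliffordAlgebra.contractLeft d x ∈
        CliffordAlgebra.evenOdd (0 : QuadraticForm ℝ V) (j + 1) →
      CliffordAlgebra.contractLeft d (CliffordAlgebra.ι 0 m₁ * CliffordAlgebra.ι 0 m₂ * x) ∈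
        CliffordAlgebra.evenOdd (0 : QuadraticForm ℝ V) (j + 1) := by
    intro j m₁ m₂ x hx hd
    have e : ∀ m : V, CliffordAlgebra.ι 0 m ∈ CliffordAlgebra.evenOdd (0 : QuadraticForm ℝ V) 1 :=
      CliffordAlgebra.ι_mem_evenOdd_one 0
    have a1 := SetLike.mul_mem_graded (e m₁) hx
    have a2 := SetLike.mul_mem_graded (e m₂) hx
    have a3 := SetLike.mul_mem_graded (e m₁) (SetLike.mul_mem_graded (e m₂) hd)
    rw [show (1 : ZMod 2) + (1 + (j + 1)) = j + 1 by
      rw [← add_assoc, show (1 : ZMod 2) + 1 = 0 from rfl, zero_add]] at a3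
    rw [add_comm] at a1 a2
    rw [mul_assoc, CliffordAlgebra.contractLeft_ι_mul, CliffordAlgebra.contractLeft_ι_mul, mul_sub,
      mul_smul_comm]
    exact sub_mem (Submodule.smul_mem _ _ a2) (sub_mem (Submodule.smul_mem _ _ a1) a3)
  fin_cases i
  · induction a, ha using CliffordAlgebra.even_induction with
    | algebraMap r => simp [CliffordAlgebra.contractLeft_algebraMap]
    | add x y hx hy h1 h2 => rw [map_add]; exact add_mem h1 h2
    | ι_mul_ι_mul m₁ m₂ x hx h => exact step _ m₁ m₂ x hx h
  · induction a, ha using CliffordAlgebra.odd_induction with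
    | ι v =>
      rw [CliffordAlgebra.contractLeft_ι]
      exact CliffordAlgebra.one_le_evenOdd_zero _ (Submodule.algebraMap_mem _)
    | add x y hx hy h1 h2 => rw [map_add]; exact add_mem h1 h2
    | ι_mul_ι_mul m₁ m₂ x hx h => exact step _ m₁ m₂ x hx h

/-- The fibrewise contraction of `η` with `s`. -/
def contractFun (s : ∀ b, E b) :
    (∀ b, ExteriorAlgebra ℝ (Module.Dual ℝ (E b))) →ₗ[ℝ]
      (∀ b, ExteriorAlgebra ℝ (Module.Dual ℝ (E b))) :=
  LinearMap.pi fun b =>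
    (CliffordAlgebra.contractLeft (Module.Dual.eval ℝ (E b) (s b))) ∘ₗ LinearMap.proj b

theorem contractFun_mem (s : ∀ b, E b)
    (hs : ContMDiff 𝓘(ℝ, EB) (𝓘(ℝ, EB).prod 𝓘(ℝ, FE)) ∞
      (fun b => (⟨b, s b⟩ : Bundle.TotalSpace FE E)))
    (η : SuperFun EB FE E) : contractFun s η.1 ∈ SuperFun EB FE E := by
  have key : ∀ g ∈ Algebra.adjoin ℝ (generators EB FE E),
      (fun b => CliffordAlgebra.involute (g b)) ∈ Algebra.adjoin ℝ (generators EB FE E) ∧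
      contractFun s g ∈ Algebra.adjoin ℝ (generators EB FE E) := by
    intro g hg
    induction hg using Algebra.adjoin_induction with
    | mem x hx =>
      rcases hx with ⟨f, rfl⟩ | ⟨θ, rfl⟩
      · constructor
        · simp only [AlgHom.commutes]
          exact Algebra.subset_adjoin (Or.inl ⟨f, rfl⟩)
        · have : contractFun s (fun b => algebraMap ℝ _ (f b)) = 0 := by
            funext b
            exact CliffordAlgebra.contractLeft_algebraMap 0 (Module.Dual.eval ℝ (E b) (s b)) _
          rw [this]
          exact zero_mem _
      · constructor
        · have : (fun b => CliffordAlgebra.involute (ExteriorAlgebra.ι ℝ (θ.toFun b))) =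
              -fun b => ExteriorAlgebra.ι ℝ (θ.toFun b) := by
            funext b
            exact CliffordAlgebra.involute_ι _
          rw [this]
          exact neg_mem (Algebra.subset_adjoin (Or.inr ⟨θ, rfl⟩))
        · refine Algebra.subset_adjoin (Or.inl ⟨⟨fun b => θ.toFun b (s b), θ.smooth.comp hs⟩, ?_⟩)
          funext b
          exact CliffordAlgebra.contractLeft_ι 0 (Module.Dual.eval ℝ (E b) (s b)) _
    | algebraMap r =>
      constructor
      · simp only [Pi.algebraMap_apply, AlgHom.commutes]
        exact Subalgebra.algebraMap_mem _ r
      · have : contractFun s (algebraMap ℝ _ r) = 0 := by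
          funext b
          exact CliffordAlgebra.contractLeft_algebraMap 0 (Module.Dual.eval ℝ (E b) (s b)) _
        rw [this]
        exact zero_mem _
    | add x y _ _ hx hy =>
      constructor
      · simpa [Pi.add_def] using add_mem hx.1 hy.1
      · rw [map_add]
        exact add_mem hx.2 hy.2
    | mul x y h1 h2 hx hy =>
      constructor
      · simpa [Pi.mul_def] using mul_mem hx.1 hy.1
      · have : contractFun s (x * y) = contractFun s x * y +
            (fun b => CliffordAlgebra.involute (x b)) * contractFun s y := by
          funext b
          exact contractLeft_mul _ _ _
        rw [this]
        exact add_mem (mul_mem hx.2 h2) (mul_mem hx.1 hy.2)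
  intro b₀
  obtain ⟨g, hg, h⟩ := η.2 b₀
  refine ⟨_, (key g hg).2, ?_⟩
  filter_upwards [h] with b hb
  simp [contractFun, hb]

/-- The odd vector field `ι_s = s^i ∂/∂ξ^i` on `ΠE` defined by a smooth section `s` of `E`. -/
def contract (s : Cₛ^∞⟮𝓘(ℝ, EB); FE, E⟯) : SuperVect EB FE E 1 where
  toLin := (contractFun (fun b => s b) ∘ₗ (SuperFun EB FE E).val.toLinearMap).codRestrict
    (Subalgebra.toSubmodule (SuperFun EB FE E)) (fun η => contractFun_mem _ s.contMDiff η)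
  parity i a ha b := contractLeft_mem _ i _ (ha b)
  leibniz i a ha b := by
    apply Subtype.ext
    funext x
    refine (contractLeft_mul (Module.Dual.eval ℝ (E x) (s x)) (a.1 x) (b.1 x)).trans ?_
    rw [involute_eq i _ (ha x), one_mul, smul_mul_assoc]
    rfl

variable (EB FE E) in
/-- The space of smooth sections of `E`. -/
abbrev Sec := Cₛ^∞⟮𝓘(ℝ, EB); FE, E⟯

end Super

/-! ### Morphisms of vector bundles and the pullback of functions -/

section Morphism

variable {EB : Type*} [NormedAddCommGroup EB] [NormedSpace ℝ EB]
  {B : Type*} [TopologicalSpace B] [ChartedSpace EB B]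
  {FE : Type*} [NormedAddCommGroup FE] [NormedSpace ℝ FE]
  {E : B → Type*} [∀ b, AddCommMonoid (E b)] [∀ b, Module ℝ (E b)]
  [TopologicalSpace (Bundle.TotalSpace FE E)] [∀ b, TopologicalSpace (E b)]
  [FiberBundle FE E]
  {EB' : Type*} [NormedAddCommGroup EB'] [NormedSpace ℝ EB']
  {B' : Type*} [TopologicalSpace B'] [ChartedSpace EB' B']
  {FE' : Type*} [NormedAddCommGroup FE'] [NormedSpace ℝ FE']
  {E' : B' → Type*} [∀ b, AddCommMonoid (E' b)] [∀ b, Module ℝ (E' b)]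
  [TopologicalSpace (Bundle.TotalSpace FE' E')] [∀ b, TopologicalSpace (E' b)]
  [FiberBundle FE' E']

variable (EB B FE E EB' B' FE' E') in
/-- A smooth morphism of vector bundles `E → E'` over a smooth map `B → B'`. -/
structure BundleMap where
  base : C^∞⟮𝓘(ℝ, EB), B; 𝓘(ℝ, EB'), B'⟯
  fib : ∀ b, E b →ₗ[ℝ] E' (base b)
  smooth : ContMDiff (𝓘(ℝ, EB).prod 𝓘(ℝ, FE)) (𝓘(ℝ, EB').prod 𝓘(ℝ, FE')) ∞
    (fun v : Bundle.TotalSpace FE E => (⟨base v.1, fib v.1 v.2⟩ : Bundle.TotalSpace FE' E'))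

/-- The pullback of a family of exterior forms by a morphism of vector bundles. -/
def pullFun (Φ : BundleMap EB B FE E EB' B' FE' E') :
    (∀ b, ExteriorAlgebra ℝ (Module.Dual ℝ (E' b))) →ₐ[ℝ]
      (∀ b, ExteriorAlgebra ℝ (Module.Dual ℝ (E b))) :=
  AlgHom.pi fun b =>
    (ExteriorAlgebra.map (Φ.fib b).dualMap).comp (Pi.evalAlgHom ℝ _ (Φ.base b))

theorem pullFun_mem (Φ : BundleMap EB B FE E EB' B' FE' E') (η : SuperFun EB' FE' E') :
    pullFun Φ η.1 ∈ SuperFun EB FE E := by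
  have key : Algebra.adjoin ℝ (generators EB' FE' E') ≤
      (Algebra.adjoin ℝ (generators EB FE E)).comap (pullFun Φ) := by
    refine Algebra.adjoin_le ?_
    rintro x (⟨f, rfl⟩ | ⟨θ, rfl⟩)
    · refine Algebra.subset_adjoin (Or.inl ⟨f.comp Φ.base, ?_⟩)
      funext b
      exact AlgHom.commutes _ _
    · refine Algebra.subset_adjoin (Or.inr
        ⟨⟨fun b => (Φ.fib b).dualMap (θ.toFun (Φ.base b)), θ.smooth.comp Φ.smooth⟩, ?_⟩)
      funext b
      exact ExteriorAlgebra.map_apply_ι _ _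
  intro b₀
  obtain ⟨g, hg, h⟩ := η.2 (Φ.base b₀)
  refine ⟨_, key hg, ?_⟩
  filter_upwards [Φ.base.contMDiff.continuous.continuousAt.eventually h] with b hb
  simp [pullFun, hb]

/-- The pullback `Φ* : C^∞(ΠE') → C^∞(ΠE)` by the morphism of supermanifolds `ΠE → ΠE'` defined by
a morphism of vector bundles `Φ : E → E'`. -/
def pull (Φ : BundleMap EB B FE E EB' B' FE' E') : SuperFun EB' FE' E' →ₐ[ℝ] SuperFun EB FE E :=
  ((pullFun Φ).comp (SuperFun EB' FE' E').val).codRestrict _ (pullFun_mem Φ)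

variable (EB FE E) in
/-- The regular homogeneity structure `l_t` of a vector bundle: multiplication by `t`. -/
def scale [VectorBundle ℝ FE E] (t : ℝ) : BundleMap EB B FE E EB B FE E where
  base := ContMDiffMap.id
  fib b := t • LinearMap.id
  smooth := by
    intro v₀
    rw [Bundle.contMDiffAt_totalSpace]
    refine ⟨Bundle.contMDiffAt_proj E, ?_⟩
    have h : ContMDiffAt (𝓘(ℝ, EB).prod 𝓘(ℝ, FE)) 𝓘(ℝ, FE) ∞
        (fun v => (trivializationAt FE E v₀.proj v).2) v₀ :=
      ((Bundle.contMDiffAt_totalSpace (IB := 𝓘(ℝ, EB)) (n := ∞)).1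
      (contMDiffAt_id (x := v₀) (I := 𝓘(ℝ, EB).prod 𝓘(ℝ, FE)))).2
    refine ((contMDiffAt_const (c := t) (I := 𝓘(ℝ, EB).prod 𝓘(ℝ, FE)) (I' := 𝓘(ℝ, ℝ))).smul h).congr_of_eventuallyEq ?_
    have hb : ∀ᶠ v : Bundle.TotalSpace FE E in 𝓝 v₀,
        v.proj ∈ (trivializationAt FE E v₀.proj).baseSet :=
      (FiberBundle.continuous_proj FE E).continuousAt.eventually
        ((trivializationAt FE E v₀.proj).open_baseSet.mem_nhds
          (FiberBundle.mem_baseSet_trivializationAt' v₀.proj))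
    filter_upwards [hb] with v hv
    exact ((trivializationAt FE E v₀.proj).linear ℝ hv).map_smul t v.2

end Morphism

theorem cast_fib {M : Type*} (FA : Type*) (A : M → Type*) [∀ x, AddCommMonoid (A x)]
    [∀ x, Module ℝ (A x)] {x y : M} (h : x = y) (v : A x) :
    (⟨y, cast (congrArg (fun z => A x →ₗ[ℝ] A z) h) LinearMap.id v⟩ : Bundle.TotalSpace FA A) =
      ⟨x, v⟩ := by
  subst h
  rfl

section Pullback

variable {EB : Type*} [NormedAddCommGroup EB] [NormedSpace ℝ EB]
  {B : Type*} [TopologicalSpace B] [ChartedSpace EB B]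
  {FE : Type*} [NormedAddCommGroup FE] [NormedSpace ℝ FE]
  {E : B → Type*} [∀ b, AddCommMonoid (E b)]
  [TopologicalSpace (Bundle.TotalSpace FE E)] [∀ b, TopologicalSpace (E b)]
  [FiberBundle FE E]
  {EB' : Type*} [NormedAddCommGroup EB'] [NormedSpace ℝ EB']
  {B' : Type*} [TopologicalSpace B'] [ChartedSpace EB' B']
  {EN HN N : Type*} [NormedAddCommGroup EN] [NormedSpace ℝ EN] [TopologicalSpace HN]
  {IN : ModelWithCorners ℝ EN HN} [TopologicalSpace N] [ChartedSpace HN N]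

theorem contMDiff_lift (φ : C^∞⟮𝓘(ℝ, EB'), B'; 𝓘(ℝ, EB), B⟯) :
    ContMDiff (𝓘(ℝ, EB').prod 𝓘(ℝ, FE)) (𝓘(ℝ, EB).prod 𝓘(ℝ, FE)) ∞
      (Bundle.Pullback.lift φ : Bundle.TotalSpace FE (φ *ᵖ E) → Bundle.TotalSpace FE E) := by
  intro v₀
  rw [Bundle.contMDiffAt_totalSpace]
  exact ⟨φ.contMDiff.contMDiffAt.comp v₀ (Bundle.contMDiffAt_proj (φ *ᵖ E)),
    ((Bundle.contMDiffAt_totalSpace (IB := 𝓘(ℝ, EB')) (n := ∞)).1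
      (contMDiffAt_id (x := v₀) (I := 𝓘(ℝ, EB').prod 𝓘(ℝ, FE)))).2⟩

theorem contMDiff_to_pullback (φ : C^∞⟮𝓘(ℝ, EB'), B'; 𝓘(ℝ, EB), B⟯)
    (f : N → Bundle.TotalSpace FE (φ *ᵖ E))
    (h1 : ContMDiff IN 𝓘(ℝ, EB') ∞ (fun x => (f x).proj))
    (h2 : ContMDiff IN (𝓘(ℝ, EB).prod 𝓘(ℝ, FE)) ∞ (fun x => Bundle.Pullback.lift φ (f x))) :
    ContMDiff IN (𝓘(ℝ, EB').prod 𝓘(ℝ, FE)) ∞ f := by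
  intro x₀
  rw [Bundle.contMDiffAt_totalSpace]
  exact ⟨h1 x₀, (Bundle.contMDiffAt_totalSpace.1 (h2 x₀)).2⟩

end Pullback

/-! ### Lie algebroids -/

section Algebroid

variable (EM : Type*) [NormedAddCommGroup EM] [NormedSpace ℝ EM]
  {M : Type*} [TopologicalSpace M] [ChartedSpace EM M]
  (FA : Type*) [NormedAddCommGroup FA] [NormedSpace ℝ FA]
  (A : M → Type*) [∀ x, AddCommGroup (A x)] [∀ x, Module ℝ (A x)]
  [TopologicalSpace (Bundle.TotalSpace FA A)] [∀ x, TopologicalSpace (A x)]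
  [FiberBundle FA A] [VectorBundle ℝ FA A]

/-- A Lie algebroid structure on the vector bundle `A → M`: a homological vector field of weight
one on `ΠA`. -/
structure LieAlgebroid where
  d : SuperVect EM FA A 1
  weight : ∀ (t : ℝ) (η : SuperFun EM FA A),
    pull (scale EM FA A t) (d.toLin η) = t • d.toLin (pull (scale EM FA A t) η)
  homological : (superSq d).toLin = 0

variable {EM FA A}

/-- The anchor `ρ_u`, the vector field on `M` with `ρ_u(f) = [d_A, ι_u](f)`. -/
def LieAlgebroid.anchor (D : LieAlgebroid EM FA A) (u : Sec EM FA A) :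
    Derivation ℝ C^∞⟮𝓘(ℝ, EM), M; ℝ⟯ C^∞⟮𝓘(ℝ, EM), M; ℝ⟯ :=
  pushforward (superBracket D.d (contract u))

/-- The Lie algebroid bracket: `[u, v]_A` is the section with `ι_{[u, v]_A} = [[d_A, ι_u], ι_v]`. -/
def LieAlgebroid.bracket (D : LieAlgebroid EM FA A) (u v : Sec EM FA A) : Sec EM FA A :=
  Classical.epsilon fun w =>
    (contract w).toLin = (superBracket (superBracket D.d (contract u)) (contract v)).toLin

/-- The section `f u`. -/
def smulSec [ContMDiffVectorBundle ∞ FA A 𝓘(ℝ, EM)] (f : C^∞⟮𝓘(ℝ, EM), M; ℝ⟯)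
    (u : Sec EM FA A) : Sec EM FA A :=
  ⟨fun x => f x • u x, f.contMDiff.smul_section u.contMDiff⟩

end Algebroid

/-! ### Graded bundles, weighted connections and actions -/

section Graded

variable (EM : Type*) [NormedAddCommGroup EM] [NormedSpace ℝ EM]
  (M : Type*) [TopologicalSpace M] [ChartedSpace EM M]
  (EF : Type*) [NormedAddCommGroup EF] [NormedSpace ℝ EF]
  (F : Type*) [TopologicalSpace F] [ChartedSpace EF F]

/-- A graded bundle `F` over `M`: a smooth action `h` of the monoid `(ℝ, ·)` on `F`, where the
manifold `M` is identified with `h_0(F)` by a smooth embedding `zero : M → F` with smooth left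
inverse `τ`, so that `h_0` becomes the projection `τ : F → M`. -/
structure GradedBundle where
  h : ℝ → F → F
  smooth : ContMDiff (𝓘(ℝ, ℝ).prod 𝓘(ℝ, EF)) 𝓘(ℝ, EF) ∞ (fun q : ℝ × F => h q.1 q.2)
  h_one : ∀ p, h 1 p = p
  h_mul : ∀ s t p, h (s * t) p = h s (h t p)
  τ : C^∞⟮𝓘(ℝ, EF), F; 𝓘(ℝ, EM), M⟯
  zero : C^∞⟮𝓘(ℝ, EM), M; 𝓘(ℝ, EF), F⟯
  τ_zero : ∀ x, τ (zero x) = x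
  h_zero : ∀ p, h 0 p = zero (τ p)

variable {EM M EF F}

theorem GradedBundle.τ_h (G : GradedBundle EM M EF F) (t : ℝ) (p : F) : G.τ (G.h t p) = G.τ p := by
  have h1 := G.h_mul 0 t p
  rw [zero_mul, G.h_zero, G.h_zero] at h1
  rw [← G.τ_zero (G.τ (G.h t p)), ← h1, G.τ_zero]

/-- The diffeomorphism (for `t ≠ 0`) or smooth map `h_t`. -/
def GradedBundle.hMap (G : GradedBundle EM M EF F) (t : ℝ) : C^∞⟮𝓘(ℝ, EF), F; 𝓘(ℝ, EF), F⟯ :=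
  ⟨G.h t, G.smooth.comp (contMDiff_const.prodMk contMDiff_id)⟩

variable {FA : Type*} [NormedAddCommGroup FA] [NormedSpace ℝ FA]
  {A : M → Type*} [∀ x, AddCommGroup (A x)] [∀ x, Module ℝ (A x)]
  [TopologicalSpace (Bundle.TotalSpace FA A)] [∀ x, TopologicalSpace (A x)]
  [FiberBundle FA A] [VectorBundle ℝ FA A]

section
variable (FA A)

/-- The projection `p_{ΠA} : τ*ΠA → ΠA`. -/
def GradedBundle.pA (G : GradedBundle EM M EF F) :
    BundleMap EF F FA (G.τ *ᵖ A) EM M FA A where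
  base := G.τ
  fib _ := LinearMap.id
  smooth := contMDiff_lift G.τ

/-- The homogeneity structure `h_t` on `τ*ΠA`, which is `h_t` on `F` and the identity on the fibres
`(τ*A)_p = A_{τ p} = (τ*A)_{h_t p}`. -/
def GradedBundle.hA (G : GradedBundle EM M EF F) (t : ℝ) :
    BundleMap EF F FA (G.τ *ᵖ A) EF F FA (G.τ *ᵖ A) where
  base := G.hMap t
  fib p := cast (congrArg (fun x => A (G.τ p) →ₗ[ℝ] A x) (G.τ_h t p).symm) LinearMap.id
  smooth := by
    refine contMDiff_to_pullback G.τ _ ((G.hMap t).contMDiff.comp (Bundle.contMDiff_proj (G.τ *ᵖ A))) ?_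
    refine (contMDiff_lift (FE := FA) (E := A) G.τ).congr fun v => ?_
    exact cast_fib FA A (G.τ_h t v.proj).symm v.2

end

/-- The pullback `τ*u` of a section. -/
def GradedBundle.pullSec (G : GradedBundle EM M EF F) (u : Sec EM FA A) :
    Sec EF FA (G.τ *ᵖ A) :=
  ⟨fun p => u (G.τ p), contMDiff_to_pullback G.τ _ contMDiff_id
    (u.contMDiff.comp G.τ.contMDiff)⟩

/-- A weighted `A`-connection on `F`: an odd vector field on `τ*ΠA` of bi-weight `(0, 1)` that
projects to `d_A`. -/
structure IsWeightedConnection (D : LieAlgebroid EM FA A) (G : GradedBundle EM M EF F)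
    (N : SuperVect EF FA (G.τ *ᵖ A) 1) : Prop where
  weight_h : ∀ (t : ℝ) (η : SuperFun EF FA (G.τ *ᵖ A)),
    pull (G.hA FA A t) (N.toLin η) = N.toLin (pull (G.hA FA A t) η)
  weight_l : ∀ (t : ℝ) (η : SuperFun EF FA (G.τ *ᵖ A)),
    pull (scale EF FA (G.τ *ᵖ A) t) (N.toLin η) =
      t • N.toLin (pull (scale EF FA (G.τ *ᵖ A) t) η)
  projects : ∀ η : SuperFun EM FA A, N.toLin (pull (G.pA FA A) η) = pull (G.pA FA A) (D.d.toLin η)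

/-- Flatness: `∇² = 0`. -/
def IsFlat {G : GradedBundle EM M EF F} (N : SuperVect EF FA (G.τ *ᵖ A) 1) : Prop :=
  (superSq N).toLin = 0

/-- The vector field `[∇, ι_u]` on `τ*ΠA`. -/
def liftBracket {G : GradedBundle EM M EF F} (N : SuperVect EF FA (G.τ *ᵖ A) 1)
    (u : Sec EM FA A) : SuperVect EF FA (G.τ *ᵖ A) (1 + 1) :=
  superBracket N (contract (G.pullSec u))

/-- The generalised horizontal lift `H_∇(u) = (p_F)_* [∇, ι_u]`. -/
def horizontalLift {G : GradedBundle EM M EF F} (N : SuperVect EF FA (G.τ *ᵖ A) 1)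
    (u : Sec EM FA A) : Derivation ℝ C^∞⟮𝓘(ℝ, EF), F; ℝ⟯ C^∞⟮𝓘(ℝ, EF), F; ℝ⟯ :=
  pushforward (liftBracket N u)

variable [ContMDiffVectorBundle ∞ FA A 𝓘(ℝ, EM)]

/-- An infinitesimal quasi-action of `A` on `F`. Vector fields on `F` are derivations of
`C^∞(F)`. -/
structure IsQuasiAction (D : LieAlgebroid EM FA A) (G : GradedBundle EM M EF F)
    (a : Sec EM FA A → Derivation ℝ C^∞⟮𝓘(ℝ, EF), F; ℝ⟯ C^∞⟮𝓘(ℝ, EF), F; ℝ⟯) : Prop where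
  map_add : ∀ u v, a (u + v) = a u + a v
  map_smul : ∀ (r : ℝ) (u), a (r • u) = r • a u
  weight : ∀ u (t : ℝ) (f : C^∞⟮𝓘(ℝ, EF), F; ℝ⟯), (a u f).comp (G.hMap t) = a u (f.comp (G.hMap t))
  projects : ∀ u (f : C^∞⟮𝓘(ℝ, EM), M; ℝ⟯), a u (f.comp G.τ) = (D.anchor u f).comp G.τ
  map_smulSec : ∀ (f : C^∞⟮𝓘(ℝ, EM), M; ℝ⟯) (u), a (smulSec f u) = f.comp G.τ • a u

/-- An infinitesimal action of `A` on `F`: a quasi-action that preserves brackets. -/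
structure IsAction (D : LieAlgebroid EM FA A) (G : GradedBundle EM M EF F)
    (a : Sec EM FA A → Derivation ℝ C^∞⟮𝓘(ℝ, EF), F; ℝ⟯ C^∞⟮𝓘(ℝ, EF), F; ℝ⟯) : Prop
    extends IsQuasiAction D G a where
  map_bracket : ∀ u v, a (D.bracket u v) = ⁅a u, a v⁆

end Graded

end WeightedConn

end

open WeightedConn

open scoped TensorProduct

noncomputable section

namespace WeightedConn

/-! ### The exterior algebra -/

section Exterior

variable {V W : Type*} [AddCommGroup V] [Module ℝ V] [AddCommGroup W] [Module ℝ W]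

/-! Locally a function on `τ*ΠA` is a polynomial in covectors pulled back from `A`, with
coefficients in `C^∞(F)`. A graded derivation is local, hence determined by its values on `C^∞(F)`
and on pulled-back covectors (`IsSkewDerivation.ext_pullback`). On the latter a weighted connection
`∇` is prescribed: it acts as `d_A`. On a function `f`, weight one makes `∇f` a one-form, and since
`ι_u` kills functions, `[∇, ι_u] f = ι_u ∇f` is again a function, namely `H_∇(u) f`. So `H_∇` is the
family of one-forms `∇f` evaluated on sections, and the quasi-action axioms translate the linearity
of `u ↦ ι_u`, the weights and the projectability. Forms of positive degree are determined by their
contractions, by Euler's identity (`sum_ι_mul_contractLeft`); hence `H_∇` determines `∇`.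

For the curvature, `[[∇, ι_u], ι_v]` equals the contraction with `[u, v]_A`: both are odd
derivations that vanish on functions and agree on pulled-back covectors. Expanding the double
bracket on `∇f` gives `H([u,v]) f = [H(u), H(v)] f - ι_v ι_u ∇²f`
(`HasWeightOne.contract_contract_sq`). Moreover `∇²` kills pulled-back covectors because `d_A² = 0`,
and `∇²f` is a two-form, determined by its double contractions. So flatness is the same as
preservation of brackets.

For surjectivity, a quasi-action `a` is tensorial in `u`, so `u ↦ a(u) f` is a one-form `δf`, and
`δ` is a derivation that continues `d_A` from functions on `M`. The required vector field must send
`f · p*η` to `δf · p*η + f · p*(d_A η)`. The point is that this does not depend on how a function is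
written with such products (`BaseDerivation.extend_eq_zero`); Leibniz rule and weights are then
checked on products. -/

theorem exterior_degree_induction {k : ℕ} {C : ℕ → ExteriorAlgebra ℝ V → Prop}
    (algebraMap : ∀ r : ℝ, C 0 (algebraMap ℝ _ r))
    (add : ∀ k x y, C k x → C k y → C k (x + y))
    (ι_mul : ∀ k v x, x ∈ ⋀[ℝ]^k V → C k x → C (k + 1) (ExteriorAlgebra.ι ℝ v * x))
    {x : ExteriorAlgebra ℝ V} (hx : x ∈ ⋀[ℝ]^k V) : C k x := by
  refine Submodule.pow_induction_on_left' _ (C := fun k x _ => C k x) algebraMap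
    (fun x y k _ _ => add k x y) ?_ hx
  rintro _ ⟨v, rfl⟩ k x hx h
  exact ι_mul k v x hx h

theorem map_smul_id_of_mem {k : ℕ} (t : ℝ) {x : ExteriorAlgebra ℝ V} (hx : x ∈ ⋀[ℝ]^k V) :
    ExteriorAlgebra.map (t • (LinearMap.id : V →ₗ[ℝ] V)) x = t ^ k • x := by
  refine exterior_degree_induction
    (C := fun k x => ExteriorAlgebra.map (t • (LinearMap.id : V →ₗ[ℝ] V)) x = t ^ k • x)
    ?_ ?_ ?_ hx
  · intro r; simp
  · intro k x y h1 h2; simp [h1, h2]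
  · intro k v x _ h
    simp [h, smul_smul, pow_succ, mul_comm]

/-- Scaling by `2` multiplies the component of degree `i` by `2 ^ i`, and these eigenvalues are
distinct. Hence a single scale factor detects the degree. -/
theorem mem_of_map_smul_id {k : ℕ} {x : ExteriorAlgebra ℝ V}
    (hx : ExteriorAlgebra.map ((2 : ℝ) • (LinearMap.id : V →ₗ[ℝ] V)) x = (2 : ℝ) ^ k • x) :
    x ∈ ⋀[ℝ]^k V := by
  classical
  have key : ∀ (y : ExteriorAlgebra ℝ V) (i : ℕ),
      (DirectSum.decompose (fun i : ℕ => ⋀[ℝ]^i V)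
        (ExteriorAlgebra.map ((2 : ℝ) • (LinearMap.id : V →ₗ[ℝ] V)) y) i : ExteriorAlgebra ℝ V) =
        (2 : ℝ) ^ i • (DirectSum.decompose (fun i : ℕ => ⋀[ℝ]^i V) y i : ExteriorAlgebra ℝ V) := by
    intro y i
    induction y using DirectSum.Decomposition.inductionOn (fun i : ℕ => ⋀[ℝ]^i V) with
    | zero => simp
    | homogeneous m =>
      rename_i j
      rw [map_smul_id_of_mem 2 m.2, DirectSum.decompose_smul]
      by_cases h : j = i
      · subst h; simp [DirectSum.smul_apply]
      · simp [DirectSum.smul_apply, DirectSum.decompose_coe, DirectSum.of_eq_of_ne _ _ _ (Ne.symm h)]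
    | add m m' h1 h2 => simp [h1, h2, DirectSum.decompose_add]
  rw [← DirectSum.sum_support_decompose (fun i : ℕ => ⋀[ℝ]^i V) x]
  refine sum_mem fun i _ => ?_
  have h := key x i
  rw [hx, DirectSum.decompose_smul] at h
  by_cases hik : i = k
  · subst hik; exact Subtype.coe_prop _
  · have h' : ((2 : ℝ) ^ k - 2 ^ i) •
        (DirectSum.decompose (fun i : ℕ => ⋀[ℝ]^i V) x i : ExteriorAlgebra ℝ V) = 0 := by
      rw [sub_smul, ← h]
      simp [DirectSum.smul_apply]
    rcases smul_eq_zero.1 h' with h0 | h0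
    · exact absurd (pow_right_injective₀ (by norm_num) (by norm_num) (sub_eq_zero.1 h0)).symm hik
    · rw [h0]; exact zero_mem _

theorem contractLeft_mem_degree (d : Module.Dual ℝ V) {k : ℕ} {x : ExteriorAlgebra ℝ V}
    (hx : x ∈ ⋀[ℝ]^k V) :
    CliffordAlgebra.contractLeft d x ∈ ⋀[ℝ]^(k - 1) V := by
  -- In degree `0` the subtraction `k - 1` truncates, so the induction also carries the vanishing of
  -- the contraction there. The passage from degree `0` to `1` needs it: membership alone would put
  -- the second term in degree `1` instead of `0`.
  refine exterior_degree_induction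
    (C := fun k x => (k = 0 → (CliffordAlgebra.contractLeft d x : ExteriorAlgebra ℝ V) = 0) ∧
      (CliffordAlgebra.contractLeft d x : ExteriorAlgebra ℝ V) ∈ ⋀[ℝ]^(k - 1) V)
    ?_ ?_ ?_ hx |>.2
  · intro r
    have : (CliffordAlgebra.contractLeft d (algebraMap ℝ (ExteriorAlgebra ℝ V) r) :
      ExteriorAlgebra ℝ V) = 0 := CliffordAlgebra.contractLeft_algebraMap 0 d r
    rw [this]
    exact ⟨fun _ => rfl, zero_mem _⟩
  · intro k x y h1 h2
    rw [map_add]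
    exact ⟨fun h => by rw [h1.1 h, h2.1 h, add_zero], add_mem h1.2 h2.2⟩
  · intro k v x hx h
    refine ⟨fun h => by omega, ?_⟩
    have e : (CliffordAlgebra.contractLeft d (ExteriorAlgebra.ι ℝ v * x) : ExteriorAlgebra ℝ V) =
      d v • x - ExteriorAlgebra.ι ℝ v * CliffordAlgebra.contractLeft d x :=
      CliffordAlgebra.contractLeft_ι_mul (Q := 0) _ v x
    rw [e]
    refine sub_mem (Submodule.smul_mem _ _ hx) ?_
    rcases k with _ | k
    · rw [h.1 rfl, mul_zero]; exact zero_mem _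
    · have hv : ExteriorAlgebra.ι ℝ v ∈ ⋀[ℝ]^1 V := by simp
      have := SetLike.mul_mem_graded (A := fun i : ℕ => ⋀[ℝ]^i V) hv h.2
      rwa [Nat.add_sub_cancel, Nat.add_comm 1 k] at this

/-- Euler's identity for the field `ξ^i ∂/∂ξ^i`: moving it past a factor `v` produces `∑ c_i (c^i v)
= v` once, and the two sign changes cancel. It recovers a form of positive degree from its
contractions. -/
theorem sum_ι_mul_contractLeft {n : Type*} [Fintype n] (c : Module.Basis n ℝ V) {k : ℕ}
    {x : ExteriorAlgebra ℝ V} (hx : x ∈ ⋀[ℝ]^k V) :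
    ∑ i, ExteriorAlgebra.ι ℝ (c i) * CliffordAlgebra.contractLeft (c.coord i) x = (k : ℝ) • x := by
  refine exterior_degree_induction (C := fun k x => ∑ i, ExteriorAlgebra.ι ℝ (c i) *
    (CliffordAlgebra.contractLeft (c.coord i) x : ExteriorAlgebra ℝ V) = (k : ℝ) • x) ?_ ?_ ?_ hx
  · intro r
    have (i : n) : (CliffordAlgebra.contractLeft (c.coord i) (algebraMap ℝ (ExteriorAlgebra ℝ V) r) :
      ExteriorAlgebra ℝ V) = 0 := CliffordAlgebra.contractLeft_algebraMap 0 _ r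
    simp [this]
  · intro k x y h1 h2
    simp only [map_add, mul_add, Finset.sum_add_distrib, h1, h2, smul_add]
  · intro k v x hx h
    have e (i : n) : (CliffordAlgebra.contractLeft (c.coord i) (ExteriorAlgebra.ι ℝ v * x) :
      ExteriorAlgebra ℝ V) =
      c.coord i v • x - ExteriorAlgebra.ι ℝ v * CliffordAlgebra.contractLeft (c.coord i) x :=
      CliffordAlgebra.contractLeft_ι_mul (Q := 0) _ v x
    have e2 (i : n) (y : ExteriorAlgebra ℝ V) :
        ExteriorAlgebra.ι ℝ (c i) * (ExteriorAlgebra.ι ℝ v * y) =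
        -(ExteriorAlgebra.ι ℝ v * (ExteriorAlgebra.ι ℝ (c i) * y)) := by
      rw [← mul_assoc, ← mul_assoc, eq_neg_of_add_eq_zero_left (ExteriorAlgebra.ι_add_mul_swap (c i) v),
        neg_mul]
    simp only [e, mul_sub, e2, sub_neg_eq_add, Finset.sum_add_distrib, ← Finset.mul_sum, h]
    have e3 : ∑ i, ExteriorAlgebra.ι ℝ (c i) * (c.coord i v • x) = ExteriorAlgebra.ι ℝ v * x := by
      conv_rhs => rw [← c.sum_repr v, map_sum, Finset.sum_mul]
      simp
    rw [e3, mul_smul_comm]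
    push_cast
    module

theorem eq_zero_of_contractLeft_eq_zero [FiniteDimensional ℝ V] {k : ℕ} {x : ExteriorAlgebra ℝ V}
    (hx : x ∈ ⋀[ℝ]^(k + 1) V)
    (h : ∀ d : Module.Dual ℝ V, (CliffordAlgebra.contractLeft d x : ExteriorAlgebra ℝ V) = 0) :
    x = 0 := by
  have := sum_ι_mul_contractLeft (Module.finBasis ℝ V) hx
  simp only [h, mul_zero, Finset.sum_const_zero] at this
  refine (smul_eq_zero.1 this.symm).resolve_left ?_
  positivity

theorem eq_zero_of_contractLeft_eval_eq_zero {U : Type*} [AddCommMonoid U] [Module ℝ U]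
    [Module.IsReflexive ℝ U] [FiniteDimensional ℝ (Module.Dual ℝ U)] {k : ℕ}
    {x : ExteriorAlgebra ℝ (Module.Dual ℝ U)} (hx : x ∈ ⋀[ℝ]^(k + 1) (Module.Dual ℝ U))
    (h : ∀ v : U, (CliffordAlgebra.contractLeft (Module.Dual.eval ℝ U v) x :
      ExteriorAlgebra ℝ (Module.Dual ℝ U)) = 0) : x = 0 := by
  refine eq_zero_of_contractLeft_eq_zero hx fun d => ?_
  obtain ⟨v, rfl⟩ := (Module.evalEquiv ℝ U).surjective d
  exact h v

theorem contractLeft_map (f : V →ₗ[ℝ] W) (d : Module.Dual ℝ W) (x : ExteriorAlgebra ℝ V) :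
    (CliffordAlgebra.contractLeft d (ExteriorAlgebra.map f x) : ExteriorAlgebra ℝ W) =
      ExteriorAlgebra.map f (CliffordAlgebra.contractLeft (d ∘ₗ f) x) := by
  induction x using CliffordAlgebra.left_induction with
  | algebraMap r =>
    rw [CliffordAlgebra.contractLeft_algebraMap, map_zero]
    exact (congrArg _ (AlgHom.commutes _ r)).trans (CliffordAlgebra.contractLeft_algebraMap 0 d r)
  | add x y hx hy => simp only [map_add, hx, hy]
  | ι_mul x v hx =>
    have e : (CliffordAlgebra.contractLeft (d ∘ₗ f) (CliffordAlgebra.ι 0 v * x) :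
      ExteriorAlgebra ℝ V) = d (f v) • x - ExteriorAlgebra.ι ℝ v * CliffordAlgebra.contractLeft
        (d ∘ₗ f) x := CliffordAlgebra.contractLeft_ι_mul (Q := 0) _ v x
    have e2 : ExteriorAlgebra.map f (CliffordAlgebra.ι 0 v) = ExteriorAlgebra.ι ℝ (f v) :=
      ExteriorAlgebra.map_apply_ι f v
    have e3 : (CliffordAlgebra.contractLeft d (ExteriorAlgebra.ι ℝ (f v) * ExteriorAlgebra.map f x) :
      ExteriorAlgebra ℝ W) = d (f v) • ExteriorAlgebra.map f x - ExteriorAlgebra.ι ℝ (f v) *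
        CliffordAlgebra.contractLeft d (ExteriorAlgebra.map f x) :=
        CliffordAlgebra.contractLeft_ι_mul (Q := 0) _ _ _
    rw [e, map_mul, e2, e3, map_sub, map_smul, map_mul, ExteriorAlgebra.map_apply_ι, hx]

/-- Parity is the weight at `t = -1`. This lets all signs be expressed by the pullback along
`l_{-1}`, also for inhomogeneous elements. -/
theorem map_neg_one_eq_involute (x : ExteriorAlgebra ℝ V) :
    ExteriorAlgebra.map ((-1 : ℝ) • (LinearMap.id : V →ₗ[ℝ] V)) x = CliffordAlgebra.involute x := by
  have : ExteriorAlgebra.map ((-1 : ℝ) • (LinearMap.id : V →ₗ[ℝ] V)) = CliffordAlgebra.involute := by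
    ext v
    exact (ExteriorAlgebra.map_apply_ι _ v).trans (by
      rw [LinearMap.smul_apply, neg_smul, one_smul, map_neg]
      exact (CliffordAlgebra.involute_ι (Q := 0) v).symm)
  rw [this]

theorem map_smul_id_map (t : ℝ) (f : V →ₗ[ℝ] W) (x : ExteriorAlgebra ℝ V) :
    ExteriorAlgebra.map (t • (LinearMap.id : W →ₗ[ℝ] W)) (ExteriorAlgebra.map f x) =
      ExteriorAlgebra.map f (ExteriorAlgebra.map (t • (LinearMap.id : V →ₗ[ℝ] V)) x) := by
  rw [← AlgHom.comp_apply, ← AlgHom.comp_apply, ExteriorAlgebra.map_comp_map,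
    ExteriorAlgebra.map_comp_map]
  congr 2
  ext v
  simp

theorem ι_mul_eq_involute_mul_ι (v : V) (x : ExteriorAlgebra ℝ V) :
    ExteriorAlgebra.ι ℝ v * x =
      ExteriorAlgebra.map ((-1 : ℝ) • (LinearMap.id : V →ₗ[ℝ] V)) x * ExteriorAlgebra.ι ℝ v := by
  induction x using CliffordAlgebra.left_induction with
  | algebraMap r =>
    rw [map_neg_one_eq_involute, AlgHom.commutes]
    exact (Algebra.commutes r (ExteriorAlgebra.ι ℝ v)).symm
  | add x y hx hy => simp only [mul_add, map_add, add_mul, hx, hy]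
  | ι_mul x w hx =>
    have e : ExteriorAlgebra.map ((-1 : ℝ) • (LinearMap.id : V →ₗ[ℝ] V)) (CliffordAlgebra.ι 0 w) =
        -ExteriorAlgebra.ι ℝ w := by
      refine (ExteriorAlgebra.map_apply_ι _ w).trans ?_
      simp
    have e2 : ExteriorAlgebra.ι ℝ v * CliffordAlgebra.ι 0 w =
        -(ExteriorAlgebra.ι ℝ w * ExteriorAlgebra.ι ℝ v) :=
      eq_neg_of_add_eq_zero_left (ExteriorAlgebra.ι_add_mul_swap v w)
    rw [map_mul, e, ← mul_assoc, e2, neg_mul, mul_assoc, hx]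
    simp only [neg_mul, mul_assoc]

theorem mem_evenOdd_iff (i : ZMod 2) (x : ExteriorAlgebra ℝ V) :
    x ∈ CliffordAlgebra.evenOdd (0 : QuadraticForm ℝ V) i ↔
      ExteriorAlgebra.map ((-1 : ℝ) • (LinearMap.id : V →ₗ[ℝ] V)) x = sgn i • x := by
  rw [map_neg_one_eq_involute]
  refine ⟨involute_eq i x, fun h => ?_⟩
  -- Even plus odd part; the involution acts on them by `1` and `-1`, so the eigenvalue equation
  -- forces twice the part of the wrong parity to vanish.
  obtain ⟨y, hy, z, hz, rfl⟩ := Submodule.mem_sup.1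
    (((CliffordAlgebra.evenOdd_isCompl (0 : QuadraticForm ℝ V)).sup_eq_top).symm ▸
      Submodule.mem_top : x ∈ _)
  rw [map_add, involute_eq 0 y hy, involute_eq 1 z hz, sgn_zero, sgn_one] at h
  have hi : ∀ i : ZMod 2, i = 0 ∨ i = 1 := by decide
  rcases hi i with rfl | rfl
  · rw [sgn_zero] at h
    have h' : (2 : ℝ) • z = 0 := by
      have := sub_eq_zero.2 h.symm
      rw [← this]; module
    rw [(smul_eq_zero.1 h').resolve_left two_ne_zero, add_zero]
    exact hy
  · rw [sgn_one] at h
    have h' : (2 : ℝ) • y = 0 := by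
      have := sub_eq_zero.2 h
      rw [← this]; module
    rw [(smul_eq_zero.1 h').resolve_left two_ne_zero, zero_add]
    exact hz

/-- Both sides are algebra homomorphisms that kill the generators. Thus `l_0` is the projection to
degree zero, which identifies forms of degree zero with functions. -/
theorem map_zero_smul_id (x : ExteriorAlgebra ℝ V) :
    ExteriorAlgebra.map ((0 : ℝ) • (LinearMap.id : V →ₗ[ℝ] V)) x =
      algebraMap ℝ _ (ExteriorAlgebra.algebraMapInv x) := by
  have : ExteriorAlgebra.map ((0 : ℝ) • (LinearMap.id : V →ₗ[ℝ] V)) =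
      (Algebra.ofId ℝ _).comp ExteriorAlgebra.algebraMapInv := by
    ext v
    simp [ExteriorAlgebra.algebraMapInv]
  rw [this]
  rfl

end Exterior

/-! ### Functions and vector fields on `ΠE` -/

section Morphisms

variable {EB : Type*} [NormedAddCommGroup EB] [NormedSpace ℝ EB]
  {B : Type*} [TopologicalSpace B] [ChartedSpace EB B]
  {FE : Type*} [NormedAddCommGroup FE] [NormedSpace ℝ FE]
  {E : B → Type*} [∀ b, AddCommMonoid (E b)] [∀ b, Module ℝ (E b)]
  [TopologicalSpace (Bundle.TotalSpace FE E)] [∀ b, TopologicalSpace (E b)]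
  [FiberBundle FE E]
  {EB' : Type*} [NormedAddCommGroup EB'] [NormedSpace ℝ EB']
  {B' : Type*} [TopologicalSpace B'] [ChartedSpace EB' B']
  {FE' : Type*} [NormedAddCommGroup FE'] [NormedSpace ℝ FE']
  {E' : B' → Type*} [∀ b, AddCommMonoid (E' b)] [∀ b, Module ℝ (E' b)]
  [TopologicalSpace (Bundle.TotalSpace FE' E')] [∀ b, TopologicalSpace (E' b)]
  [FiberBundle FE' E']

theorem superFun_ext {η ζ : SuperFun EB FE E} (h : ∀ b, η.1 b = ζ.1 b) : η = ζ :=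
  Subtype.ext (funext h)

theorem ofBase_injective : Function.Injective (ofBase EB FE E) :=
  Function.LeftInverse.injective (g := body EB FE E) body_ofBase

theorem ofBase_mul_apply (f : C^∞⟮𝓘(ℝ, EB), B; ℝ⟯) (η : SuperFun EB FE E) (b : B) :
    (ofBase EB FE E f * η).1 b = f b • η.1 b := by
  rw [Algebra.smul_def]
  rfl

theorem ofBase_mul_comm (f : C^∞⟮𝓘(ℝ, EB), B; ℝ⟯) (η : SuperFun EB FE E) :
    ofBase EB FE E f * η = η * ofBase EB FE E f :=
  superFun_ext fun b => Algebra.commutes (f b) (η.1 b)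

theorem pull_apply (Φ : BundleMap EB B FE E EB' B' FE' E') (η : SuperFun EB' FE' E') (b : B) :
    (pull Φ η).1 b = ExteriorAlgebra.map (Φ.fib b).dualMap (η.1 (Φ.base b)) := rfl

theorem pull_ofBase (Φ : BundleMap EB B FE E EB' B' FE' E') (f : C^∞⟮𝓘(ℝ, EB'), B'; ℝ⟯) :
    pull Φ (ofBase EB' FE' E' f) = ofBase EB FE E (f.comp Φ.base) :=
  superFun_ext fun b => (ExteriorAlgebra.map (Φ.fib b).dualMap).commutes (f (Φ.base b))

/-- The pullback of a section of the dual bundle by a morphism of vector bundles. -/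
def pullCovector (Φ : BundleMap EB B FE E EB' B' FE' E') (θ : Covector EB' FE' E') :
    Covector EB FE E :=
  ⟨fun b => (Φ.fib b).dualMap (θ.toFun (Φ.base b)), θ.smooth.comp Φ.smooth⟩

theorem pull_ofCovector (Φ : BundleMap EB B FE E EB' B' FE' E') (θ : Covector EB' FE' E') :
    pull Φ (ofCovector EB' FE' E' θ) = ofCovector EB FE E (pullCovector Φ θ) :=
  superFun_ext fun _ => ExteriorAlgebra.map_apply_ι _ _

theorem pull_scale_apply [VectorBundle ℝ FE E] (t : ℝ) (η : SuperFun EB FE E) (b : B) :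
    (pull (scale EB FE E t) η).1 b = ExteriorAlgebra.map (t • LinearMap.id) (η.1 b) := by
  have : ((scale EB FE E t).fib b).dualMap = t • LinearMap.id := by
    ext θ v
    exact (θ.map_smul t v)
  rw [pull_apply, this]
  rfl

theorem pull_pull_scale [VectorBundle ℝ FE E] [VectorBundle ℝ FE' E']
    (Φ : BundleMap EB B FE E EB' B' FE' E') (t : ℝ) (η : SuperFun EB' FE' E') :
    pull (scale EB FE E t) (pull Φ η) = pull Φ (pull (scale EB' FE' E' t) η) := by
  refine superFun_ext fun b => ?_
  rw [pull_scale_apply, pull_apply, pull_apply, pull_scale_apply]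
  exact map_smul_id_map t (Φ.fib b).dualMap (η.1 (Φ.base b))

theorem contract_apply (s : Sec EB FE E) (η : SuperFun EB FE E) (b : B) :
    ((contract s).toLin η).1 b = CliffordAlgebra.contractLeft (Module.Dual.eval ℝ (E b) (s b))
      (η.1 b) := rfl

theorem contract_pull (Φ : BundleMap EB B FE E EB' B' FE' E') (s : Sec EB FE E)
    (s' : Sec EB' FE' E') (h : ∀ b, Φ.fib b (s b) = s' (Φ.base b)) (η : SuperFun EB' FE' E') :
    (contract s).toLin (pull Φ η) = pull Φ ((contract s').toLin η) := by
  refine superFun_ext fun b => ?_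
  have e : Module.Dual.eval ℝ (E b) (s b) ∘ₗ (Φ.fib b).dualMap =
      Module.Dual.eval ℝ (E' (Φ.base b)) (s' (Φ.base b)) := by
    ext θ
    simp [← h]
  rw [contract_apply, pull_apply, pull_apply, contract_apply, contractLeft_map, e]

theorem contract_ofBase (s : Sec EB FE E) (f : C^∞⟮𝓘(ℝ, EB), B; ℝ⟯) :
    (contract s).toLin (ofBase EB FE E f) = 0 :=
  superFun_ext fun b =>
    CliffordAlgebra.contractLeft_algebraMap 0 (Module.Dual.eval ℝ (E b) (s b)) (f b)

/-- The smooth function `θ(s)`. -/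
def Covector.eval (θ : Covector EB FE E) (s : Sec EB FE E) : C^∞⟮𝓘(ℝ, EB), B; ℝ⟯ :=
  ⟨fun b => θ.toFun b (s b), θ.smooth.comp s.contMDiff⟩

theorem contract_ofCovector (s : Sec EB FE E) (θ : Covector EB FE E) :
    (contract s).toLin (ofCovector EB FE E θ) = ofBase EB FE E (θ.eval s) :=
  superFun_ext fun b => CliffordAlgebra.contractLeft_ι 0 (Module.Dual.eval ℝ (E b) (s b)) _

/-- The hypothesis is pointwise so that for pulled-back sections it holds definitionally. -/
theorem contract_of_add {s t w : Sec EB FE E} (h : ∀ b, w b = s b + t b) (η : SuperFun EB FE E) :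
    (contract w).toLin η = (contract s).toLin η + (contract t).toLin η := by
  refine superFun_ext fun b => ?_
  rw [contract_apply, h, map_add, map_add]
  rfl

theorem contract_of_const_smul {s w : Sec EB FE E} {r : ℝ} (h : ∀ b, w b = r • s b)
    (η : SuperFun EB FE E) : (contract w).toLin η = r • (contract s).toLin η := by
  refine superFun_ext fun b => ?_
  rw [contract_apply, h, map_smul, map_smul]
  rfl

theorem contract_of_smul {s w : Sec EB FE E} {f : C^∞⟮𝓘(ℝ, EB), B; ℝ⟯} (h : ∀ b, w b = f b • s b)
    (η : SuperFun EB FE E) : (contract w).toLin η = ofBase EB FE E f * (contract s).toLin η := by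
  refine superFun_ext fun b => ?_
  rw [contract_apply, h, map_smul, map_smul, ofBase_mul_apply]
  rfl

end Morphisms

/-! ### Degrees of forms, weights and graded derivations -/

section Weights

variable {EB : Type*} [NormedAddCommGroup EB] [NormedSpace ℝ EB]
  {B : Type*} [TopologicalSpace B] [ChartedSpace EB B]
  {FE : Type*} [NormedAddCommGroup FE] [NormedSpace ℝ FE]
  {E : B → Type*} [∀ b, AddCommMonoid (E b)] [∀ b, Module ℝ (E b)]
  [TopologicalSpace (Bundle.TotalSpace FE E)] [∀ b, TopologicalSpace (E b)]
  [FiberBundle FE E]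

/-- `η` is a form of degree `k`. -/
def IsForm (k : ℕ) (η : SuperFun EB FE E) : Prop := ∀ b, η.1 b ∈ ⋀[ℝ]^k (Module.Dual ℝ (E b))

theorem isForm_ofBase (f : C^∞⟮𝓘(ℝ, EB), B; ℝ⟯) : IsForm 0 (ofBase EB FE E f) := fun b => by
  simpa using ⟨f b, rfl⟩

theorem isForm_ofCovector (θ : Covector EB FE E) : IsForm 1 (ofCovector EB FE E θ) := fun b => by
  simpa using ⟨θ.toFun b, rfl⟩

theorem IsForm.contract {k : ℕ} {η : SuperFun EB FE E} (h : IsForm k η) (s : Sec EB FE E) :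
    IsForm (k - 1) ((contract s).toLin η) := fun b => contractLeft_mem_degree _ (h b)

theorem IsForm.eq_ofBase {η : SuperFun EB FE E} (h : IsForm 0 η) :
    η = ofBase EB FE E (body EB FE E η) := by
  refine superFun_ext fun b => ?_
  have := map_smul_id_of_mem 0 (h b)
  -- Here `0 ^ 0 = 1`: the pullback along `l_0` fixes forms of degree zero.
  rw [map_zero_smul_id, pow_zero, one_smul] at this
  exact this.symm

theorem IsForm.mul_comm [VectorBundle ℝ FE E] {η : SuperFun EB FE E} (h : IsForm 1 η)
    (ζ : SuperFun EB FE E) : η * ζ = pull (scale EB FE E (-1)) ζ * η := by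
  refine superFun_ext fun b => ?_
  obtain ⟨θ, hθ⟩ : ∃ θ, ExteriorAlgebra.ι ℝ θ = η.1 b := by simpa using h b
  have := ι_mul_eq_involute_mul_ι θ (ζ.1 b)
  rwa [hθ, ← pull_scale_apply] at this

/-- Forms of positive degree are determined by their contractions with sections. -/
theorem IsForm.eq_of_contract_eq [∀ b, Module.IsReflexive ℝ (E b)]
    [∀ b, FiniteDimensional ℝ (Module.Dual ℝ (E b))] {ι : Type*} {s : ι → Sec EB FE E}
    (hs : ∀ b (v : E b), ∃ i, s i b = v) {k : ℕ} {η ζ : SuperFun EB FE E}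
    (hη : IsForm (k + 1) η) (hζ : IsForm (k + 1) ζ)
    (h : ∀ i, (WeightedConn.contract (s i)).toLin η = (WeightedConn.contract (s i)).toLin ζ) : η = ζ := by
  refine superFun_ext fun b => sub_eq_zero.1
    (eq_zero_of_contractLeft_eval_eq_zero (sub_mem (hη b) (hζ b)) fun v => ?_)
  obtain ⟨i, rfl⟩ := hs b v
  rw [map_sub, ← contract_apply, ← contract_apply, h, sub_self]

variable [VectorBundle ℝ FE E]

theorem pull_scale_ofBase (t : ℝ) (f : C^∞⟮𝓘(ℝ, EB), B; ℝ⟯) :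
    pull (scale EB FE E t) (ofBase EB FE E f) = ofBase EB FE E f :=
  pull_ofBase _ f

theorem pull_scale_one (η : SuperFun EB FE E) : pull (scale EB FE E 1) η = η := by
  refine superFun_ext fun b => ?_
  rw [pull_scale_apply, one_smul, ExteriorAlgebra.map_id]
  rfl

theorem pull_scale_neg_one_pull_scale_neg_one (η : SuperFun EB FE E) :
    pull (scale EB FE E (-1)) (pull (scale EB FE E (-1)) η) = η := by
  refine superFun_ext fun b => ?_
  simp only [pull_scale_apply, map_neg_one_eq_involute, CliffordAlgebra.involute_involute]

theorem IsForm.pull_scale {k : ℕ} {η : SuperFun EB FE E} (h : IsForm k η) (t : ℝ) :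
    pull (scale EB FE E t) η = t ^ k • η := by
  refine superFun_ext fun b => ?_
  rw [pull_scale_apply]
  exact map_smul_id_of_mem t (h b)

theorem isForm_of_pull_scale {k : ℕ} {η : SuperFun EB FE E}
    (h : pull (scale EB FE E 2) η = (2 : ℝ) ^ k • η) : IsForm k η := by
  intro b
  refine mem_of_map_smul_id ?_
  rw [← pull_scale_apply, h]
  rfl

theorem mem_parityPart_iff (i : ZMod 2) (η : SuperFun EB FE E) :
    η ∈ parityPart EB FE E i ↔ pull (scale EB FE E (-1)) η = sgn i • η := by
  constructor
  · intro h
    refine superFun_ext fun b => ?_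
    rw [pull_scale_apply]
    exact (mem_evenOdd_iff i _).1 (h b)
  · intro h b
    rw [mem_evenOdd_iff, ← pull_scale_apply, h]
    rfl

/-- A linear map of weight one with respect to `l_t` raises the degree of forms by one. -/
theorem IsForm.map_of_weight_one {L : SuperFun EB FE E →ₗ[ℝ] SuperFun EB FE E}
    (hL : ∀ (t : ℝ) (η : SuperFun EB FE E),
      pull (scale EB FE E t) (L η) = t • L (pull (scale EB FE E t) η))
    {k : ℕ} {η : SuperFun EB FE E} (h : IsForm k η) : IsForm (k + 1) (L η) := by
  refine isForm_of_pull_scale ?_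
  rw [hL, h.pull_scale, map_smul, smul_smul, pow_succ']

/-- The graded Leibniz rule for not necessarily homogeneous functions:
`D (a b) = D a b + l_s*(a) D b`,
where `s = ±1` is the sign of `D`. -/
def IsSkewDerivation (s : ℝ) (L : SuperFun EB FE E →ₗ[ℝ] SuperFun EB FE E) : Prop :=
  ∀ a b, L (a * b) = L a * b + pull (scale EB FE E s) a * L b

/-- The Leibniz rule of `SuperVect` asks for a homogeneous left factor, on which the sign is the
action of `l_{-1}` (odd field) or `l_1` (even field). By linearity this form of the rule holds for
every left factor, which is needed in local arguments where no parity is available. -/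
theorem SuperVect.isSkewDerivation {ε : ZMod 2} (X : SuperVect EB FE E ε) :
    IsSkewDerivation (sgn ε) X.toLin := by
  intro a b
  have hom : ∀ i, ∀ a ∈ parityPart EB FE E i,
      X.toLin (a * b) = X.toLin a * b + pull (scale EB FE E (sgn ε)) a * X.toLin b := by
    intro i a ha
    have hi : ∀ i : ZMod 2, i = 0 ∨ i = 1 := by decide
    rw [X.leibniz i a ha b]
    rcases hi ε with rfl | rfl
    · rw [zero_mul, sgn_zero, one_smul, pull_scale_one]
    · rw [one_mul, sgn_one, (mem_parityPart_iff i a).1 ha, smul_mul_assoc]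
  set a' := pull (scale EB FE E (-1)) a with ha'
  have h2 : pull (scale EB FE E (-1)) a' = a := pull_scale_neg_one_pull_scale_neg_one a
  -- The even and the odd part of `a`, as eigenvectors of `l_{-1}`.
  have e : a = (1 / 2 : ℝ) • (a + a') + (1 / 2 : ℝ) • (a - a') := by module
  have h0 := hom 0 ((1 / 2 : ℝ) • (a + a')) (Submodule.smul_mem _ _ ((mem_parityPart_iff _ _).2 (by
    rw [map_add, h2, ← ha', sgn_zero, one_smul, add_comm])))
  have h1 := hom 1 ((1 / 2 : ℝ) • (a - a')) (Submodule.smul_mem _ _ ((mem_parityPart_iff _ _).2 (by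
    rw [map_sub, h2, ← ha', sgn_one]; module)))
  rw [e, add_mul, map_add, map_add, map_add, h0, h1, add_mul, add_mul]
  abel

theorem SuperVect.isSkewDerivation_of_sgn_eq {ε : ZMod 2} (X : SuperVect EB FE E ε) {s : ℝ}
    (hs : sgn ε = s) : IsSkewDerivation s X.toLin :=
  hs ▸ X.isSkewDerivation

variable [FiniteDimensional ℝ EB] [IsManifold 𝓘(ℝ, EB) ∞ B] [T2Space B]

theorem exists_bump {b₀ : B} {p : B → Prop} (hp : ∀ᶠ b in 𝓝 b₀, p b) :
    ∃ χ : C^∞⟮𝓘(ℝ, EB), B; ℝ⟯, (∀ᶠ b in 𝓝 b₀, χ b = 1) ∧ ∀ b ∈ tsupport χ, p b := by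
  obtain ⟨χ, -, h⟩ := (SmoothBumpFunction.nhds_basis_tsupport (I := 𝓘(ℝ, EB)) b₀).mem_iff.1 hp
  exact ⟨⟨χ, χ.contMDiff⟩, χ.eventuallyEq_one, h⟩

/-- Locality: if `χ = 1` near `b₀` and `χ η = 0`, then `0 = L χ · η + χ · L η`, and at `b₀` only `L
η` survives. -/
theorem IsSkewDerivation.apply_eq_zero {s : ℝ} {L : SuperFun EB FE E →ₗ[ℝ] SuperFun EB FE E}
    (hL : IsSkewDerivation s L) {η : SuperFun EB FE E} {b₀ : B} (h : ∀ᶠ b in 𝓝 b₀, η.1 b = 0) :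
    (L η).1 b₀ = 0 := by
  obtain ⟨χ, h1, h0⟩ := exists_bump (EB := EB) h
  have hz : ofBase EB FE E χ * η = 0 := by
    refine superFun_ext fun b => ?_
    rw [ofBase_mul_apply]
    by_cases hb : b ∈ tsupport χ
    · rw [h0 b hb, smul_zero]; rfl
    · rw [image_eq_zero_of_notMem_tsupport hb, zero_smul]; rfl
  have := hL (ofBase EB FE E χ) η
  rw [hz, map_zero, pull_scale_ofBase] at this
  have h2 := congrFun (congrArg Subtype.val this) b₀
  have h3 : (L (ofBase EB FE E χ) * η + ofBase EB FE E χ * L η).1 b₀ =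
      (L (ofBase EB FE E χ)).1 b₀ * η.1 b₀ + (ofBase EB FE E χ * L η).1 b₀ := rfl
  rw [h3, h.self_of_nhds, mul_zero, zero_add, ofBase_mul_apply, h1.self_of_nhds, one_smul] at h2
  exact h2.symm

theorem IsSkewDerivation.apply_congr {s : ℝ} {L : SuperFun EB FE E →ₗ[ℝ] SuperFun EB FE E}
    (hL : IsSkewDerivation s L) {η ζ : SuperFun EB FE E} {b₀ : B}
    (h : ∀ᶠ b in 𝓝 b₀, η.1 b = ζ.1 b) : (L η).1 b₀ = (L ζ).1 b₀ := by
  have := hL.apply_eq_zero (η := η - ζ) (b₀ := b₀) (h.mono fun b hb => sub_eq_zero.2 hb)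
  rw [map_sub] at this
  exact sub_eq_zero.1 this

theorem SuperVect.apply_congr {ε : ZMod 2} (X : SuperVect EB FE E ε) {η ζ : SuperFun EB FE E} {b₀ : B}
    (h : ∀ᶠ b in 𝓝 b₀, η.1 b = ζ.1 b) : (X.toLin η).1 b₀ = (X.toLin ζ).1 b₀ :=
  X.isSkewDerivation.apply_congr h

/-- A superderivation is determined by its values on functions on the base and on covectors. -/
theorem IsSkewDerivation.ext {s : ℝ} {L L' : SuperFun EB FE E →ₗ[ℝ] SuperFun EB FE E}
    (hL : IsSkewDerivation s L) (hL' : IsSkewDerivation s L')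
    (hf : ∀ f, L (ofBase EB FE E f) = L' (ofBase EB FE E f))
    (hθ : ∀ θ, L (ofCovector EB FE E θ) = L' (ofCovector EB FE E θ)) : L = L' := by
  have key : ∀ g (hg : g ∈ Algebra.adjoin ℝ (generators EB FE E)),
      L ⟨g, adjoin_le_superFun hg⟩ = L' ⟨g, adjoin_le_superFun hg⟩ := by
    intro g hg
    induction hg using Algebra.adjoin_induction with
    | mem x hx =>
      rcases hx with ⟨f, rfl⟩ | ⟨θ, rfl⟩
      · exact hf f
      · exact hθ θ
    | algebraMap r => exact hf (algebraMap ℝ _ r)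
    | add x y hx hy h1 h2 =>
      have e : (⟨x + y, adjoin_le_superFun (add_mem hx hy)⟩ : SuperFun EB FE E) =
        ⟨x, adjoin_le_superFun hx⟩ + ⟨y, adjoin_le_superFun hy⟩ := rfl
      rw [e, map_add, map_add, h1, h2]
    | mul x y hx hy h1 h2 =>
      have e : (⟨x * y, adjoin_le_superFun (mul_mem hx hy)⟩ : SuperFun EB FE E) =
        ⟨x, adjoin_le_superFun hx⟩ * ⟨y, adjoin_le_superFun hy⟩ := rfl
      rw [e, hL, hL', h1, h2]
  refine LinearMap.ext fun η => superFun_ext fun b => ?_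
  obtain ⟨g, hg, h⟩ := η.2 b
  rw [hL.apply_congr (ζ := ⟨g, adjoin_le_superFun hg⟩) h,
    hL'.apply_congr (ζ := ⟨g, adjoin_le_superFun hg⟩) h, key g hg]

end Weights

/-! ### Local frames -/

section Frames

variable {EB : Type*} [NormedAddCommGroup EB] [NormedSpace ℝ EB]
  {B : Type*} [TopologicalSpace B] [ChartedSpace EB B]
  {FE : Type*} [NormedAddCommGroup FE] [NormedSpace ℝ FE]
  {E : B → Type*} [∀ b, AddCommMonoid (E b)] [∀ b, Module ℝ (E b)]
  [TopologicalSpace (Bundle.TotalSpace FE E)] [∀ b, TopologicalSpace (E b)]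
  [FiberBundle FE E]

/-- The sections `e i` and the covectors `ξ i` are dual bases at the point `b`. -/
structure IsDualAt {n : ℕ} (e : Fin n → Sec EB FE E) (ξ : Fin n → Covector EB FE E) (b : B) :
    Prop where
  sum_smul : ∀ v : E b, ∑ i, (ξ i).toFun b v • e i b = v
  dual : ∀ i j, (ξ i).toFun b (e j b) = if i = j then 1 else 0

theorem IsDualAt.covector_eq {n : ℕ} {e : Fin n → Sec EB FE E} {ξ : Fin n → Covector EB FE E}
    {b : B} (h : IsDualAt e ξ b) (θ : Module.Dual ℝ (E b)) :
    θ = ∑ i, θ (e i b) • (ξ i).toFun b := by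
  ext v
  conv_lhs => rw [← h.sum_smul v]
  simp [mul_comm]

theorem superFun_sum_apply {ι : Type*} (s : Finset ι) (η : ι → SuperFun EB FE E) (b : B) :
    (∑ i ∈ s, η i).1 b = ∑ i ∈ s, (η i).1 b := by
  simp [AddSubmonoidClass.coe_finsetSum]

theorem IsDualAt.ofCovector_apply {n : ℕ} {e : Fin n → Sec EB FE E} {ξ : Fin n → Covector EB FE E}
    {b : B} (h : IsDualAt e ξ b) (θ : Covector EB FE E) :
    (ofCovector EB FE E θ).1 b =
      (∑ i, ofBase EB FE E (θ.eval (e i)) * ofCovector EB FE E (ξ i)).1 b := by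
  simp only [superFun_sum_apply, ofBase_mul_apply]
  refine (congrArg (ExteriorAlgebra.ι ℝ) (h.covector_eq (θ.toFun b))).trans ?_
  rw [map_sum]
  refine Finset.sum_congr rfl fun i _ => ?_
  rw [map_smul]
  rfl

end Frames

section FrameExistence

variable {EB : Type*} [NormedAddCommGroup EB] [NormedSpace ℝ EB]
  {B : Type*} [TopologicalSpace B] [ChartedSpace EB B]
  {FE : Type*} [NormedAddCommGroup FE] [NormedSpace ℝ FE]
  {E : B → Type*} [∀ b, AddCommGroup (E b)] [∀ b, Module ℝ (E b)]
  [TopologicalSpace (Bundle.TotalSpace FE E)] [∀ b, TopologicalSpace (E b)]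
  [FiberBundle FE E] [VectorBundle ℝ FE E]

theorem sum_smulSec_apply [ContMDiffVectorBundle ∞ FE E 𝓘(ℝ, EB)] {n : ℕ}
    (f : Fin n → C^∞⟮𝓘(ℝ, EB), B; ℝ⟯) (e : Fin n → Sec EB FE E) (b : B) :
    (∑ i, smulSec (f i) (e i)) b = ∑ i, f i b • e i b := by
  have := congrFun (map_sum (ContMDiffSection.coeAddHom 𝓘(ℝ, EB) FE ∞ E)
    (fun i => smulSec (f i) (e i)) Finset.univ) b
  rw [Finset.sum_apply] at this
  exact this

variable [FiniteDimensional ℝ EB] [FiniteDimensional ℝ FE] [IsManifold 𝓘(ℝ, EB) ∞ B] [T2Space B]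
  [ContMDiffVectorBundle ∞ FE E 𝓘(ℝ, EB)]

variable (EB FE E) in
-- The frame and coframe of a trivialization, both cut off by the same bump function to become
-- global. They are dual where the bump function equals `1`.
theorem exists_frame (b₀ : B) :
    ∃ (e : Fin (Module.finrank ℝ FE) → Sec EB FE E)
      (ξ : Fin (Module.finrank ℝ FE) → Covector EB FE E), ∀ᶠ b in 𝓝 b₀, IsDualAt e ξ b := by
  let T := trivializationAt FE E b₀
  let c := Module.finBasis ℝ FE
  obtain ⟨χ, h1, h0⟩ := exists_bump (EB := EB)
    (T.open_baseSet.mem_nhds (FiberBundle.mem_baseSet_trivializationAt' b₀))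
  have hsec (i) : ContMDiff 𝓘(ℝ, EB) (𝓘(ℝ, EB).prod 𝓘(ℝ, FE)) ∞
      (fun b => (⟨b, ((χ : B → ℝ) • T.localFrame c i) b⟩ : Bundle.TotalSpace FE E)) :=
    ContMDiffOn.smul_section_of_tsupport χ.contMDiff.contMDiffOn T.open_baseSet h0
      (T.contMDiffOn_localFrame_baseSet ∞ c i)
  have hcov (i) : ContMDiff (𝓘(ℝ, EB).prod 𝓘(ℝ, FE)) 𝓘(ℝ, ℝ) ∞
      (fun v : Bundle.TotalSpace FE E =>
        (χ v.1 • (c.coord i ∘ₗ T.linearMapAt ℝ v.1) : Module.Dual ℝ (E v.1)) v.2) := by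
    intro v
    -- Over the support of `χ` the trivialization is smooth; off the support the covector vanishes
    -- on a neighbourhood.
    by_cases hv : v.1 ∈ tsupport χ
    · have hc : ContMDiff 𝓘(ℝ, FE) 𝓘(ℝ, ℝ) ∞ (c.coord i) :=
        (LinearMap.toContinuousLinearMap (c.coord i)).contMDiff
      have hs : ContMDiffAt (𝓘(ℝ, EB).prod 𝓘(ℝ, FE)) 𝓘(ℝ, FE) ∞
          (fun v : Bundle.TotalSpace FE E => (T v).2) v :=
        contMDiffAt_snd.comp v (T.contMDiffOn.contMDiffAt (T.open_source.mem_nhds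
          (T.mem_source.2 (h0 _ hv))))
      refine ((χ.contMDiff.contMDiffAt.comp v (Bundle.contMDiffAt_proj E)).smul
        (hc.contMDiffAt.comp v hs)).congr_of_eventuallyEq ?_
      filter_upwards [T.open_source.mem_nhds (T.mem_source.2 (h0 _ hv))] with w hw
      simp [T.coe_linearMapAt_of_mem (R := ℝ) (T.mem_source.1 hw)]
    · refine (contMDiffAt_const (c := (0 : ℝ))).congr_of_eventuallyEq ?_
      filter_upwards [(FiberBundle.continuous_proj FE E).continuousAt.eventually
        ((isClosed_tsupport χ).isOpen_compl.mem_nhds hv)] with w hw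
      simp [image_eq_zero_of_notMem_tsupport hw]
  refine ⟨fun i => ⟨_, hsec i⟩, fun i => ⟨fun b => χ b • (c.coord i ∘ₗ T.linearMapAt ℝ b), hcov i⟩, ?_⟩
  filter_upwards [h1, T.open_baseSet.mem_nhds (FiberBundle.mem_baseSet_trivializationAt' b₀)]
    with b hb hbT
  have e2 (i) : T.localFrame c i b = (T.linearEquivAt ℝ b hbT).symm (c i) := by
    simp [hbT, Bundle.Trivialization.basisAt]
  constructor
  · intro v
    have e3 := congrArg (T.linearEquivAt ℝ b hbT).symm (c.sum_repr (T.linearEquivAt ℝ b hbT v))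
    rw [map_sum, LinearEquiv.symm_apply_apply] at e3
    conv_rhs => rw [← e3]
    refine Finset.sum_congr rfl fun i _ => ?_
    simp [hb, T.linearMapAt_def_of_mem hbT, e2]
  · intro i j
    change χ b • c.coord i (T.linearMapAt ℝ b (χ b • T.localFrame c j b)) = _
    rw [hb, one_smul, one_smul, T.linearMapAt_def_of_mem hbT, e2, LinearEquiv.coe_coe,
      LinearEquiv.apply_symm_apply, Module.Basis.coord_apply, Module.Basis.repr_self,
      Finsupp.single_apply]
    simp only [eq_comm]

theorem exists_section_apply_eq (b : B) (v : E b) : ∃ s : Sec EB FE E, s b = v := by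
  obtain ⟨e, ξ, h⟩ := exists_frame EB FE E b
  refine ⟨∑ i, smulSec (ContMDiffMap.const ((ξ i).toFun b v)) (e i), ?_⟩
  rw [sum_smulSec_apply]
  exact h.self_of_nhds.sum_smul v

variable (EB FE) in
theorem eq_of_forall_covector {b : B} {v w : E b}
    (h : ∀ θ : Covector EB FE E, θ.toFun b v = θ.toFun b w) : v = w := by
  obtain ⟨e, ξ, hd⟩ := exists_frame EB FE E b
  rw [← hd.self_of_nhds.sum_smul v, ← hd.self_of_nhds.sum_smul w]
  simp only [h]

theorem contract_injective {s s' : Sec EB FE E} (h : (contract s).toLin = (contract s').toLin) :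
    s = s' := by
  refine ContMDiffSection.ext fun b => eq_of_forall_covector EB FE fun θ => ?_
  have := LinearMap.congr_fun h (ofCovector EB FE E θ)
  rw [contract_ofCovector, contract_ofCovector] at this
  exact DFunLike.congr_fun (ofBase_injective this) b

/-- An odd vector field of weight `-1` is the contraction with a section. -/
theorem exists_contract_eq {L : SuperFun EB FE E →ₗ[ℝ] SuperFun EB FE E}
    (hL : IsSkewDerivation (-1) L) (hf : ∀ f, L (ofBase EB FE E f) = 0)
    (hθ : ∀ θ, ∃ g, L (ofCovector EB FE E θ) = ofBase EB FE E g) :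
    ∃ w : Sec EB FE E, (contract w).toLin = L := by
  choose g hg using hθ
  -- The section sought is characterised at each point by `θ(w) = L θ` for all covectors `θ`; in a
  -- local frame this forces `w = ∑ L(ξ_i) e_i`.
  have loc (b₀ : B) : ∃ w : Sec EB FE E, ∀ᶠ b in 𝓝 b₀, ∀ θ, θ.toFun b (w b) = g θ b := by
    obtain ⟨e, ξ, hd⟩ := exists_frame EB FE E b₀
    refine ⟨∑ i, smulSec (g (ξ i)) (e i), ?_⟩
    -- Locality of `L` at `b` needs the frames to be dual on a whole neighbourhood of `b`.
    filter_upwards [hd.eventually_nhds] with b hb θ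
    have h1 := hL.apply_congr (hb.mono fun b' hb' => hb'.ofCovector_apply θ)
    have h2 : L (∑ i, ofBase EB FE E (θ.eval (e i)) * ofCovector EB FE E (ξ i)) =
        ofBase EB FE E (∑ i, θ.eval (e i) * g (ξ i)) := by
      simp only [map_sum, map_mul]
      refine Finset.sum_congr rfl fun i _ => ?_
      rw [hL, hf, zero_mul, zero_add, pull_scale_ofBase, hg]
    rw [hg, h2] at h1
    have h3 : g θ b = (∑ i, θ.eval (e i) * g (ξ i)) b :=
      (algebraMap ℝ (ExteriorAlgebra ℝ (Module.Dual ℝ (E b)))).injective h1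
    rw [h3, sum_smulSec_apply, map_sum]
    have h4 := map_sum (ContMDiffMap.evalRingHom (I := 𝓘(ℝ, EB)) (I' := 𝓘(ℝ, ℝ)) (n := ∞) b)
      (fun i => θ.eval (e i) * g (ξ i)) Finset.univ
    refine (h4.trans (Finset.sum_congr rfl fun i _ => ?_)).symm
    rw [map_smul, smul_eq_mul, mul_comm]
    rfl
  choose w hw using loc
  have hs : ContMDiff 𝓘(ℝ, EB) (𝓘(ℝ, EB).prod 𝓘(ℝ, FE)) ∞
      (fun b => (⟨b, w b b⟩ : Bundle.TotalSpace FE E)) := by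
    intro b₀
    refine ((w b₀).contMDiff b₀).congr_of_eventuallyEq ?_
    filter_upwards [hw b₀] with b hb
    -- The local solutions agree because covectors separate the vectors of a fibre; so choosing a
    -- solution for each point gives a smooth section.
    have : w b b = w b₀ b := eq_of_forall_covector EB FE fun θ => by
      rw [hb θ, (hw b).self_of_nhds θ]
    rw [this]
  refine ⟨⟨fun b => w b b, hs⟩, ?_⟩
  have hc := (contract (⟨fun b => w b b, hs⟩ : Sec EB FE E)).isSkewDerivation
  rw [sgn_one] at hc
  refine hc.ext hL (fun f => by rw [contract_ofBase, hf]) fun θ => ?_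
  rw [contract_ofCovector, hg]
  congr 1
  ext b
  exact (hw b).self_of_nhds θ

end FrameExistence

/-! ### Odd vector fields of weight one and their brackets with contractions -/

section WeightOne

variable {EB : Type*} [NormedAddCommGroup EB] [NormedSpace ℝ EB]
  {B : Type*} [TopologicalSpace B] [ChartedSpace EB B]
  {FE : Type*} [NormedAddCommGroup FE] [NormedSpace ℝ FE]
  {E : B → Type*} [∀ b, AddCommMonoid (E b)] [∀ b, Module ℝ (E b)]
  [TopologicalSpace (Bundle.TotalSpace FE E)] [∀ b, TopologicalSpace (E b)]
  [FiberBundle FE E]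

theorem superBracket_apply {ε δ : ZMod 2} (X : SuperVect EB FE E ε) (Y : SuperVect EB FE E δ)
    (η : SuperFun EB FE E) : (superBracket X Y).toLin η =
      X.toLin (Y.toLin η) - sgn (ε * δ) • Y.toLin (X.toLin η) := rfl

theorem superBracket_contract_apply (N : SuperVect EB FE E 1) (s : Sec EB FE E)
    (η : SuperFun EB FE E) : (superBracket N (contract s)).toLin η =
      N.toLin ((contract s).toLin η) + (contract s).toLin (N.toLin η) := by
  rw [superBracket_apply, mul_one, sgn_one]
  module

theorem superBracket_contract_contract_apply (N : SuperVect EB FE E 1) (s t : Sec EB FE E)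
    (η : SuperFun EB FE E) : (superBracket (superBracket N (contract s)) (contract t)).toLin η =
      N.toLin ((contract s).toLin ((contract t).toLin η)) +
        (contract s).toLin (N.toLin ((contract t).toLin η)) -
        (contract t).toLin (N.toLin ((contract s).toLin η)) -
        (contract t).toLin ((contract s).toLin (N.toLin η)) := by
  rw [superBracket_apply, superBracket_contract_apply, superBracket_contract_apply, map_add,
    show ((1 : ZMod 2) + 1) * 1 = 0 from rfl, sgn_zero]
  module

theorem pushforward_apply {ε : ZMod 2} (X : SuperVect EB FE E ε) (f : C^∞⟮𝓘(ℝ, EB), B; ℝ⟯) :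
    pushforward X f = body EB FE E (X.toLin (ofBase EB FE E f)) := rfl

/-- Contractions kill functions, so only one term of the bracket remains. The lift is thereby read
off from the form `N f`. -/
theorem superBracket_contract_ofBase (N : SuperVect EB FE E 1) (s : Sec EB FE E)
    (f : C^∞⟮𝓘(ℝ, EB), B; ℝ⟯) : (superBracket N (contract s)).toLin (ofBase EB FE E f) =
      (contract s).toLin (N.toLin (ofBase EB FE E f)) := by
  rw [superBracket_contract_apply, contract_ofBase, map_zero, zero_add]

/-- Of the four terms in the expansion, three contract a function first. The sign comes from the
inner bracket, where `N²` is even; the outer one is a bracket of two odd fields. -/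
theorem superBracket_superSq_contract_contract_ofBase (N : SuperVect EB FE E 1) (s t : Sec EB FE E)
    (f : C^∞⟮𝓘(ℝ, EB), B; ℝ⟯) : (superBracket (superBracket (superSq N) (contract s))
      (contract t)).toLin (ofBase EB FE E f) =
      -(contract t).toLin ((contract s).toLin (N.toLin (N.toLin (ofBase EB FE E f)))) := by
  rw [superBracket_apply, superBracket_apply, superBracket_apply, contract_ofBase, contract_ofBase,
    ← superSq_apply, show sgn ((1 + 1 + 1) * 1) = -1 from sgn_one,
    show sgn ((1 + 1) * 1) = 1 from sgn_zero]
  simp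

variable [VectorBundle ℝ FE E]

theorem superSq_isSkewDerivation (N : SuperVect EB FE E 1) :
    IsSkewDerivation 1 (superSq N).toLin :=
  (superSq N).isSkewDerivation_of_sgn_eq (show sgn (1 + 1) = 1 from sgn_zero)

theorem superBracket_contract_contract_isSkewDerivation (N : SuperVect EB FE E 1)
    (s t : Sec EB FE E) :
    IsSkewDerivation (-1) (superBracket (superBracket N (contract s)) (contract t)).toLin :=
  SuperVect.isSkewDerivation_of_sgn_eq _ (show sgn (1 + 1 + 1) = -1 from sgn_one)

theorem contract_isSkewDerivation (s : Sec EB FE E) : IsSkewDerivation (-1) (contract s).toLin :=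
  (contract s).isSkewDerivation_of_sgn_eq sgn_one

theorem isSkewDerivation_zero (s : ℝ) :
    IsSkewDerivation s (0 : SuperFun EB FE E →ₗ[ℝ] SuperFun EB FE E) := fun a b => by simp

/-- The vector field `N` has weight one. -/
def HasWeightOne (N : SuperVect EB FE E 1) : Prop :=
  ∀ (t : ℝ) (η : SuperFun EB FE E),
    pull (scale EB FE E t) (N.toLin η) = t • N.toLin (pull (scale EB FE E t) η)

variable {N : SuperVect EB FE E 1} (hN : HasWeightOne N)

include hN

theorem HasWeightOne.isForm {k : ℕ} {η : SuperFun EB FE E} (h : IsForm k η) :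
    IsForm (k + 1) (N.toLin η) := h.map_of_weight_one hN

theorem HasWeightOne.contract_ofBase (s : Sec EB FE E) (f : C^∞⟮𝓘(ℝ, EB), B; ℝ⟯) :
    (contract s).toLin (N.toLin (ofBase EB FE E f)) =
      ofBase EB FE E (pushforward (superBracket N (contract s)) f) := by
  rw [pushforward_apply, superBracket_contract_ofBase]
  exact ((hN.isForm (isForm_ofBase f)).contract s).eq_ofBase

/-- The double bracket lowers the degree by one, which leaves nothing for functions. -/
theorem HasWeightOne.superBracket_contract_contract_ofBase (s t : Sec EB FE E)
    (f : C^∞⟮𝓘(ℝ, EB), B; ℝ⟯) :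
    (superBracket (superBracket N (contract s)) (contract t)).toLin (ofBase EB FE E f) = 0 := by
  rw [superBracket_contract_contract_apply, WeightedConn.contract_ofBase,
    WeightedConn.contract_ofBase, hN.contract_ofBase, WeightedConn.contract_ofBase]
  simp

theorem HasWeightOne.superBracket_contract_contract_ofCovector (s t : Sec EB FE E)
    (θ : Covector EB FE E) : ∃ g,
    (superBracket (superBracket N (contract s)) (contract t)).toLin (ofCovector EB FE E θ) =
      ofBase EB FE E g := by
  refine ⟨_, IsForm.eq_ofBase ?_⟩
  rw [superBracket_contract_contract_apply, contract_ofCovector, contract_ofCovector,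
    WeightedConn.contract_ofBase, map_zero, zero_add]
  refine fun b => sub_mem (sub_mem ?_ ?_) ?_
  · exact (hN.isForm (isForm_ofBase _)).contract _ b
  · exact (hN.isForm (isForm_ofBase _)).contract _ b
  · exact ((hN.isForm (isForm_ofCovector θ)).contract _).contract _ b

/-- Cartan's formula behind the curvature identity. On the one-form `N f` the four terms of the
double bracket are `0` (two contractions of a one-form), `H_s H_t f`, `-H_t H_s f` and `-ι_t ι_s N²
f`, where `H_s f = ι_s N f`. -/
theorem HasWeightOne.contract_contract_sq (s t : Sec EB FE E) (f : C^∞⟮𝓘(ℝ, EB), B; ℝ⟯) :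
    -(contract t).toLin ((contract s).toLin (N.toLin (N.toLin (ofBase EB FE E f)))) =
      (superBracket (superBracket N (contract s)) (contract t)).toLin
        (N.toLin (ofBase EB FE E f)) -
      ofBase EB FE E (⁅pushforward (superBracket N (contract s)),
        pushforward (superBracket N (contract t))⁆ f) := by
  rw [superBracket_contract_contract_apply, hN.contract_ofBase, hN.contract_ofBase,
    WeightedConn.contract_ofBase, hN.contract_ofBase, hN.contract_ofBase, map_zero,
    Derivation.commutator_apply, map_sub]
  abel

end WeightOne

section FrameExt

variable {EB : Type*} [NormedAddCommGroup EB] [NormedSpace ℝ EB] [FiniteDimensional ℝ EB]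
  {B : Type*} [TopologicalSpace B] [ChartedSpace EB B] [IsManifold 𝓘(ℝ, EB) ∞ B] [T2Space B]
  {FE : Type*} [NormedAddCommGroup FE] [NormedSpace ℝ FE]
  {E : B → Type*} [∀ b, AddCommMonoid (E b)] [∀ b, Module ℝ (E b)]
  [TopologicalSpace (Bundle.TotalSpace FE E)] [∀ b, TopologicalSpace (E b)]
  [FiberBundle FE E] [VectorBundle ℝ FE E]

/-- A superderivation is determined by its values on functions on the base and on local coframes. -/
theorem IsSkewDerivation.ext_frame {s : ℝ} {L L' : SuperFun EB FE E →ₗ[ℝ] SuperFun EB FE E}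
    (hL : IsSkewDerivation s L) (hL' : IsSkewDerivation s L')
    (hf : ∀ f, L (ofBase EB FE E f) = L' (ofBase EB FE E f))
    (hξ : ∀ b₀ : B, ∃ (n : ℕ) (e : Fin n → Sec EB FE E) (ξ : Fin n → Covector EB FE E),
      (∀ᶠ b in 𝓝 b₀, IsDualAt e ξ b) ∧
      ∀ i, L (ofCovector EB FE E (ξ i)) = L' (ofCovector EB FE E (ξ i))) : L = L' := by
  refine hL.ext hL' hf fun θ => superFun_ext fun b₀ => ?_
  obtain ⟨n, e, ξ, hd, h⟩ := hξ b₀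
  have h1 := hd.mono fun b hb => hb.ofCovector_apply θ
  have h2 : L (∑ i, ofBase EB FE E (θ.eval (e i)) * ofCovector EB FE E (ξ i)) =
      L' (∑ i, ofBase EB FE E (θ.eval (e i)) * ofCovector EB FE E (ξ i)) := by
    rw [map_sum, map_sum]
    refine Finset.sum_congr rfl fun i _ => ?_
    rw [hL, hL', hf, h]
  rw [hL.apply_congr h1, hL'.apply_congr h1, h2]

end FrameExt

/-! ### The bracket of a Lie algebroid -/

section Algebroid

variable {EM : Type*} [NormedAddCommGroup EM] [NormedSpace ℝ EM] [FiniteDimensional ℝ EM]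
  {M : Type*} [TopologicalSpace M] [ChartedSpace EM M] [IsManifold 𝓘(ℝ, EM) ∞ M] [T2Space M]
  {FA : Type*} [NormedAddCommGroup FA] [NormedSpace ℝ FA] [FiniteDimensional ℝ FA]
  {A : M → Type*} [∀ x, AddCommGroup (A x)] [∀ x, Module ℝ (A x)]
  [TopologicalSpace (Bundle.TotalSpace FA A)] [∀ x, TopologicalSpace (A x)]
  [FiberBundle FA A] [VectorBundle ℝ FA A] [ContMDiffVectorBundle ∞ FA A 𝓘(ℝ, EM)]
  (D : LieAlgebroid EM FA A)

/-- The choice in `bracket` has the intended value only if some section satisfies its equation. One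
does: the double bracket is an odd derivation that kills functions and sends covectors to functions,
hence a contraction. -/
theorem LieAlgebroid.contract_bracket (u v : Sec EM FA A) :
    (contract (D.bracket u v)).toLin =
      (superBracket (superBracket D.d (contract u)) (contract v)).toLin := by
  exact Classical.epsilon_spec (p := fun w : Sec EM FA A => (contract w).toLin =
    (superBracket (superBracket D.d (contract u)) (contract v)).toLin)
    (exists_contract_eq (superBracket_contract_contract_isSkewDerivation _ u v)
      (HasWeightOne.superBracket_contract_contract_ofBase D.weight u v)
      (HasWeightOne.superBracket_contract_contract_ofCovector D.weight u v))

theorem LieAlgebroid.eq_bracket_iff (u v w : Sec EM FA A) : w = D.bracket u v ↔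
    (contract w).toLin = (superBracket (superBracket D.d (contract u)) (contract v)).toLin := by
  rw [← D.contract_bracket]
  exact ⟨fun h => h ▸ rfl, contract_injective⟩

end Algebroid

/-! ### The pullback of the algebroid to a graded bundle -/

section Pullbacks

variable {EM : Type*} [NormedAddCommGroup EM] [NormedSpace ℝ EM]
  {M : Type*} [TopologicalSpace M] [ChartedSpace EM M]
  {EF : Type*} [NormedAddCommGroup EF] [NormedSpace ℝ EF]
  {F : Type*} [TopologicalSpace F] [ChartedSpace EF F]
  {FA : Type*} [NormedAddCommGroup FA] [NormedSpace ℝ FA]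
  {A : M → Type*} [∀ x, AddCommGroup (A x)] [∀ x, Module ℝ (A x)]
  [TopologicalSpace (Bundle.TotalSpace FA A)] [∀ x, TopologicalSpace (A x)]
  [FiberBundle FA A] [VectorBundle ℝ FA A]
  (G : GradedBundle EM M EF F)

omit [VectorBundle ℝ FA A] in
theorem contract_pullSec_pull_pA (u : Sec EM FA A) (η : SuperFun EM FA A) :
    (contract (G.pullSec u)).toLin (pull (G.pA FA A) η) =
      pull (G.pA FA A) ((contract u).toLin η) :=
  contract_pull _ _ _ (fun _ => rfl) η

omit [TopologicalSpace M] [(x : M) → TopologicalSpace (A x)] in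
-- The fibres `A (τ p)` and `A (τ (h_t p))` are equal but not definitionally so. An arbitrary
-- equality `x = y` allows the cast to be eliminated.
theorem cast_section_apply {x y : M} (h : x = y) (u : ∀ x, A x) :
    (cast (congrArg (fun z => A x →ₗ[ℝ] A z) h) LinearMap.id : A x →ₗ[ℝ] A y) (u x) = u y := by
  subst h
  rfl

omit [VectorBundle ℝ FA A] in
theorem contract_pullSec_pull_hA (t : ℝ) (u : Sec EM FA A) (η : SuperFun EF FA (G.τ *ᵖ A)) :
    (contract (G.pullSec u)).toLin (pull (G.hA FA A t) η) =
      pull (G.hA FA A t) ((contract (G.pullSec u)).toLin η) :=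
  contract_pull _ _ _ (fun p => cast_section_apply (G.τ_h t p).symm u) η

omit [VectorBundle ℝ FA A] in
theorem pull_pA_apply (η : SuperFun EM FA A) (p : F) :
    (pull (G.pA FA A) η).1 p = η.1 (G.τ p) := by
  have : (pull (G.pA FA A) η).1 p =
      ExteriorAlgebra.map (LinearMap.id : Module.Dual ℝ (A (G.τ p)) →ₗ[ℝ] _) (η.1 (G.τ p)) := rfl
  rw [this, ExteriorAlgebra.map_id]
  rfl

omit [TopologicalSpace M] [(x : M) → TopologicalSpace (A x)] in
-- The dual form of the same elimination: a family indexed by `M` does not notice the identification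
-- of the fibres over `p` and `h_t p`.
theorem dualMap_cast_dualMap_id {x y : M} (h : x = y)
    (c : ∀ x, ExteriorAlgebra ℝ (Module.Dual ℝ (A x))) :
    ExteriorAlgebra.map
      (cast (congrArg (fun z => A x →ₗ[ℝ] A z) h) LinearMap.id : A x →ₗ[ℝ] A y).dualMap (c y) =
      c x := by
  subst h
  have : ExteriorAlgebra.map (LinearMap.id : A x →ₗ[ℝ] A x).dualMap = AlgHom.id ℝ _ := by
    rw [LinearMap.dualMap_id, ExteriorAlgebra.map_id]
  exact DFunLike.congr_fun this _

theorem pull_hA_pull_pA (t : ℝ) (η : SuperFun EM FA A) :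
    pull (G.hA FA A t) (pull (G.pA FA A) η) = pull (G.pA FA A) η := by
  refine superFun_ext fun p => ?_
  rw [pull_pA_apply, pull_apply]
  have := pull_pA_apply G η ((G.hA FA A t).base p)
  rw [this]
  exact dualMap_cast_dualMap_id (G.τ_h t p).symm η.1

omit [VectorBundle ℝ FA A] in
theorem IsDualAt.pullback {n : ℕ} {e : Fin n → Sec EM FA A} {ξ : Fin n → Covector EM FA A} {p : F}
    (h : IsDualAt e ξ (G.τ p)) :
    IsDualAt (fun i => G.pullSec (e i)) (fun i => pullCovector (G.pA FA A) (ξ i)) p :=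
  ⟨h.sum_smul, h.dual⟩

variable [FiniteDimensional ℝ EM] [IsManifold 𝓘(ℝ, EM) ∞ M] [T2Space M]
  [FiniteDimensional ℝ EF] [IsManifold 𝓘(ℝ, EF) ∞ F] [T2Space F]
  [FiniteDimensional ℝ FA] [ContMDiffVectorBundle ∞ FA A 𝓘(ℝ, EM)]

/-- A superderivation on `τ*ΠA` is determined by its values on functions on `F` and on covectors
pulled back from `A`. -/
theorem IsSkewDerivation.ext_pullback {s : ℝ}
    {L L' : SuperFun EF FA (G.τ *ᵖ A) →ₗ[ℝ] SuperFun EF FA (G.τ *ᵖ A)}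
    (hL : IsSkewDerivation s L) (hL' : IsSkewDerivation s L')
    (hf : ∀ f, L (ofBase EF FA (G.τ *ᵖ A) f) = L' (ofBase EF FA (G.τ *ᵖ A) f))
    (hθ : ∀ θ, L (pull (G.pA FA A) (ofCovector EM FA A θ)) =
      L' (pull (G.pA FA A) (ofCovector EM FA A θ))) : L = L' := by
  refine hL.ext_frame hL' hf fun p => ?_
  obtain ⟨e, ξ, hd⟩ := exists_frame EM FA A (G.τ p)
  refine ⟨_, fun i => G.pullSec (e i), fun i => pullCovector (G.pA FA A) (ξ i), ?_, fun i => ?_⟩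
  · exact (G.τ.contMDiff.continuous.continuousAt.eventually hd).mono fun q hq => hq.pullback G
  · have := hθ (ξ i)
    rwa [pull_ofCovector] at this

omit [FiniteDimensional ℝ EF] [IsManifold 𝓘(ℝ, EF) ∞ F] [T2Space F] in
-- Sections pulled back from `M` suffice as tests, since `(τ*A)_p = A_{τ p}` and sections of `A`
-- take every value there. Degree zero is excluded, as contractions do not see functions.
theorem eq_of_contract_pullSec {k : ℕ} {η ζ : SuperFun EF FA (G.τ *ᵖ A)}
    (hη : IsForm (k + 1) η) (hζ : IsForm (k + 1) ζ)
    (h : ∀ u : Sec EM FA A, (contract (G.pullSec u)).toLin η = (contract (G.pullSec u)).toLin ζ) :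
    η = ζ := by
  have hA (x : M) : FiniteDimensional ℝ (A x) :=
    Module.Finite.equiv ((trivializationAt FA A x).linearEquivAt ℝ x
      (FiberBundle.mem_baseSet_trivializationAt' _)).symm
  have h1 (p : F) : Module.IsReflexive ℝ ((G.τ *ᵖ A) p) :=
    inferInstanceAs (Module.IsReflexive ℝ (A (G.τ p)))
  have h2 (p : F) : FiniteDimensional ℝ (Module.Dual ℝ ((G.τ *ᵖ A) p)) :=
    inferInstanceAs (FiniteDimensional ℝ (Module.Dual ℝ (A (G.τ p))))
  exact hη.eq_of_contract_eq (s := G.pullSec) (fun p v => exists_section_apply_eq (G.τ p) v) hζ h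

theorem eq_zero_of_contract_pullSec {k : ℕ} {η : SuperFun EF FA (G.τ *ᵖ A)} (hη : IsForm (k + 1) η)
    (h : ∀ u : Sec EM FA A, (contract (G.pullSec u)).toLin η = 0) : η = 0 :=
  eq_of_contract_pullSec G hη (fun _ => zero_mem _) fun u => (h u).trans (LinearMap.map_zero _).symm

end Pullbacks

/-! ### The generalised horizontal lift -/

section Lift

variable {EM : Type*} [NormedAddCommGroup EM] [NormedSpace ℝ EM]
  {M : Type*} [TopologicalSpace M] [ChartedSpace EM M]
  {EF : Type*} [NormedAddCommGroup EF] [NormedSpace ℝ EF]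
  {F : Type*} [TopologicalSpace F] [ChartedSpace EF F]
  {FA : Type*} [NormedAddCommGroup FA] [NormedSpace ℝ FA]
  {A : M → Type*} [∀ x, AddCommGroup (A x)] [∀ x, Module ℝ (A x)]
  [TopologicalSpace (Bundle.TotalSpace FA A)] [∀ x, TopologicalSpace (A x)]
  [FiberBundle FA A] [VectorBundle ℝ FA A]
  {D : LieAlgebroid EM FA A} {G : GradedBundle EM M EF F}
  {N N' : SuperVect EF FA (G.τ *ᵖ A) 1}

theorem IsWeightedConnection.hasWeightOne (hN : IsWeightedConnection D G N) : HasWeightOne N :=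
  hN.weight_l

theorem contract_eq_ofBase_horizontalLift (hN : HasWeightOne N) (u : Sec EM FA A)
    (f : C^∞⟮𝓘(ℝ, EF), F; ℝ⟯) :
    (contract (G.pullSec u)).toLin (N.toLin (ofBase EF FA (G.τ *ᵖ A) f)) =
      ofBase EF FA (G.τ *ᵖ A) (horizontalLift N u f) :=
  hN.contract_ofBase _ f

theorem liftBracket_ofBase (hN : HasWeightOne N) (u : Sec EM FA A) (f : C^∞⟮𝓘(ℝ, EF), F; ℝ⟯) :
    (liftBracket N u).toLin (ofBase EF FA (G.τ *ᵖ A) f) =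
      ofBase EF FA (G.τ *ᵖ A) (horizontalLift N u f) :=
  (superBracket_contract_ofBase _ _ _).trans (contract_eq_ofBase_horizontalLift hN u f)

/-- Every identity for the lift is proved in this form, as an identity for a contraction of the
one-form `∇f`. -/
theorem horizontalLift_eq_iff (hN : HasWeightOne N) (u : Sec EM FA A)
    (f g : C^∞⟮𝓘(ℝ, EF), F; ℝ⟯) : horizontalLift N u f = g ↔
      (contract (G.pullSec u)).toLin (N.toLin (ofBase EF FA (G.τ *ᵖ A) f)) =
        ofBase EF FA (G.τ *ᵖ A) g := by
  rw [contract_eq_ofBase_horizontalLift hN]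
  exact ofBase_injective.eq_iff.symm

theorem LieAlgebroid.d_d (D : LieAlgebroid EM FA A) (η : SuperFun EM FA A) :
    D.d.toLin (D.d.toLin η) = 0 := by
  rw [← superSq_apply, D.homological]
  rfl

theorem LieAlgebroid.contract_d_ofBase (D : LieAlgebroid EM FA A) (u : Sec EM FA A)
    (f : C^∞⟮𝓘(ℝ, EM), M; ℝ⟯) :
    (contract u).toLin (D.d.toLin (ofBase EM FA A f)) = ofBase EM FA A (D.anchor u f) :=
  HasWeightOne.contract_ofBase D.weight u f

theorem IsWeightedConnection.horizontalLift_add (hN : IsWeightedConnection D G N)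
    (u v : Sec EM FA A) : horizontalLift N (u + v) = horizontalLift N u + horizontalLift N v := by
  refine Derivation.ext fun f => (horizontalLift_eq_iff hN.hasWeightOne _ _ _).2 ?_
  rw [Derivation.add_apply, map_add, ← contract_eq_ofBase_horizontalLift hN.hasWeightOne,
    ← contract_eq_ofBase_horizontalLift hN.hasWeightOne]
  exact contract_of_add (fun _ => rfl) _

theorem IsWeightedConnection.horizontalLift_smul (hN : IsWeightedConnection D G N)
    (r : ℝ) (u : Sec EM FA A) : horizontalLift N (r • u) = r • horizontalLift N u := by
  refine Derivation.ext fun f => (horizontalLift_eq_iff hN.hasWeightOne _ _ _).2 ?_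
  rw [Derivation.smul_apply, map_smul, ← contract_eq_ofBase_horizontalLift hN.hasWeightOne]
  exact contract_of_const_smul (fun _ => rfl) _

theorem IsWeightedConnection.horizontalLift_comp_hMap (hN : IsWeightedConnection D G N)
    (u : Sec EM FA A) (t : ℝ) (f : C^∞⟮𝓘(ℝ, EF), F; ℝ⟯) :
    (horizontalLift N u f).comp (G.hMap t) = horizontalLift N u (f.comp (G.hMap t)) := by
  refine ((horizontalLift_eq_iff hN.hasWeightOne _ _ _).2 ?_).symm
  have h1 : pull (G.hA FA A t) (ofBase EF FA (G.τ *ᵖ A) f) =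
      ofBase EF FA (G.τ *ᵖ A) (f.comp (G.hMap t)) := pull_ofBase (G.hA FA A t) f
  rw [← h1, ← hN.weight_h, contract_pullSec_pull_hA]
  exact (congrArg (pull (G.hA FA A t))
    (contract_eq_ofBase_horizontalLift hN.hasWeightOne u f)).trans (pull_ofBase (G.hA FA A t) _)

theorem IsWeightedConnection.horizontalLift_comp_τ (hN : IsWeightedConnection D G N)
    (u : Sec EM FA A) (f : C^∞⟮𝓘(ℝ, EM), M; ℝ⟯) :
    horizontalLift N u (f.comp G.τ) = (D.anchor u f).comp G.τ := by
  refine (horizontalLift_eq_iff hN.hasWeightOne _ _ _).2 ?_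
  have h1 (f) : pull (G.pA FA A) (ofBase EM FA A f) = ofBase EF FA (G.τ *ᵖ A) (f.comp G.τ) :=
    pull_ofBase (G.pA FA A) f
  rw [← h1, ← h1, hN.projects, contract_pullSec_pull_pA, D.contract_d_ofBase]

variable [ContMDiffVectorBundle ∞ FA A 𝓘(ℝ, EM)]

theorem IsWeightedConnection.horizontalLift_smulSec (hN : IsWeightedConnection D G N)
    (g : C^∞⟮𝓘(ℝ, EM), M; ℝ⟯) (u : Sec EM FA A) :
    horizontalLift N (smulSec g u) = g.comp G.τ • horizontalLift N u := by
  refine Derivation.ext fun f => (horizontalLift_eq_iff hN.hasWeightOne _ _ _).2 ?_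
  rw [Derivation.smul_apply, smul_eq_mul, map_mul,
    ← contract_eq_ofBase_horizontalLift hN.hasWeightOne]
  exact contract_of_smul (fun _ => rfl) _

theorem IsWeightedConnection.isQuasiAction (hN : IsWeightedConnection D G N) :
    IsQuasiAction D G (horizontalLift N) where
  map_add := hN.horizontalLift_add
  map_smul := hN.horizontalLift_smul
  weight := hN.horizontalLift_comp_hMap
  projects := hN.horizontalLift_comp_τ
  map_smulSec := hN.horizontalLift_smulSec

variable [FiniteDimensional ℝ EM] [IsManifold 𝓘(ℝ, EM) ∞ M] [T2Space M]
  [FiniteDimensional ℝ EF] [IsManifold 𝓘(ℝ, EF) ∞ F] [T2Space F]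
  [FiniteDimensional ℝ FA]

/-- Both sides are odd derivations and vanish on functions on `F`. On pulled-back covectors `∇` acts
as `d_A`, and the claim becomes the defining equation of the bracket of `A`. -/
theorem IsWeightedConnection.contract_bracket (hN : IsWeightedConnection D G N)
    (u v : Sec EM FA A) :
    (superBracket (superBracket N (contract (G.pullSec u))) (contract (G.pullSec v))).toLin =
      (contract (G.pullSec (D.bracket u v))).toLin := by
  refine IsSkewDerivation.ext_pullback G (superBracket_contract_contract_isSkewDerivation _ _ _)
    (contract_isSkewDerivation _) (fun f => ?_) (fun θ => ?_)
  · rw [HasWeightOne.superBracket_contract_contract_ofBase hN.hasWeightOne, contract_ofBase]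
  · rw [contract_pullSec_pull_pA, D.contract_bracket, superBracket_contract_contract_apply,
      superBracket_contract_contract_apply]
    simp only [contract_pullSec_pull_pA, hN.projects, map_add, map_sub]

theorem IsWeightedConnection.contract_contract_sq (hN : IsWeightedConnection D G N)
    (u v : Sec EM FA A) (f : C^∞⟮𝓘(ℝ, EF), F; ℝ⟯) :
    -(contract (G.pullSec v)).toLin ((contract (G.pullSec u)).toLin
      (N.toLin (N.toLin (ofBase EF FA (G.τ *ᵖ A) f)))) =
    ofBase EF FA (G.τ *ᵖ A)
      ((horizontalLift N (D.bracket u v) - ⁅horizontalLift N u, horizontalLift N v⁆) f) := by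
  have h := HasWeightOne.contract_contract_sq hN.hasWeightOne (G.pullSec u) (G.pullSec v) f
  rw [hN.contract_bracket, contract_eq_ofBase_horizontalLift hN.hasWeightOne] at h
  rw [h, Derivation.sub_apply, map_sub]
  rfl

theorem IsWeightedConnection.curvature (hN : IsWeightedConnection D G N)
    (u v : Sec EM FA A) (f : C^∞⟮𝓘(ℝ, EF), F; ℝ⟯) :
    (superBracket (superBracket (superSq N) (contract (G.pullSec u)))
      (contract (G.pullSec v))).toLin (ofBase EF FA (G.τ *ᵖ A) f) =
    ofBase EF FA (G.τ *ᵖ A)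
      ((horizontalLift N (D.bracket u v) - ⁅horizontalLift N u, horizontalLift N v⁆) f) := by
  rw [← hN.contract_contract_sq, superBracket_superSq_contract_contract_ofBase]

theorem IsWeightedConnection.isFlat_iff (hN : IsWeightedConnection D G N) :
    IsFlat N ↔ ∀ u v, horizontalLift N (D.bracket u v) = ⁅horizontalLift N u, horizontalLift N v⁆ := by
  constructor
  · intro h u v
    refine Derivation.ext fun f => sub_eq_zero.1 (ofBase_injective (FE := FA) (E := G.τ *ᵖ A) ?_)
    rw [map_zero, ← Derivation.sub_apply, ← hN.contract_contract_sq, ← superSq_apply, h]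
    simp
  · intro h
    -- `∇²` is an even derivation, to be tested on two kinds of generators: `∇²f` is a two-form
    -- whose double contractions are the curvature, and on pulled-back covectors `∇²` is `d_A² = 0`.
    refine IsSkewDerivation.ext_pullback G (superSq_isSkewDerivation N) (isSkewDerivation_zero 1)
      (fun f => ?_) (fun θ => ?_)
    · have h2 := HasWeightOne.isForm hN.hasWeightOne (HasWeightOne.isForm hN.hasWeightOne
        (isForm_ofBase (FE := FA) (E := G.τ *ᵖ A) f))
      rw [superSq_apply, LinearMap.zero_apply]
      refine eq_zero_of_contract_pullSec G h2 fun u =>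
        eq_zero_of_contract_pullSec G (h2.contract _) fun v => ?_
      have h3 := hN.contract_contract_sq u v f
      have h4 : horizontalLift N (D.bracket u v) - ⁅horizontalLift N u, horizontalLift N v⁆ = 0 :=
        sub_eq_zero.2 (h u v)
      rw [h4] at h3
      exact neg_eq_zero.1 (h3.trans (ofBase EF FA (G.τ *ᵖ A)).toLinearMap.map_zero)
    · have h1 := (congrArg N.toLin (hN.projects (ofCovector EM FA A θ))).trans (hN.projects _)
      rw [D.d_d] at h1
      exact (superSq_apply _ _).trans (h1.trans (pull (G.pA FA A)).toLinearMap.map_zero)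

/-- The lifts determine the contractions of `∇f`, hence `∇f`; on pulled-back covectors there is no
freedom. Flatness plays no role. -/
theorem IsWeightedConnection.eq_of_horizontalLift_eq (hN : IsWeightedConnection D G N)
    (hN' : IsWeightedConnection D G N')
    (h : (horizontalLift N : Sec EM FA A → _) = horizontalLift N') : N = N' := by
  refine SuperVect.ext (IsSkewDerivation.ext_pullback G N.isSkewDerivation N'.isSkewDerivation
    (fun f => ?_) (fun θ => ?_))
  · refine eq_of_contract_pullSec G (HasWeightOne.isForm hN.hasWeightOne (isForm_ofBase f))
      (HasWeightOne.isForm hN'.hasWeightOne (isForm_ofBase f)) fun u => ?_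
    rw [contract_eq_ofBase_horizontalLift hN.hasWeightOne,
      contract_eq_ofBase_horizontalLift hN'.hasWeightOne, h]
  · rw [hN.projects, hN'.projects]

end Lift

/-! ### Polynomials in a coframe -/

section Poly

variable {EB : Type*} [NormedAddCommGroup EB] [NormedSpace ℝ EB]
  {B : Type*} [TopologicalSpace B] [ChartedSpace EB B]
  {FE : Type*} [NormedAddCommGroup FE] [NormedSpace ℝ FE]
  {E : B → Type*} [∀ b, AddCommMonoid (E b)] [∀ b, Module ℝ (E b)]
  [TopologicalSpace (Bundle.TotalSpace FE E)] [∀ b, TopologicalSpace (E b)]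
  [FiberBundle FE E] {n : ℕ}

/-- The fibrewise linear map `c ↦ ∑ cᵢ ξᵢ`. -/
def coframeLin (ξ : Fin n → Covector EB FE E) (b : B) : (Fin n → ℝ) →ₗ[ℝ] Module.Dual ℝ (E b) :=
  Fintype.linearCombination ℝ fun i => (ξ i).toFun b

/-- Evaluation on the dual frame is a left inverse of `coframeLin`, and `ExteriorAlgebra.map`
preserves left inverses. So linear independence in the fixed exterior algebra persists at the point
`b`. -/
theorem IsDualAt.map_coframeLin_injective {e : Fin n → Sec EB FE E} {ξ : Fin n → Covector EB FE E}
    {b : B} (h : IsDualAt e ξ b) :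
    Function.Injective (ExteriorAlgebra.map (coframeLin ξ b)) := by
  refine ExteriorAlgebra.map_injective ⟨LinearMap.pi fun j => Module.Dual.eval ℝ (E b) (e j b), ?_⟩
  refine LinearMap.ext fun c => funext fun j => ?_
  simp [coframeLin, Fintype.linearCombination_apply, h.dual]

/-- The homomorphism from a fixed exterior algebra to `C^∞(ΠE)` defined by the covectors `ξ i`. -/
def coframeHom (ξ : Fin n → Covector EB FE E) :
    ExteriorAlgebra ℝ (Fin n → ℝ) →ₐ[ℝ] SuperFun EB FE E :=
  ExteriorAlgebra.lift ℝ ⟨Fintype.linearCombination ℝ fun i => ofCovector EB FE E (ξ i), fun c => by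
    refine superFun_ext fun b => ?_
    have : (Fintype.linearCombination ℝ (fun i => ofCovector EB FE E (ξ i)) c).1 b =
        ExteriorAlgebra.ι ℝ (coframeLin ξ b c) := by
      rw [Fintype.linearCombination_apply, superFun_sum_apply, coframeLin,
        Fintype.linearCombination_apply, map_sum]
      exact Finset.sum_congr rfl fun i _ => ((ExteriorAlgebra.ι ℝ).map_smul (c i) _).symm
    exact (congrArg₂ (· * ·) this this).trans (ExteriorAlgebra.ι_sq_zero _)⟩

theorem coframeHom_ι (ξ : Fin n → Covector EB FE E) (c : Fin n → ℝ) :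
    coframeHom ξ (ExteriorAlgebra.ι ℝ c) = ∑ i, c i • ofCovector EB FE E (ξ i) := by
  rw [coframeHom, ExteriorAlgebra.lift_ι_apply, Fintype.linearCombination_apply]

theorem coframeHom_apply (ξ : Fin n → Covector EB FE E) (w : ExteriorAlgebra ℝ (Fin n → ℝ)) (b : B) :
    (coframeHom ξ w).1 b = ExteriorAlgebra.map (coframeLin ξ b) w := by
  have : ((Pi.evalAlgHom ℝ (fun b => ExteriorAlgebra ℝ (Module.Dual ℝ (E b))) b).comp
      (SuperFun EB FE E).val).comp (coframeHom ξ) = ExteriorAlgebra.map (coframeLin ξ b) := by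
    refine ExteriorAlgebra.hom_ext (LinearMap.ext fun c => ?_)
    change (coframeHom ξ (ExteriorAlgebra.ι ℝ c)).1 b = ExteriorAlgebra.map _ (ExteriorAlgebra.ι ℝ c)
    rw [coframeHom_ι, superFun_sum_apply, ExteriorAlgebra.map_apply_ι, coframeLin,
      Fintype.linearCombination_apply, map_sum]
    exact Finset.sum_congr rfl fun i _ => ((ExteriorAlgebra.ι ℝ).map_smul (c i) _).symm
  exact DFunLike.congr_fun this w

/-- The homomorphism `f ⊗ w ↦ f w(ξ)`. -/
def polyHom (ξ : Fin n → Covector EB FE E) :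
    C^∞⟮𝓘(ℝ, EB), B; ℝ⟯ ⊗[ℝ] ExteriorAlgebra ℝ (Fin n → ℝ) →ₐ[ℝ] SuperFun EB FE E :=
  Algebra.TensorProduct.lift (ofBase EB FE E) (coframeHom ξ) fun f _ => ofBase_mul_comm f _

theorem polyHom_tmul (ξ : Fin n → Covector EB FE E) (f : C^∞⟮𝓘(ℝ, EB), B; ℝ⟯)
    (w : ExteriorAlgebra ℝ (Fin n → ℝ)) :
    polyHom ξ (f ⊗ₜ w) = ofBase EB FE E f * coframeHom ξ w := rfl

theorem exists_polyHom_eq {e : Fin n → Sec EB FE E} {ξ : Fin n → Covector EB FE E} {b₀ : B}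
    (h : ∀ᶠ b in 𝓝 b₀, IsDualAt e ξ b) (η : SuperFun EB FE E) :
    ∃ r, ∀ᶠ b in 𝓝 b₀, η.1 b = (polyHom ξ r).1 b := by
  have key : ∀ g ∈ Algebra.adjoin ℝ (generators EB FE E),
      ∃ r, ∀ b, IsDualAt e ξ b → g b = (polyHom ξ r).1 b := by
    intro g hg
    induction hg using Algebra.adjoin_induction with
    | mem x hx =>
      rcases hx with ⟨f, rfl⟩ | ⟨θ, rfl⟩
      · refine ⟨f ⊗ₜ 1, fun b _ => ?_⟩
        rw [polyHom_tmul, map_one, mul_one]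
        rfl
      · refine ⟨∑ i, θ.eval (e i) ⊗ₜ ExteriorAlgebra.ι ℝ (Pi.single i 1), fun b hb => ?_⟩
        refine (hb.ofCovector_apply θ).trans ?_
        rw [map_sum]
        refine congrArg (fun ζ : SuperFun EB FE E => ζ.1 b) (Finset.sum_congr rfl fun i _ => ?_)
        rw [polyHom_tmul, coframeHom_ι]
        simp [Pi.single_apply]
    | algebraMap r => exact ⟨algebraMap ℝ _ r, fun b _ => by rw [AlgHom.commutes]; rfl⟩
    | add x y _ _ hx hy =>
      obtain ⟨r, hr⟩ := hx
      obtain ⟨s, hs⟩ := hy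
      refine ⟨r + s, fun b hb => ?_⟩
      rw [Pi.add_apply, hr b hb, hs b hb, map_add]
      rfl
    | mul x y _ _ hx hy =>
      obtain ⟨r, hr⟩ := hx
      obtain ⟨s, hs⟩ := hy
      refine ⟨r * s, fun b hb => ?_⟩
      rw [Pi.mul_apply, hr b hb, hs b hb, map_mul]
      rfl
  obtain ⟨g, hg, hηg⟩ := η.2 b₀
  obtain ⟨r, hr⟩ := key g hg
  refine ⟨r, ?_⟩
  filter_upwards [hηg, h] with b h1 h2
  rw [h1, hr b h2]

/-- The coefficients of a polynomial that vanishes locally vanish locally. -/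
theorem eventually_coeff_eq_zero {e : Fin n → Sec EB FE E} {ξ : Fin n → Covector EB FE E} {b₀ : B}
    (h : ∀ᶠ b in 𝓝 b₀, IsDualAt e ξ b) {κ : Type*}
    (c : Module.Basis κ ℝ (ExteriorAlgebra ℝ (Fin n → ℝ)))
    (f : κ →₀ C^∞⟮𝓘(ℝ, EB), B; ℝ⟯)
    (h0 : ∀ᶠ b in 𝓝 b₀, (polyHom ξ (f.sum fun k g => g ⊗ₜ c k)).1 b = 0) (k : κ) :
    ∀ᶠ b in 𝓝 b₀, f k b = 0 := by
  filter_upwards [h, h0] with b hb hb0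
  -- The value of the polynomial at `b` is the image of a real linear combination of basis elements
  -- under an injective map.
  have h1 : ExteriorAlgebra.map (coframeLin ξ b) (∑ k ∈ f.support, f k b • c k) = 0 := by
    rw [← hb0, Finsupp.sum, map_sum, map_sum, superFun_sum_apply]
    refine Finset.sum_congr rfl fun k _ => ?_
    rw [polyHom_tmul, ofBase_mul_apply, coframeHom_apply, map_smul]
  have h2 := hb.map_coframeLin_injective (h1.trans (map_zero _).symm)
  by_cases hk : k ∈ f.support
  · exact (linearIndependent_iff'.1 c.linearIndependent) f.support (fun k => f k b) h2 k hk
  · rw [Finsupp.notMem_support_iff.1 hk]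
    rfl

end Poly

/-! ### Extension of derivations along a morphism of vector bundles -/

section Extension

variable {EB : Type*} [NormedAddCommGroup EB] [NormedSpace ℝ EB]
  {B : Type*} [TopologicalSpace B] [ChartedSpace EB B]
  {FE : Type*} [NormedAddCommGroup FE] [NormedSpace ℝ FE]
  {E : B → Type*} [∀ b, AddCommMonoid (E b)] [∀ b, Module ℝ (E b)]
  [TopologicalSpace (Bundle.TotalSpace FE E)] [∀ b, TopologicalSpace (E b)]
  [FiberBundle FE E]
  {EB' : Type*} [NormedAddCommGroup EB'] [NormedSpace ℝ EB']
  {B' : Type*} [TopologicalSpace B'] [ChartedSpace EB' B']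
  {FE' : Type*} [NormedAddCommGroup FE'] [NormedSpace ℝ FE']
  {E' : B' → Type*} [∀ b, AddCommMonoid (E' b)] [∀ b, Module ℝ (E' b)]
  [TopologicalSpace (Bundle.TotalSpace FE' E')] [∀ b, TopologicalSpace (E' b)]
  [FiberBundle FE' E']

/-- The composition of smooth functions with a smooth map, as a homomorphism of algebras. -/
def compAlgHom (φ : C^∞⟮𝓘(ℝ, EB), B; 𝓘(ℝ, EB'), B'⟯) :
    C^∞⟮𝓘(ℝ, EB'), B'; ℝ⟯ →ₐ[ℝ] C^∞⟮𝓘(ℝ, EB), B; ℝ⟯ where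
  toFun f := f.comp φ
  map_one' := rfl
  map_mul' _ _ := rfl
  map_zero' := rfl
  map_add' _ _ := rfl
  commutes' _ := rfl

/-- The homomorphism `f ⊗ η ↦ f Φ*η`. -/
def mulPull (Φ : BundleMap EB B FE E EB' B' FE' E') :
    C^∞⟮𝓘(ℝ, EB), B; ℝ⟯ ⊗[ℝ] SuperFun EB' FE' E' →ₐ[ℝ] SuperFun EB FE E :=
  Algebra.TensorProduct.lift (ofBase EB FE E) (pull Φ) fun f _ => ofBase_mul_comm f _

theorem mulPull_tmul (Φ : BundleMap EB B FE E EB' B' FE' E') (f : C^∞⟮𝓘(ℝ, EB), B; ℝ⟯)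
    (η : SuperFun EB' FE' E') : mulPull Φ (f ⊗ₜ η) = ofBase EB FE E f * pull Φ η := rfl

theorem pull_coframeHom (Φ : BundleMap EB B FE E EB' B' FE' E') {n : ℕ}
    (ξ : Fin n → Covector EB' FE' E') (w : ExteriorAlgebra ℝ (Fin n → ℝ)) :
    pull Φ (coframeHom ξ w) = coframeHom (fun i => pullCovector Φ (ξ i)) w := by
  have : (pull Φ).comp (coframeHom ξ) = coframeHom (fun i => pullCovector Φ (ξ i)) := by
    refine ExteriorAlgebra.hom_ext (LinearMap.ext fun c => ?_)
    change pull Φ (coframeHom ξ (ExteriorAlgebra.ι ℝ c)) = coframeHom _ (ExteriorAlgebra.ι ℝ c)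
    simp only [coframeHom_ι, map_sum, map_smul, pull_ofCovector]
  exact DFunLike.congr_fun this w

/-- The homomorphism `f ⊗ w ↦ f ⊗ w(ξ)`. -/
def tensorCoframe (B : Type*) [TopologicalSpace B] [ChartedSpace EB B] {n : ℕ}
    (ξ : Fin n → Covector EB' FE' E') :
    C^∞⟮𝓘(ℝ, EB), B; ℝ⟯ ⊗[ℝ] ExteriorAlgebra ℝ (Fin n → ℝ) →ₐ[ℝ]
      C^∞⟮𝓘(ℝ, EB), B; ℝ⟯ ⊗[ℝ] SuperFun EB' FE' E' :=
  Algebra.TensorProduct.map (AlgHom.id ℝ _) (coframeHom ξ)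

theorem mulPull_tensorCoframe (Φ : BundleMap EB B FE E EB' B' FE' E') {n : ℕ}
    (ξ : Fin n → Covector EB' FE' E')
    (r : C^∞⟮𝓘(ℝ, EB), B; ℝ⟯ ⊗[ℝ] ExteriorAlgebra ℝ (Fin n → ℝ)) :
    mulPull Φ (tensorCoframe B ξ r) = polyHom (fun i => pullCovector Φ (ξ i)) r := by
  have : (mulPull Φ).comp (tensorCoframe B ξ) = polyHom (fun i => pullCovector Φ (ξ i)) := by
    refine Algebra.TensorProduct.ext' fun f w => ?_
    change ofBase EB FE E f * pull Φ (coframeHom ξ w) = _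
    rw [pull_coframeHom]
    rfl
  exact DFunLike.congr_fun this r

variable [VectorBundle ℝ FE E] [VectorBundle ℝ FE' E']

/-- In the application `x = X f`, `y = X g`, `p = Φ*η`, `q = Φ*ζ`, `p' = l_{-1}* p`, `dp = Φ*(dη)`
and `dq = Φ*(dζ)`. The hypotheses say that the one-form `y` passes `p` with a sign and that the
function `g` is central. -/
theorem leibniz_aux {R : Type*} [Ring R] {p p' f g y : R} (h : y * p = p' * y)
    (hg : ∀ x, g * x = x * g) (x q dp dq : R) :
    (x * g + f * y) * (p * q) + f * g * (dp * q + p' * dq) =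
      (x * p + f * dp) * (g * q) + f * p' * (y * q + g * dq) := by
  have h1 : x * g * (p * q) = x * p * (g * q) := by
    rw [mul_assoc, ← mul_assoc g, hg p, mul_assoc, mul_assoc]
  have h2 : f * y * (p * q) = f * p' * (y * q) := by
    rw [mul_assoc, ← mul_assoc y, h, mul_assoc, mul_assoc]
  have h3 : f * g * (dp * q) = f * dp * (g * q) := by
    rw [mul_assoc, ← mul_assoc g, hg dp, mul_assoc, mul_assoc]
  have h4 : f * g * (p' * dq) = f * p' * (g * dq) := by
    rw [mul_assoc, ← mul_assoc g, hg p', mul_assoc, mul_assoc]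
  rw [add_mul, add_mul, mul_add, mul_add, h1, h2, h3, h4]
  abel

/-- A derivation of functions on the base with values in forms of degree one that is compatible
with the vector field `d` along `Φ`. -/
structure BaseDerivation (Φ : BundleMap EB B FE E EB' B' FE' E') (d : SuperVect EB' FE' E' 1) where
  toLin : C^∞⟮𝓘(ℝ, EB), B; ℝ⟯ →ₗ[ℝ] SuperFun EB FE E
  isForm : ∀ f, IsForm 1 (toLin f)
  leibniz : ∀ f g, toLin (f * g) = toLin f * ofBase EB FE E g + ofBase EB FE E f * toLin g
  comp : ∀ g : C^∞⟮𝓘(ℝ, EB'), B'; ℝ⟯, toLin (g.comp Φ.base) = pull Φ (d.toLin (ofBase EB' FE' E' g))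

variable {Φ : BundleMap EB B FE E EB' B' FE' E'} {d : SuperVect EB' FE' E' 1}
  (X : BaseDerivation Φ d)

namespace BaseDerivation

omit [VectorBundle ℝ FE E] [VectorBundle ℝ FE' E'] in
theorem map_one : X.toLin 1 = 0 := by
  have h := X.leibniz 1 1
  rw [one_mul (1 : C^∞⟮𝓘(ℝ, EB), B; ℝ⟯), _root_.map_one (ofBase EB FE E), mul_one (X.toLin 1),
    one_mul (X.toLin 1)] at h
  exact left_eq_add.1 h

/-- The linear map `f ⊗ η ↦ X f Φ*η + f Φ*(d η)`. -/
def extend : C^∞⟮𝓘(ℝ, EB), B; ℝ⟯ ⊗[ℝ] SuperFun EB' FE' E' →ₗ[ℝ] SuperFun EB FE E :=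
  TensorProduct.lift ((LinearMap.mul ℝ (SuperFun EB FE E)).compl₁₂ X.toLin (pull Φ).toLinearMap +
    (LinearMap.mul ℝ (SuperFun EB FE E)).compl₁₂ (ofBase EB FE E).toLinearMap
      ((pull Φ).toLinearMap ∘ₗ d.toLin))

omit [VectorBundle ℝ FE E] [VectorBundle ℝ FE' E'] in
theorem extend_tmul (f : C^∞⟮𝓘(ℝ, EB), B; ℝ⟯) (η : SuperFun EB' FE' E') :
    X.extend (f ⊗ₜ η) = X.toLin f * pull Φ η + ofBase EB FE E f * pull Φ (d.toLin η) := rfl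

/-- The Leibniz rule holds already on the tensor product, before it is known that `extend` descends
along `mulPull`. -/
theorem extend_mul (r s : C^∞⟮𝓘(ℝ, EB), B; ℝ⟯ ⊗[ℝ] SuperFun EB' FE' E') :
    X.extend (r * s) = X.extend r * mulPull Φ s +
      pull (scale EB FE E (-1)) (mulPull Φ r) * X.extend s := by
  induction r with
  | zero => simp
  | add r r' hr hr' => simp only [add_mul, map_add, hr, hr']; abel
  | tmul f η =>
    induction s with
    | zero => simp
    | add s s' hs hs' => simp only [mul_add, map_add, hs, hs']; abel
    | tmul g ζ =>
      have hd : d.toLin (η * ζ) = d.toLin η * ζ + pull (scale EB' FE' E' (-1)) η * d.toLin ζ :=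
        d.isSkewDerivation_of_sgn_eq sgn_one η ζ
      have h1 := (X.isForm g).mul_comm (pull Φ η)
      rw [pull_pull_scale] at h1
      have e1 : X.extend ((f ⊗ₜ η) * (g ⊗ₜ ζ)) = X.extend ((f * g) ⊗ₜ (η * ζ)) :=
        congrArg X.extend (Algebra.TensorProduct.tmul_mul_tmul f g η ζ)
      have e2 : pull (scale EB FE E (-1)) (mulPull Φ (f ⊗ₜ η)) =
          ofBase EB FE E f * pull Φ (pull (scale EB' FE' E' (-1)) η) := by
        rw [mulPull_tmul, _root_.map_mul (pull (scale EB FE E (-1))) (ofBase EB FE E f),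
          pull_scale_ofBase, pull_pull_scale]
      rw [e1, e2, extend_tmul, extend_tmul, extend_tmul, mulPull_tmul, hd, X.leibniz,
        _root_.map_mul (ofBase EB FE E) f g, _root_.map_mul (pull Φ) η ζ,
        _root_.map_add (pull Φ) (d.toLin η * ζ),
        _root_.map_mul (pull Φ) (d.toLin η) ζ, _root_.map_mul (pull Φ) _ (d.toLin ζ)]
      exact leibniz_aux h1 (fun x => ofBase_mul_comm g x) _ _ _ _

variable [FiniteDimensional ℝ EB] [IsManifold 𝓘(ℝ, EB) ∞ B] [T2Space B]
  [FiniteDimensional ℝ EB'] [IsManifold 𝓘(ℝ, EB') ∞ B'] [T2Space B']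

omit [VectorBundle ℝ FE' E'] [FiniteDimensional ℝ EB'] [IsManifold 𝓘(ℝ, EB') ∞ B'] [T2Space B'] in
theorem apply_eq_zero {f : C^∞⟮𝓘(ℝ, EB), B; ℝ⟯} {b₀ : B} (h : ∀ᶠ b in 𝓝 b₀, f b = 0) :
    (X.toLin f).1 b₀ = 0 := by
  obtain ⟨χ, h1, h0⟩ := exists_bump (EB := EB) h
  have hz : χ * f = 0 := by
    ext b
    change χ b * f b = 0
    by_cases hb : b ∈ tsupport χ
    · rw [h0 b hb, mul_zero]
    · rw [image_eq_zero_of_notMem_tsupport hb, zero_mul]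
  have h2 := X.leibniz χ f
  rw [hz, map_zero, ← ofBase_mul_comm] at h2
  have h3 : 0 = (ofBase EB FE E f * X.toLin χ).1 b₀ + (ofBase EB FE E χ * X.toLin f).1 b₀ :=
    congrFun (congrArg Subtype.val h2) b₀
  rw [ofBase_mul_apply, ofBase_mul_apply, h.self_of_nhds, h1.self_of_nhds, zero_smul, zero_add,
    one_smul] at h3
  exact h3.symm

omit [FiniteDimensional ℝ EB] [IsManifold 𝓘(ℝ, EB) ∞ B] [T2Space B] in
theorem extend_tmul_congr {η ζ : SuperFun EB' FE' E'} {b₀ : B}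
    (h : ∀ᶠ b in 𝓝 (Φ.base b₀), η.1 b = ζ.1 b) (f : C^∞⟮𝓘(ℝ, EB), B; ℝ⟯) :
    (X.extend (f ⊗ₜ η)).1 b₀ = (X.extend (f ⊗ₜ ζ)).1 b₀ := by
  rw [extend_tmul, extend_tmul]
  have h1 : (pull Φ η).1 b₀ = (pull Φ ζ).1 b₀ := by
    rw [pull_apply, pull_apply, h.self_of_nhds]
  have h2 : (pull Φ (d.toLin η)).1 b₀ = (pull Φ (d.toLin ζ)).1 b₀ := by
    rw [pull_apply, pull_apply, d.apply_congr h]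
  change (X.toLin f).1 b₀ * (pull Φ η).1 b₀ + (ofBase EB FE E f).1 b₀ * (pull Φ (d.toLin η)).1 b₀ =
    (X.toLin f).1 b₀ * (pull Φ ζ).1 b₀ + (ofBase EB FE E f).1 b₀ * (pull Φ (d.toLin ζ)).1 b₀
  rw [h1, h2]

variable (Φ) in
/-- The covectors `ξ i` form a coframe near `b₀`, both on `E'` and pulled back to `E`. -/
structure IsCoframeAt {n : ℕ} (ξ : Fin n → Covector EB' FE' E') (b₀ : B) : Prop where
  target : ∃ e, ∀ᶠ b in 𝓝 (Φ.base b₀), IsDualAt e ξ b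
  source : ∃ e, ∀ᶠ b in 𝓝 b₀, IsDualAt e (fun i => pullCovector Φ (ξ i)) b

omit [VectorBundle ℝ FE E] [VectorBundle ℝ FE' E'] [FiniteDimensional ℝ EB]
  [IsManifold 𝓘(ℝ, EB) ∞ B] [T2Space B] [FiniteDimensional ℝ EB'] [IsManifold 𝓘(ℝ, EB') ∞ B']
  [T2Space B'] in
theorem mulPull_tensorCoframe_mulLeft {n : ℕ} {ξ : Fin n → Covector EB' FE' E'}
    (f : C^∞⟮𝓘(ℝ, EB), B; ℝ⟯) (s : C^∞⟮𝓘(ℝ, EB'), B'; ℝ⟯ ⊗[ℝ] ExteriorAlgebra ℝ (Fin n → ℝ)) :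
    mulPull Φ (tensorCoframe B ξ (TensorProduct.map
      ((LinearMap.mulLeft ℝ f) ∘ₗ (compAlgHom Φ.base).toLinearMap) LinearMap.id s)) =
      ofBase EB FE E f * pull Φ (polyHom ξ s) := by
  have : (mulPull Φ).toLinearMap ∘ₗ (tensorCoframe B ξ).toLinearMap ∘ₗ TensorProduct.map
      ((LinearMap.mulLeft ℝ f) ∘ₗ (compAlgHom Φ.base).toLinearMap) LinearMap.id =
      (LinearMap.mulLeft ℝ (ofBase EB FE E f)) ∘ₗ (pull Φ).toLinearMap ∘ₗ
        (polyHom ξ).toLinearMap := by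
    refine TensorProduct.ext' fun g w => ?_
    change ofBase EB FE E (f * g.comp Φ.base) * pull Φ (coframeHom ξ w) =
      ofBase EB FE E f * pull Φ (polyHom ξ (g ⊗ₜ w))
    rw [polyHom_tmul, _root_.map_mul (pull Φ) (ofBase EB' FE' E' g), pull_ofBase,
      _root_.map_mul (ofBase EB FE E) f, mul_assoc (ofBase EB FE E f)]
  exact LinearMap.congr_fun this s

omit [FiniteDimensional ℝ EB] [IsManifold 𝓘(ℝ, EB) ∞ B] [T2Space B] [FiniteDimensional ℝ EB']
  [IsManifold 𝓘(ℝ, EB') ∞ B'] [T2Space B'] in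
-- A function `g` on `B'` may be moved across the tensor sign: `f ⊗ g w(ξ)` and `f (g ∘ Φ) ⊗ w(ξ)`
-- have the same extension. This is where the compatibility `X (g ∘ Φ) = Φ*(d g)` enters.
theorem extend_tensorCoframe_mulLeft {n : ℕ} {ξ : Fin n → Covector EB' FE' E'}
    (f : C^∞⟮𝓘(ℝ, EB), B; ℝ⟯) (s : C^∞⟮𝓘(ℝ, EB'), B'; ℝ⟯ ⊗[ℝ] ExteriorAlgebra ℝ (Fin n → ℝ)) :
    X.extend (tensorCoframe B ξ (TensorProduct.map
      ((LinearMap.mulLeft ℝ f) ∘ₗ (compAlgHom Φ.base).toLinearMap) LinearMap.id s)) =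
      X.extend (f ⊗ₜ polyHom ξ s) := by
  have : X.extend ∘ₗ (tensorCoframe B ξ).toLinearMap ∘ₗ TensorProduct.map
      ((LinearMap.mulLeft ℝ f) ∘ₗ (compAlgHom Φ.base).toLinearMap) LinearMap.id =
      X.extend ∘ₗ TensorProduct.mk ℝ _ _ f ∘ₗ (polyHom ξ).toLinearMap := by
    refine TensorProduct.ext' fun g w => ?_
    have hd : d.toLin (ofBase EB' FE' E' g * coframeHom ξ w) =
        d.toLin (ofBase EB' FE' E' g) * coframeHom ξ w +
          pull (scale EB' FE' E' (-1)) (ofBase EB' FE' E' g) * d.toLin (coframeHom ξ w) :=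
      d.isSkewDerivation_of_sgn_eq sgn_one _ _
    change X.extend ((f * g.comp Φ.base) ⊗ₜ coframeHom ξ w) = X.extend (f ⊗ₜ polyHom ξ (g ⊗ₜ w))
    rw [extend_tmul, extend_tmul, polyHom_tmul, hd, X.leibniz, X.comp, pull_scale_ofBase,
      _root_.map_mul (ofBase EB FE E) f, _root_.map_add (pull Φ) (d.toLin (ofBase EB' FE' E' g) * _),
      _root_.map_mul (pull Φ) (ofBase EB' FE' E' g) (coframeHom ξ w),
      _root_.map_mul (pull Φ) _ (coframeHom ξ w),
      _root_.map_mul (pull Φ) _ (d.toLin (coframeHom ξ w)), pull_ofBase]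
    generalize pull Φ (d.toLin (ofBase EB' FE' E' g)) = y
    generalize pull Φ (d.toLin (coframeHom ξ w)) = z
    generalize pull Φ (coframeHom ξ w) = k
    generalize ofBase EB FE E (g.comp Φ.base) = c
    rw [add_mul, mul_add, mul_assoc, mul_assoc, mul_assoc, add_assoc]
  exact LinearMap.congr_fun this s

/-- Normal form near `b₀`: all coefficient functions are moved to `B`, leaving in the second factor
polynomials in `ξ` with constant coefficients. Neither the local product nor the value of `extend`
at `b₀` changes. -/
theorem exists_tensorCoframe {n : ℕ} {ξ : Fin n → Covector EB' FE' E'} {b₀ : B}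
    (hξ : IsCoframeAt Φ ξ b₀) (r : C^∞⟮𝓘(ℝ, EB), B; ℝ⟯ ⊗[ℝ] SuperFun EB' FE' E') :
    ∃ s, (∀ᶠ b in 𝓝 b₀, (mulPull Φ r).1 b = (mulPull Φ (tensorCoframe B ξ s)).1 b) ∧
      (X.extend r).1 b₀ = (X.extend (tensorCoframe B ξ s)).1 b₀ := by
  induction r with
  | zero => exact ⟨0, by simp⟩
  | add r r' hr hr' =>
    obtain ⟨s, hs, hs2⟩ := hr
    obtain ⟨s', hs', hs2'⟩ := hr'
    refine ⟨s + s', ?_, ?_⟩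
    · filter_upwards [hs, hs'] with b h1 h2
      rw [map_add, map_add, map_add]
      exact congrArg₂ (· + ·) h1 h2
    · rw [map_add, map_add, map_add]
      exact congrArg₂ (· + ·) hs2 hs2'
  | tmul f η =>
    obtain ⟨e, he⟩ := hξ.target
    obtain ⟨s, hs⟩ := exists_polyHom_eq he η
    let T := TensorProduct.map ((LinearMap.mulLeft ℝ f) ∘ₗ (compAlgHom Φ.base).toLinearMap)
      (LinearMap.id : ExteriorAlgebra ℝ (Fin n → ℝ) →ₗ[ℝ] _)
    have hT1 : mulPull Φ (tensorCoframe B ξ (T s)) = ofBase EB FE E f * pull Φ (polyHom ξ s) :=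
      mulPull_tensorCoframe_mulLeft f s
    have hT2 : X.extend (tensorCoframe B ξ (T s)) = X.extend (f ⊗ₜ polyHom ξ s) :=
      X.extend_tensorCoframe_mulLeft f s
    refine ⟨T s, ?_, ?_⟩
    · filter_upwards [Φ.base.contMDiff.continuous.continuousAt.eventually hs] with b hb
      rw [hT1, mulPull_tmul, ofBase_mul_apply, ofBase_mul_apply, pull_apply, pull_apply, hb]
    · rw [hT2]
      exact X.extend_tmul_congr hs f

omit [FiniteDimensional ℝ EB'] [IsManifold 𝓘(ℝ, EB') ∞ B'] [T2Space B'] in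
theorem extend_tensorCoframe_sum_eq_zero {n : ℕ} {ξ : Fin n → Covector EB' FE' E'} {b₀ : B}
    {κ : Type*} (c : κ → ExteriorAlgebra ℝ (Fin n → ℝ)) (f : κ →₀ C^∞⟮𝓘(ℝ, EB), B; ℝ⟯)
    (h0 : ∀ k, ∀ᶠ b in 𝓝 b₀, f k b = 0) :
    (X.extend (tensorCoframe B ξ (f.sum fun k g => g ⊗ₜ c k))).1 b₀ = 0 := by
  have h3 : X.extend (tensorCoframe B ξ (f.sum fun k g => g ⊗ₜ c k)) =
      ∑ k ∈ f.support, X.extend (f k ⊗ₜ coframeHom ξ (c k)) :=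
    map_sum (X.extend ∘ₗ (tensorCoframe B ξ).toLinearMap) _ f.support
  refine (congrArg (fun ζ : SuperFun EB FE E => ζ.1 b₀) h3).trans
    ((superFun_sum_apply _ _ _).trans (Finset.sum_eq_zero fun k _ => ?_))
  rw [extend_tmul]
  change (X.toLin (f k)).1 b₀ * (pull Φ (coframeHom ξ (c k))).1 b₀ +
    (ofBase EB FE E (f k) * pull Φ (d.toLin (coframeHom ξ (c k)))).1 b₀ = 0
  rw [X.apply_eq_zero (h0 k), ofBase_mul_apply, (h0 k).self_of_nhds, zero_mul, zero_smul, add_zero]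

/-- Well-definedness of the extension. A tensor in normal form is `∑ f_k ⊗ c_k(ξ)` with `c_k` a
basis of the fixed exterior algebra. If its product vanishes near `b₀`, so do all `f_k`, and
locality of `X` finishes. -/
theorem extend_eq_zero {n : ℕ} {ξ : Fin n → Covector EB' FE' E'} {b₀ : B}
    (hξ : IsCoframeAt Φ ξ b₀) {r : C^∞⟮𝓘(ℝ, EB), B; ℝ⟯ ⊗[ℝ] SuperFun EB' FE' E'}
    (hr : ∀ᶠ b in 𝓝 b₀, (mulPull Φ r).1 b = 0) : (X.extend r).1 b₀ = 0 := by
  obtain ⟨s, h1, h2⟩ := X.exists_tensorCoframe hξ r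
  obtain ⟨e, he⟩ := hξ.source
  let c := Module.Basis.ofVectorSpace ℝ (ExteriorAlgebra ℝ (Fin n → ℝ))
  obtain ⟨f, rfl⟩ := TensorProduct.eq_repr_basis_right c s
  refine h2.trans (X.extend_tensorCoframe_sum_eq_zero c f (eventually_coeff_eq_zero he c f ?_))
  filter_upwards [hr, h1] with b hb hb1
  exact (congrArg (fun ζ : SuperFun EB FE E => ζ.1 b) (mulPull_tensorCoframe Φ ξ _)).symm.trans
    (hb1.symm.trans hb)

variable (Φ) in
/-- There are local coframes on `E'` that pull back to local coframes on `E`. -/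
def HasCoframes : Prop := ∀ b : B, ∃ (n : ℕ) (ξ : Fin n → Covector EB' FE' E'), IsCoframeAt Φ ξ b

omit [VectorBundle ℝ FE E] [VectorBundle ℝ FE' E'] [FiniteDimensional ℝ EB]
  [IsManifold 𝓘(ℝ, EB) ∞ B] [T2Space B] [FiniteDimensional ℝ EB']
  [IsManifold 𝓘(ℝ, EB') ∞ B'] [T2Space B'] in
theorem HasCoframes.exists_mulPull_eq (hΦ : HasCoframes Φ) (η : SuperFun EB FE E) (b₀ : B) :
    ∃ r, ∀ᶠ b in 𝓝 b₀, η.1 b = (mulPull Φ r).1 b := by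
  obtain ⟨n, ξ, hξ⟩ := hΦ b₀
  obtain ⟨e, he⟩ := hξ.source
  obtain ⟨s, hs⟩ := exists_polyHom_eq he η
  exact ⟨tensorCoframe B ξ s, by simpa only [mulPull_tensorCoframe] using hs⟩

theorem extend_congr (hΦ : HasCoframes Φ) {b₀ : B}
    {r s : C^∞⟮𝓘(ℝ, EB), B; ℝ⟯ ⊗[ℝ] SuperFun EB' FE' E'}
    (h : ∀ᶠ b in 𝓝 b₀, (mulPull Φ r).1 b = (mulPull Φ s).1 b) :
    (X.extend r).1 b₀ = (X.extend s).1 b₀ := by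
  obtain ⟨n, ξ, hξ⟩ := hΦ b₀
  have := X.extend_eq_zero hξ (r := r - s) (by
    filter_upwards [h] with b hb
    rw [map_sub]
    exact sub_eq_zero.2 hb)
  rw [map_sub] at this
  exact sub_eq_zero.1 this

/-- The extension of a derivation of functions to a vector field on `ΠE`, as a linear map. -/
theorem exists_linearMap (hΦ : HasCoframes Φ) :
    ∃ L : SuperFun EB FE E →ₗ[ℝ] SuperFun EB FE E, ∀ (η : SuperFun EB FE E) (b : B)
      (r : C^∞⟮𝓘(ℝ, EB), B; ℝ⟯ ⊗[ℝ] SuperFun EB' FE' E'),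
      (∀ᶠ b' in 𝓝 b, η.1 b' = (mulPull Φ r).1 b') → (L η).1 b = (X.extend r).1 b := by
  -- A tensor that represents `η` near `b`; by `key` the value of its extension at `b` does not
  -- depend on the choice.
  choose R hR using fun (η : SuperFun EB FE E) (b : B) => hΦ.exists_mulPull_eq η b
  have key (η : SuperFun EB FE E) (b : B) (r : C^∞⟮𝓘(ℝ, EB), B; ℝ⟯ ⊗[ℝ] SuperFun EB' FE' E')
      (h : ∀ᶠ b' in 𝓝 b, η.1 b' = (mulPull Φ r).1 b') :
      (X.extend (R η b)).1 b = (X.extend r).1 b :=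
    X.extend_congr hΦ (by filter_upwards [hR η b, h] with b' h1 h2; rw [← h1, h2])
  have mem (η : SuperFun EB FE E) : (fun b => (X.extend (R η b)).1 b) ∈ SuperFun EB FE E := by
    intro b₀
    -- The tensor chosen at `b₀` also represents `η` near every point close to `b₀`, so the new
    -- function coincides locally with one smooth extension.
    obtain ⟨g, hg, h⟩ := (X.extend (R η b₀)).2 b₀
    refine ⟨g, hg, ?_⟩
    filter_upwards [h, (hR η b₀).eventually_nhds] with b hb hb2
    rw [key η b _ hb2, hb]
  refine ⟨{ toFun η := ⟨_, mem η⟩, map_add' η ζ := superFun_ext fun b => ?_,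
            map_smul' c η := superFun_ext fun b => ?_ }, key⟩
  · refine (key _ b (R η b + R ζ b) ?_).trans ?_
    · filter_upwards [hR η b, hR ζ b] with b' h1 h2
      rw [map_add]
      exact congrArg₂ (· + ·) h1 h2
    · rw [map_add]
      rfl
  · refine (key _ b (c • R η b) ?_).trans ?_
    · filter_upwards [hR η b] with b' h1
      rw [map_smul]
      exact congrArg (c • ·) h1
    · rw [map_smul]
      rfl

/-- The linear map `L` extends the derivation `X`. -/
def IsExtension (L : SuperFun EB FE E →ₗ[ℝ] SuperFun EB FE E) : Prop :=
  ∀ (η : SuperFun EB FE E) (b : B) (r : C^∞⟮𝓘(ℝ, EB), B; ℝ⟯ ⊗[ℝ] SuperFun EB' FE' E'),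
    (∀ᶠ b' in 𝓝 b, η.1 b' = (mulPull Φ r).1 b') → (L η).1 b = (X.extend r).1 b

variable {X} {L : SuperFun EB FE E →ₗ[ℝ] SuperFun EB FE E}

namespace IsExtension

omit [VectorBundle ℝ FE E] [VectorBundle ℝ FE' E'] [FiniteDimensional ℝ EB]
  [IsManifold 𝓘(ℝ, EB) ∞ B] [T2Space B] [FiniteDimensional ℝ EB'] [IsManifold 𝓘(ℝ, EB') ∞ B']
  [T2Space B'] in
theorem apply_mulPull (hL : X.IsExtension L) (r) : L (mulPull Φ r) = X.extend r :=
  superFun_ext fun b => hL _ b r (Filter.Eventually.of_forall fun _ => rfl)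

omit [FiniteDimensional ℝ EB] [IsManifold 𝓘(ℝ, EB) ∞ B] [T2Space B] [FiniteDimensional ℝ EB']
  [IsManifold 𝓘(ℝ, EB') ∞ B'] [T2Space B'] in
theorem isSkewDerivation (hL : X.IsExtension L) (hΦ : HasCoframes Φ) : IsSkewDerivation (-1) L := by
  intro η ζ
  refine superFun_ext fun b => ?_
  obtain ⟨r, hr⟩ := hΦ.exists_mulPull_eq η b
  obtain ⟨s, hs⟩ := hΦ.exists_mulPull_eq ζ b
  rw [hL (η * ζ) b (r * s) (by
    filter_upwards [hr, hs] with b' h1 h2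
    rw [_root_.map_mul (mulPull Φ) r s]
    exact congrArg₂ (· * ·) h1 h2), extend_mul]
  change (X.extend r).1 b * (mulPull Φ s).1 b +
    (pull (scale EB FE E (-1)) (mulPull Φ r)).1 b * (X.extend s).1 b =
    (L η).1 b * ζ.1 b + (pull (scale EB FE E (-1)) η).1 b * (L ζ).1 b
  rw [hL η b r hr, hL ζ b s hs, pull_scale_apply, pull_scale_apply, ← hr.self_of_nhds,
    ← hs.self_of_nhds]

/-- A pullback that transforms the values of `X.extend` by a scalar transforms `L` by it. -/
theorem pull_apply (hL : X.IsExtension L) (hΦ : HasCoframes Φ) (Ψ : BundleMap EB B FE E EB B FE E)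
    (c : ℝ) (h : ∀ f η, pull Ψ (X.extend (f ⊗ₜ η)) = c • L (pull Ψ (mulPull Φ (f ⊗ₜ η))))
    (η : SuperFun EB FE E) : pull Ψ (L η) = c • L (pull Ψ η) := by
  have h' (r) : pull Ψ (X.extend r) = c • L (pull Ψ (mulPull Φ r)) := by
    have : (pull Ψ).toLinearMap ∘ₗ X.extend =
        c • (L ∘ₗ (pull Ψ).toLinearMap ∘ₗ (mulPull Φ).toLinearMap) :=
      TensorProduct.ext' h
    exact LinearMap.congr_fun this r
  refine superFun_ext fun b => ?_
  obtain ⟨r, hr⟩ := hΦ.exists_mulPull_eq η (Ψ.base b)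
  have h1 : (L (pull Ψ η)).1 b = (L (pull Ψ (mulPull Φ r))).1 b :=
    (hL.isSkewDerivation hΦ).apply_congr (by
      filter_upwards [Ψ.base.contMDiff.continuous.continuousAt.eventually hr] with b' hb'
      rw [WeightedConn.pull_apply, WeightedConn.pull_apply, hb'])
  change (pull Ψ (L η)).1 b = c • (L (pull Ψ η)).1 b
  rw [WeightedConn.pull_apply, hL η _ r hr, ← WeightedConn.pull_apply, h', h1]
  rfl

theorem pull_scale (hL : X.IsExtension L) (hΦ : HasCoframes Φ) (hd : HasWeightOne d) (t : ℝ)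
    (η : SuperFun EB FE E) : pull (scale EB FE E t) (L η) = t • L (pull (scale EB FE E t) η) := by
  refine hL.pull_apply hΦ _ t (fun f η => ?_) η
  have h1 : pull (scale EB FE E t) (mulPull Φ (f ⊗ₜ η)) =
      mulPull Φ (f ⊗ₜ pull (scale EB' FE' E' t) η) := by
    rw [mulPull_tmul, mulPull_tmul, _root_.map_mul (pull (scale EB FE E t)) (ofBase EB FE E f),
      pull_scale_ofBase, pull_pull_scale]
  have h2 : pull (scale EB FE E t) (X.toLin f) = t • X.toLin f := by
    rw [(X.isForm f).pull_scale, pow_one]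
  have h3 (ζ) : pull Φ (t • d.toLin ζ) = t • pull Φ (d.toLin ζ) :=
    (pull Φ).toLinearMap.map_smul t (d.toLin ζ)
  rw [h1, hL.apply_mulPull, extend_tmul, extend_tmul,
    _root_.map_add (pull (scale EB FE E t)) (X.toLin f * pull Φ η),
    _root_.map_mul (pull (scale EB FE E t)) (X.toLin f),
    _root_.map_mul (pull (scale EB FE E t)) (ofBase EB FE E f),
    pull_scale_ofBase, pull_pull_scale, pull_pull_scale, hd, h2,
    smul_mul_assoc t (X.toLin f), h3, mul_smul_comm t (ofBase EB FE E f)]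
  exact (smul_add t _ _).symm

theorem apply_ofBase (hL : X.IsExtension L) (f) : L (ofBase EB FE E f) = X.toLin f := by
  have h0 : d.toLin 1 = 0 := by
    have h1 := d.isSkewDerivation_of_sgn_eq sgn_one 1 1
    rw [one_mul (1 : SuperFun EB' FE' E'), mul_one (d.toLin 1),
      _root_.map_one (pull (scale EB' FE' E' (-1))), one_mul (d.toLin 1)] at h1
    exact left_eq_add.1 h1
  have h2 := hL.apply_mulPull (f ⊗ₜ 1)
  rwa [mulPull_tmul, extend_tmul, _root_.map_one (pull Φ), mul_one (ofBase EB FE E f),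
    mul_one (X.toLin f), h0, _root_.map_zero (pull Φ), mul_zero (ofBase EB FE E f),
    add_zero (X.toLin f)] at h2

theorem apply_pull (hL : X.IsExtension L) (η) : L (pull Φ η) = pull Φ (d.toLin η) := by
  have h := hL.apply_mulPull (1 ⊗ₜ η)
  rwa [mulPull_tmul, extend_tmul, X.map_one, _root_.map_one (ofBase EB FE E), one_mul (pull Φ η),
    one_mul (pull Φ (d.toLin η)), zero_mul (pull Φ η), zero_add (pull Φ (d.toLin η))] at h

theorem pull_comm (hL : X.IsExtension L) (hΦ : HasCoframes Φ) (Ψ : BundleMap EB B FE E EB B FE E)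
    (h1 : ∀ η, pull Ψ (pull Φ η) = pull Φ η)
    (h2 : ∀ f, pull Ψ (X.toLin f) = X.toLin (f.comp Ψ.base)) (η) :
    pull Ψ (L η) = L (pull Ψ η) := by
  refine (hL.pull_apply hΦ Ψ 1 (fun f η => ?_) η).trans (one_smul ℝ _)
  have h3 : pull Ψ (mulPull Φ (f ⊗ₜ η)) = mulPull Φ (f.comp Ψ.base ⊗ₜ η) := by
    rw [mulPull_tmul, mulPull_tmul, _root_.map_mul (pull Ψ) (ofBase EB FE E f), pull_ofBase, h1]
  rw [h3, hL.apply_mulPull, extend_tmul, extend_tmul,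
    _root_.map_add (pull Ψ) (X.toLin f * pull Φ η),
    _root_.map_mul (pull Ψ) (X.toLin f), _root_.map_mul (pull Ψ) (ofBase EB FE E f), h1, h1, h2,
    pull_ofBase]
  exact (one_smul ℝ _).symm

end IsExtension

variable (X) in
/-- A derivation of functions extends to an odd vector field on `ΠE` that is `Φ`-related to `d`. -/
theorem exists_superVect (hΦ : HasCoframes Φ) (hd : HasWeightOne d) :
    ∃ N : SuperVect EB FE E 1, HasWeightOne N ∧ (∀ f, N.toLin (ofBase EB FE E f) = X.toLin f) ∧
      (∀ η, N.toLin (pull Φ η) = pull Φ (d.toLin η)) ∧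
      ∀ Ψ : BundleMap EB B FE E EB B FE E, (∀ η, pull Ψ (pull Φ η) = pull Φ η) →
        (∀ f, pull Ψ (X.toLin f) = X.toLin (f.comp Ψ.base)) →
        ∀ η, pull Ψ (N.toLin η) = N.toLin (pull Ψ η) := by
  obtain ⟨L, hL⟩ := X.exists_linearMap hΦ
  replace hL : X.IsExtension L := hL
  refine ⟨⟨L, fun i a ha => ?_, fun i a ha b => ?_⟩, hL.pull_scale hΦ hd, hL.apply_ofBase,
    hL.apply_pull, hL.pull_comm hΦ⟩
  -- Oddness is the weight-one property at `t = -1`.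
  · rw [mem_parityPart_iff] at ha ⊢
    rw [hL.pull_scale hΦ hd, ha, L.map_smul, sgn_add, sgn_one, smul_smul, mul_comm]
  · rw [hL.isSkewDerivation hΦ, (mem_parityPart_iff i a).1 ha, smul_mul_assoc, one_mul]

end BaseDerivation

end Extension

/-! ### One-forms from local data -/

section Gluing

variable {EB : Type*} [NormedAddCommGroup EB] [NormedSpace ℝ EB]
  {B : Type*} [TopologicalSpace B] [ChartedSpace EB B]
  {FE : Type*} [NormedAddCommGroup FE] [NormedSpace ℝ FE]
  {E : B → Type*} [∀ b, AddCommMonoid (E b)] [∀ b, Module ℝ (E b)]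
  [TopologicalSpace (Bundle.TotalSpace FE E)] [∀ b, TopologicalSpace (E b)]
  [FiberBundle FE E]

/-- A form of degree one with given contractions exists if it exists locally. -/
theorem exists_form_of_local [∀ b, Module.IsReflexive ℝ (E b)]
    [∀ b, FiniteDimensional ℝ (Module.Dual ℝ (E b))] {ι : Type*} {s : ι → Sec EB FE E}
    (hs : ∀ b (v : E b), ∃ i, s i b = v) (g : ι → C^∞⟮𝓘(ℝ, EB), B; ℝ⟯)
    (h : ∀ b₀, ∃ η : SuperFun EB FE E, IsForm 1 η ∧ ∀ᶠ b in 𝓝 b₀, ∀ i,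
      ((contract (s i)).toLin η).1 b = (ofBase EB FE E (g i)).1 b) :
    ∃ η : SuperFun EB FE E, IsForm 1 η ∧
      ∀ i, (contract (s i)).toLin η = ofBase EB FE E (g i) := by
  choose η hη hg using h
  have mem : (fun b => (η b).1 b) ∈ SuperFun EB FE E := by
    intro b₀
    obtain ⟨k, hk, h⟩ := (η b₀).2 b₀
    refine ⟨k, hk, ?_⟩
    filter_upwards [h, hg b₀] with b hb hb2
    rw [← hb]
    -- At each `b` near `b₀` the local forms chosen at `b` and at `b₀` have the same contractions,
    -- hence agree. This uses that the neighbourhood in the hypothesis serves all `i` at once.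
    refine sub_eq_zero.1 (eq_zero_of_contractLeft_eval_eq_zero (k := 0)
      (sub_mem (hη b b) (hη b₀ b)) fun v => ?_)
    obtain ⟨i, rfl⟩ := hs b v
    rw [map_sub, ← contract_apply, ← contract_apply, hb2, (hg b).self_of_nhds, sub_self]
  exact ⟨⟨_, mem⟩, fun b => hη b b, fun i => superFun_ext fun b => (hg b).self_of_nhds i⟩

theorem contract_sum_ofBase_mul_ofCovector {n : ℕ} (s : Sec EB FE E)
    (c : Fin n → C^∞⟮𝓘(ℝ, EB), B; ℝ⟯) (θ : Fin n → Covector EB FE E) :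
    (contract s).toLin (∑ i, ofBase EB FE E (c i) * ofCovector EB FE E (θ i)) =
      ofBase EB FE E (∑ i, (θ i).eval s * c i) := by
  rw [map_sum, map_sum]
  refine Finset.sum_congr rfl fun i _ => superFun_ext fun b => ?_
  rw [contract_apply, ofBase_mul_apply, map_smul, map_mul, ← ofBase_mul_comm, ofBase_mul_apply,
    ← contract_apply, contract_ofCovector]

theorem isForm_add {k : ℕ} {η ζ : SuperFun EB FE E} (hη : IsForm k η) (hζ : IsForm k ζ) :
    IsForm k (η + ζ) := fun b => add_mem (hη b) (hζ b)

theorem IsForm.ofBase_mul {k : ℕ} {η : SuperFun EB FE E} (hη : IsForm k η)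
    (f : C^∞⟮𝓘(ℝ, EB), B; ℝ⟯) :
    IsForm k (ofBase EB FE E f * η) := fun b => by
  rw [ofBase_mul_apply]
  exact Submodule.smul_mem _ _ (hη b)

theorem IsForm.const_smul {k : ℕ} {η : SuperFun EB FE E} (hη : IsForm k η) (r : ℝ) :
    IsForm k (r • η) := fun b => Submodule.smul_mem _ r (hη b)

theorem contract_ofBase_mul (s : Sec EB FE E) (f : C^∞⟮𝓘(ℝ, EB), B; ℝ⟯) (η : SuperFun EB FE E) :
    (contract s).toLin (ofBase EB FE E f * η) = ofBase EB FE E f * (contract s).toLin η := by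
  refine superFun_ext fun b => ?_
  rw [contract_apply, ofBase_mul_apply, ofBase_mul_apply, map_smul]
  rfl

theorem IsForm.pull [VectorBundle ℝ FE E]
    {EB' : Type*} [NormedAddCommGroup EB'] [NormedSpace ℝ EB']
    {B' : Type*} [TopologicalSpace B'] [ChartedSpace EB' B']
    {FE' : Type*} [NormedAddCommGroup FE'] [NormedSpace ℝ FE']
    {E' : B' → Type*} [∀ b, AddCommMonoid (E' b)] [∀ b, Module ℝ (E' b)]
    [TopologicalSpace (Bundle.TotalSpace FE' E')] [∀ b, TopologicalSpace (E' b)]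
    [FiberBundle FE' E'] [VectorBundle ℝ FE' E']
    (Φ : BundleMap EB B FE E EB' B' FE' E') {k : ℕ} {η : SuperFun EB' FE' E'} (hη : IsForm k η) :
    IsForm k (pull Φ η) := by
  refine isForm_of_pull_scale ?_
  rw [pull_pull_scale, hη.pull_scale]
  exact (WeightedConn.pull Φ).toLinearMap.map_smul _ η

theorem IsForm.leibniz {k : ℕ} {η ζ : SuperFun EB FE E} (hη : IsForm k η) (hζ : IsForm k ζ)
    (f g : C^∞⟮𝓘(ℝ, EB), B; ℝ⟯) :
    IsForm k (η * ofBase EB FE E g + ofBase EB FE E f * ζ) := by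
  rw [← ofBase_mul_comm]
  exact isForm_add (hη.ofBase_mul g) (hζ.ofBase_mul f)

theorem contract_leibniz {s : Sec EB FE E} {η ζ : SuperFun EB FE E}
    {f g f' g' : C^∞⟮𝓘(ℝ, EB), B; ℝ⟯} (hη : (contract s).toLin η = ofBase EB FE E f')
    (hζ : (contract s).toLin ζ = ofBase EB FE E g') :
    (contract s).toLin (η * ofBase EB FE E g + ofBase EB FE E f * ζ) =
      ofBase EB FE E (f • g' + g • f') := by
  rw [← ofBase_mul_comm, (contract s).toLin.map_add, contract_ofBase_mul, contract_ofBase_mul, hη,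
    hζ, add_comm, smul_eq_mul, smul_eq_mul, map_add (ofBase EB FE E) (f * g'),
    map_mul (ofBase EB FE E) f, map_mul (ofBase EB FE E) g]

end Gluing

/-! ### Quasi-actions as families of one-forms -/

section Actions

variable {EM : Type*} [NormedAddCommGroup EM] [NormedSpace ℝ EM]
  {M : Type*} [TopologicalSpace M] [ChartedSpace EM M]
  {EF : Type*} [NormedAddCommGroup EF] [NormedSpace ℝ EF]
  {F : Type*} [TopologicalSpace F] [ChartedSpace EF F]
  {FA : Type*} [NormedAddCommGroup FA] [NormedSpace ℝ FA]
  {A : M → Type*} [∀ x, AddCommGroup (A x)] [∀ x, Module ℝ (A x)]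
  [TopologicalSpace (Bundle.TotalSpace FA A)] [∀ x, TopologicalSpace (A x)]
  [FiberBundle FA A] [VectorBundle ℝ FA A] [ContMDiffVectorBundle ∞ FA A 𝓘(ℝ, EM)]
  {D : LieAlgebroid EM FA A} {G : GradedBundle EM M EF F}
  {a : Sec EM FA A → Derivation ℝ C^∞⟮𝓘(ℝ, EF), F; ℝ⟯ C^∞⟮𝓘(ℝ, EF), F; ℝ⟯}
  (ha : IsQuasiAction D G a)

/-- A quasi-action, as a linear map. -/
def IsQuasiAction.toLinearMap : Sec EM FA A →ₗ[ℝ]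
    Derivation ℝ C^∞⟮𝓘(ℝ, EF), F; ℝ⟯ C^∞⟮𝓘(ℝ, EF), F; ℝ⟯ where
  toFun := a
  map_add' := ha.map_add
  map_smul' := ha.map_smul

variable [FiniteDimensional ℝ EM] [IsManifold 𝓘(ℝ, EM) ∞ M] [T2Space M]

include ha

/-- Linearity over `C^∞(M)` makes `a` local over `M`: with `χ = 1` near `τ p` and `χ u = 0`, the
value of `a u f` at `p` is that of `a (χ u) f = 0`. -/
theorem IsQuasiAction.apply_eq_zero {u : Sec EM FA A} {p : F}
    (hu : ∀ᶠ x in 𝓝 (G.τ p), u x = 0) (f : C^∞⟮𝓘(ℝ, EF), F; ℝ⟯) : a u f p = 0 := by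
  obtain ⟨χ, h1, h0⟩ := exists_bump (EB := EM) hu
  have hz : smulSec χ u = 0 := by
    refine ContMDiffSection.ext fun x => ?_
    change χ x • u x = 0
    by_cases hx : x ∈ tsupport χ
    · rw [h0 x hx, smul_zero]
    · rw [image_eq_zero_of_notMem_tsupport hx, zero_smul]
  have h2 := ha.map_smulSec χ u
  rw [hz] at h2
  have h3 : a u f p = χ (G.τ p) * a u f p := by rw [h1.self_of_nhds, one_mul]
  have h4 : χ (G.τ p) * a u f p = (χ.comp G.τ • a u) f p := rfl
  rw [h3, h4, ← h2]
  exact congrArg (fun X => X f p) ha.toLinearMap.map_zero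

/-- Tensoriality: the value at `p` depends on `u` only through `u (τ p)`, because `u` equals `∑
ξ_i(u) e_i` near `τ p`. -/
theorem IsQuasiAction.apply_eq_sum {n : ℕ} {e : Fin n → Sec EM FA A} {ξ : Fin n → Covector EM FA A}
    {p : F} (h : ∀ᶠ x in 𝓝 (G.τ p), IsDualAt e ξ x) (u : Sec EM FA A)
    (f : C^∞⟮𝓘(ℝ, EF), F; ℝ⟯) :
    a u f p = ∑ i, (ξ i).toFun (G.τ p) (u (G.τ p)) * a (e i) f p := by
  let v : Sec EM FA A := ∑ i, smulSec ((ξ i).eval u) (e i)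
  have h1 : a (u - v) f p = 0 := by
    refine ha.apply_eq_zero ?_ f
    filter_upwards [h] with x hx
    have : v x = u x := (sum_smulSec_apply _ _ _).trans (hx.sum_smul (u x))
    change u x - v x = 0
    rw [this, sub_self]
  have h2 : a (u - v) = a u - a v := ha.toLinearMap.map_sub u v
  rw [h2] at h1
  have h3 : a u f p = a v f p := sub_eq_zero.1 h1
  have h4 : a v = ∑ i, a (smulSec ((ξ i).eval u) (e i)) := map_sum ha.toLinearMap _ _
  rw [h3, h4]
  let ev : Derivation ℝ C^∞⟮𝓘(ℝ, EF), F; ℝ⟯ C^∞⟮𝓘(ℝ, EF), F; ℝ⟯ →+ ℝ :=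
    { toFun X := X f p
      map_zero' := rfl
      map_add' _ _ := rfl }
  refine (map_sum ev _ _).trans (Finset.sum_congr rfl fun i _ => ?_)
  change a (smulSec ((ξ i).eval u) (e i)) f p = _
  rw [ha.map_smulSec]
  rfl

variable [FiniteDimensional ℝ FA]

theorem IsQuasiAction.exists_form (f : C^∞⟮𝓘(ℝ, EF), F; ℝ⟯) :
    ∃ η : SuperFun EF FA (G.τ *ᵖ A), IsForm 1 η ∧
      ∀ u, (contract (G.pullSec u)).toLin η = ofBase EF FA (G.τ *ᵖ A) (a u f) := by
  have hA (x : M) : FiniteDimensional ℝ (A x) :=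
    Module.Finite.equiv ((trivializationAt FA A x).linearEquivAt ℝ x
      (FiberBundle.mem_baseSet_trivializationAt' _)).symm
  have h1 (p : F) : Module.IsReflexive ℝ ((G.τ *ᵖ A) p) :=
    inferInstanceAs (Module.IsReflexive ℝ (A (G.τ p)))
  have h2 (p : F) : FiniteDimensional ℝ (Module.Dual ℝ ((G.τ *ᵖ A) p)) :=
    inferInstanceAs (FiniteDimensional ℝ (Module.Dual ℝ (A (G.τ p))))
  refine exists_form_of_local (s := G.pullSec)
    (fun p v => exists_section_apply_eq (G.τ p) v) _ fun p => ?_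
  obtain ⟨e, ξ, hd⟩ := exists_frame EM FA A (G.τ p)
  -- The local formula `∑ a(e_i)(f) ξ_i`. Tensoriality gives its contraction with every section at
  -- all points near `p`, so the local forms glue.
  refine ⟨∑ i, ofBase EF FA (G.τ *ᵖ A) (a (e i) f) *
    ofCovector EF FA (G.τ *ᵖ A) (pullCovector (G.pA FA A) (ξ i)), ?_, ?_⟩
  · intro q
    rw [superFun_sum_apply]
    refine sum_mem fun i _ => ?_
    rw [ofBase_mul_apply]
    exact Submodule.smul_mem _ _ (isForm_ofCovector _ q)
  · filter_upwards [G.τ.contMDiff.continuous.continuousAt.eventually hd.eventually_nhds] with q hq u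
    rw [contract_sum_ofBase_mul_ofCovector]
    refine congrArg (algebraMap ℝ (ExteriorAlgebra ℝ (Module.Dual ℝ ((G.τ *ᵖ A) q)))) ?_
    refine Eq.trans ?_ (ha.apply_eq_sum hq u f).symm
    let ev : C^∞⟮𝓘(ℝ, EF), F; ℝ⟯ →+ ℝ :=
      { toFun g := g q
        map_zero' := rfl
        map_add' _ _ := rfl }
    exact map_sum ev _ _

end Actions

/-! ### The correspondence between connections and actions -/

section Bijection

variable {EM : Type*} [NormedAddCommGroup EM] [NormedSpace ℝ EM]
  {M : Type*} [TopologicalSpace M] [ChartedSpace EM M]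
  {EF : Type*} [NormedAddCommGroup EF] [NormedSpace ℝ EF]
  {F : Type*} [TopologicalSpace F] [ChartedSpace EF F]
  {FA : Type*} [NormedAddCommGroup FA] [NormedSpace ℝ FA]
  {A : M → Type*} [∀ x, AddCommGroup (A x)] [∀ x, Module ℝ (A x)]
  [TopologicalSpace (Bundle.TotalSpace FA A)] [∀ x, TopologicalSpace (A x)]
  [FiberBundle FA A] [VectorBundle ℝ FA A] [ContMDiffVectorBundle ∞ FA A 𝓘(ℝ, EM)]
  {D : LieAlgebroid EM FA A} {G : GradedBundle EM M EF F}
  {a : Sec EM FA A → Derivation ℝ C^∞⟮𝓘(ℝ, EF), F; ℝ⟯ C^∞⟮𝓘(ℝ, EF), F; ℝ⟯}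
  [FiniteDimensional ℝ EM] [IsManifold 𝓘(ℝ, EM) ∞ M] [T2Space M]
  [FiniteDimensional ℝ FA]

theorem hasCoframes_pA : BaseDerivation.HasCoframes (G.pA FA A) := by
  intro p
  obtain ⟨e, ξ, hd⟩ := exists_frame EM FA A (G.τ p)
  exact ⟨_, ξ, ⟨e, hd⟩, fun i => G.pullSec (e i),
    (G.τ.contMDiff.continuous.continuousAt.eventually hd).mono fun q hq => hq.pullback G⟩

variable [FiniteDimensional ℝ EF] [IsManifold 𝓘(ℝ, EF) ∞ F] [T2Space F]

/-- A quasi-action defines a derivation of `C^∞(F)` with values in forms on `τ*ΠA`. -/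
theorem IsQuasiAction.exists_baseDerivation (ha : IsQuasiAction D G a) :
    ∃ X : BaseDerivation (G.pA FA A) D.d,
      (∀ u f, (contract (G.pullSec u)).toLin (X.toLin f) = ofBase EF FA (G.τ *ᵖ A) (a u f)) ∧
      ∀ t f, pull (G.hA FA A t) (X.toLin f) = X.toLin (f.comp (G.hMap t)) := by
  -- The form `δ f` is determined by its contractions `a(u) f`, so every property of `δ` follows by
  -- contraction from the corresponding property of `a`.
  choose δ hδ hc using ha.exists_form
  have hadd (f g) : δ (f + g) = δ f + δ g := by
    refine eq_of_contract_pullSec G (hδ _) (isForm_add (hδ f) (hδ g)) fun u => ?_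
    rw [hc, (a u).map_add, (contract (G.pullSec u)).toLin.map_add, hc, hc]
    exact (ofBase EF FA (G.τ *ᵖ A)).toLinearMap.map_add _ _
  have hsmul (r : ℝ) (f) : δ (r • f) = r • δ f := by
    refine eq_of_contract_pullSec G (hδ _) ((hδ f).const_smul r) fun u => ?_
    rw [hc, (a u).map_smul, (contract (G.pullSec u)).toLin.map_smul, hc]
    exact (ofBase EF FA (G.τ *ᵖ A)).toLinearMap.map_smul _ _
  have hmul (f g) : δ (f * g) = δ f * ofBase EF FA (G.τ *ᵖ A) g +
      ofBase EF FA (G.τ *ᵖ A) f * δ g := by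
    exact eq_of_contract_pullSec G (hδ _) ((hδ f).leibniz (hδ g) f g) fun u =>
      ((hc _ u).trans (congrArg (ofBase EF FA (G.τ *ᵖ A)) ((a u).leibniz f g))).trans
        (contract_leibniz (hc f u) (hc g u)).symm
  have hcomp (g : C^∞⟮𝓘(ℝ, EM), M; ℝ⟯) :
      δ (g.comp G.τ) = pull (G.pA FA A) (D.d.toLin (ofBase EM FA A g)) := by
    refine eq_of_contract_pullSec G (hδ _)
      ((HasWeightOne.isForm D.weight (isForm_ofBase g)).pull (G.pA FA A)) fun u => ?_
    rw [hc, contract_pullSec_pull_pA, D.contract_d_ofBase, ha.projects]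
    exact (pull_ofBase (G.pA FA A) _).symm
  refine ⟨⟨{ toFun := δ, map_add' := hadd, map_smul' := hsmul }, hδ, hmul, hcomp⟩,
    fun u f => hc f u, fun t f => ?_⟩
  refine eq_of_contract_pullSec G ((hδ f).pull (G.hA FA A t)) (hδ _) fun u => ?_
  change (contract (G.pullSec u)).toLin (pull (G.hA FA A t) (δ f)) =
    (contract (G.pullSec u)).toLin (δ (f.comp (G.hMap t)))
  rw [contract_pullSec_pull_hA, hc, hc, ← ha.weight]
  exact pull_ofBase (G.hA FA A t) _

/-- Every quasi-action, with no condition on brackets, is the lift of a weighted connection.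
Commutation with `h_t` is inherited from `δ`, because `h_t` fixes everything pulled back from `ΠA`.
-/
theorem IsQuasiAction.exists_isWeightedConnection (ha : IsQuasiAction D G a) :
    ∃ N, IsWeightedConnection D G N ∧ horizontalLift N = a := by
  obtain ⟨X, hX, hXt⟩ := ha.exists_baseDerivation
  obtain ⟨N, h1, h2, h3, h4⟩ := X.exists_superVect hasCoframes_pA D.weight
  refine ⟨N, ⟨fun t η => h4 _ (pull_hA_pull_pA G t) (hXt t) η, h1, h3⟩, funext fun u =>
    Derivation.ext fun f => (horizontalLift_eq_iff h1 u f _).2 ?_⟩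
  rw [h2, hX]

/-- The bijection exists already between all weighted connections and all quasi-actions; the
curvature formula matches flatness with preservation of brackets. -/
theorem bijOn_horizontalLift :
    Set.BijOn (fun N : SuperVect EF FA (G.τ *ᵖ A) 1 => horizontalLift N)
      {N | IsWeightedConnection D G N ∧ IsFlat N} {a | IsAction D G a} := by
  refine ⟨fun N hN => ⟨hN.1.isQuasiAction, hN.1.isFlat_iff.1 hN.2⟩,
    fun N hN N' hN' h => hN.1.eq_of_horizontalLift_eq hN'.1 h, fun a ha => ?_⟩
  obtain ⟨N, hN, rfl⟩ := ha.toIsQuasiAction.exists_isWeightedConnection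
  exact ⟨N, ⟨hN, hN.isFlat_iff.2 ha.map_bracket⟩, rfl⟩

end Bijection

end WeightedConn

end

theorem theorem3p5
    {EM : Type*} [NormedAddCommGroup EM] [NormedSpace ℝ EM] [FiniteDimensional ℝ EM]
    {M : Type*} [TopologicalSpace M] [ChartedSpace EM M] [IsManifold 𝓘(ℝ, EM) ∞ M]
    [T2Space M] [SecondCountableTopology M]
    {EF : Type*} [NormedAddCommGroup EF] [NormedSpace ℝ EF] [FiniteDimensional ℝ EF]
    {F : Type*} [TopologicalSpace F] [ChartedSpace EF F] [IsManifold 𝓘(ℝ, EF) ∞ F]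
    [T2Space F] [SecondCountableTopology F]
    {FA : Type*} [NormedAddCommGroup FA] [NormedSpace ℝ FA] [FiniteDimensional ℝ FA]
    {A : M → Type*} [∀ x, AddCommGroup (A x)] [∀ x, Module ℝ (A x)]
    [TopologicalSpace (Bundle.TotalSpace FA A)] [∀ x, TopologicalSpace (A x)]
    [FiberBundle FA A] [VectorBundle ℝ FA A] [ContMDiffVectorBundle ∞ FA A 𝓘(ℝ, EM)]
    (D : LieAlgebroid EM FA A) (G : GradedBundle EM M EF F) :
    -- the bracket and the anchor of `A` are determined by `d_A`
    (∀ u v w : Sec EM FA A, w = D.bracket u v ↔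
      (contract w).toLin = (superBracket (superBracket D.d (contract u)) (contract v)).toLin) ∧
    (∀ (u : Sec EM FA A) (f : C^∞⟮𝓘(ℝ, EM), M; ℝ⟯),
      (superBracket D.d (contract u)).toLin (ofBase EM FA A f) =
        ofBase EM FA A (D.anchor u f)) ∧
    -- for every weighted connection `[∇, ι_u]` projects to `H_∇(u)`, and `H_∇` is a quasi-action
    (∀ N : SuperVect EF FA (G.τ *ᵖ A) 1, IsWeightedConnection D G N →
      (∀ (u : Sec EM FA A) (f : C^∞⟮𝓘(ℝ, EF), F; ℝ⟯),
        (liftBracket N u).toLin (ofBase EF FA (G.τ *ᵖ A) f) =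
          ofBase EF FA (G.τ *ᵖ A) (horizontalLift N u f)) ∧
      IsQuasiAction D G (horizontalLift N) ∧
      -- the curvature is the failure of `H_∇` to preserve brackets
      (∀ (u v : Sec EM FA A) (f : C^∞⟮𝓘(ℝ, EF), F; ℝ⟯),
        (superBracket (superBracket (superSq N) (contract (G.pullSec u)))
            (contract (G.pullSec v))).toLin (ofBase EF FA (G.τ *ᵖ A) f) =
          ofBase EF FA (G.τ *ᵖ A)
            ((horizontalLift N (D.bracket u v) - ⁅horizontalLift N u, horizontalLift N v⁆) f))) ∧
    -- the one-to-one correspondence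
    Set.BijOn (fun N : SuperVect EF FA (G.τ *ᵖ A) 1 => horizontalLift N)
      {N | IsWeightedConnection D G N ∧ IsFlat N} {a | IsAction D G a} := by
  refine ⟨D.eq_bracket_iff, fun u f => ?_, fun N hN =>
    ⟨fun u f => liftBracket_ofBase hN.hasWeightOne u f, hN.isQuasiAction, hN.curvature⟩,
    bijOn_horizontalLift⟩
  rw [superBracket_contract_ofBase, D.contract_d_ofBase]
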